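/- Let $d\in\{2,3\}$ and let $\Omega\subset\mathbb R^d$ be a bounded domain with Lipschitz boundary and outward unit normal $\boldsymbol n$. Let $\partial\Omega=\Gamma_{\rm Dir}\cup\Gamma_{\rm Diss}$ with $\Gamma_{\rm Dir},\Gamma_{\rm Diss}$ closed and disjoint, and let $\Gamma_{\rm Diss}$ be of class $C^{2,1}$. Let $\boldsymbol h\in C^1(\overline\Omega;\mathbb R^d)$ satisfy $\boldsymbol h\times\boldsymbol n=\boldsymbol 0$ on $\Gamma_{\rm Diss}$ (that is, $h_in_j=h_jn_i$ for all $i,j$). For $\boldsymbol x\in\Gamma_{\rm Diss}$ and $\boldsymbol\xi\in\mathbb C^d$ write $\boldsymbol\xi_N=(\boldsymbol\xi\cdot\boldsymbol n(\boldsymbol x))\boldsymbol n(\boldsymbol x)$ and $\boldsymbol\xi_T=\boldsymbol\xi-\boldsymbol\xi_N$, and let $A:\Gamma_{\rm Diss}\to\mathbb R^{d\times d}$ satisfy $A(\boldsymbol x)\boldsymbol\xi=a_T\boldsymbol\xi_T+a_N\boldsymbol\xi_N$ with real constants $a_T,a_N$. Notation: $(\nabla\boldsymbol v)_{j\ell}=\partial_j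 v_\ell$; $\varepsilon(\boldsymbol v)=\tfrac12(\nabla\boldsymbol v+(\nabla\boldsymbol v)^T)$; $(\boldsymbol h\,\varepsilon(\boldsymbol v))_\ell=\sum_j h_j\varepsilon(\boldsymbol v)_{j\ell}$; $((\nabla\boldsymbol h)\boldsymbol v)_j=\sum_\ell (\partial_jh_\ell)v_\ell$; $(\boldsymbol f,\boldsymbol g)_{\Gamma}=\int_\Gamma \boldsymbol f\cdot\overline{\boldsymbol g}$ with respect to surface measure; $\nabla_T\varphi=\nabla\varphi-(\nabla\varphi\cdot\boldsymbol n)\boldsymbol n$ and $\nabla_T\cdot\boldsymbol w=\sum_j(\nabla_Tw_j)_j$. On $\Gamma_{\rm Diss}$, $\boldsymbol v$ and $\nabla\boldsymbol v$ denote traces, and $\nabla_T\cdot\boldsymbol v_T$ is formed from the trace of $\nabla(\boldsymbol v_T)$, where $\boldsymbol v_T=\boldsymbol v-(\boldsymbol v\cdot\boldsymbol n)\boldsymbol n$ is defined near $\Gamma_{\rm Diss}$ by means of a $C^{1,1}$ extension of $\boldsymbol n$. Let $s\in(3/2,2]$ and let $\boldsymbol v:\Omega\to\mathbb C^d$ belong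 to $\boldsymbol H^s(\Omega)$ and have zero trace on $\Gamma_{\rm Dir}$. Then the traces of $\boldsymbol v$ and $\nabla\boldsymbol v$ on $\Gamma_{\rm Diss}$ and $\nabla_T\cdot\boldsymbol v_T$ exist in $L^2(\Gamma_{\rm Diss})$, and $$ \begin{aligned} (A\boldsymbol v,(\boldsymbol h\cdot\nabla)\boldsymbol v)_{\Gamma_{\rm Diss}} ={}&2(A\boldsymbol v,\boldsymbol h\,\varepsilon(\boldsymbol v))_{\Gamma_{\rm Diss}} +(A\boldsymbol v,(\nabla\boldsymbol h)\boldsymbol v)_{\Gamma_{\rm Diss}} +a_T\big((\boldsymbol h\cdot\boldsymbol n)(\nabla_T\cdot\boldsymbol v_T),\boldsymbol v\cdot\boldsymbol n\big)_{\Gamma_{\rm Diss}}\\ &-a_N\big((\boldsymbol v\cdot\boldsymbol n)\,(\boldsymbol n\cdot\nabla)\boldsymbol h,\boldsymbol v\big)_{\Gamma_{\rm Diss}} -a_N\big((\boldsymbol h\cdot\boldsymbol n)(\boldsymbol v\cdot\boldsymbol n),\varepsilon(\boldsymbol v)\boldsymbol n\cdot\boldsymbol n\big)_{\Gamma_{\rm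 Diss}}. \end{aligned} $$ -/

import Mathlib

open MeasureTheory Set Filter Topology
open scoped ContDiff ENNReal Matrix NNReal RealInnerProductSpace

noncomputable section

namespace RobinBoundary

/-- Euclidean space `ℝ^d`. -/
abbrev Space (d : ℕ) := EuclideanSpace ℝ (Fin d)

variable {d : ℕ}

/-! ### Domains, boundary regularity, normal, surface measure -/

/-- Near `x` the set `Ω` is the strict epigraph, in the direction of the unit vector `e`, of a
function `f` of the components orthogonal to `e`. -/
def IsLocalEpigraph (Ω : Set (Space d)) (x e : Space d) (f : Space d → ℝ) : Prop :=
  ‖e‖ = 1 ∧ ∀ᶠ y in 𝓝 x, (y ∈ Ω ↔ f (y - ⟪y, e⟫ • e) < ⟪y, e⟫)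

/-- A bounded domain (nonempty connected open set) with a Lipschitz boundary. -/
structure IsBoundedLipschitzDomain (Ω : Set (Space d)) : Prop where
  isOpen : IsOpen Ω
  isConnected : IsConnected Ω
  isBounded : Bornology.IsBounded Ω
  lipschitz_boundary : ∀ x ∈ frontier Ω, ∃ (e : Space d) (f : Space d → ℝ) (K : ℝ≥0),
    LipschitzWith K f ∧ IsLocalEpigraph Ω x e f

/-- The part `Γ` of the boundary of `Ω` is of class `C^{2,1}`: around each of its points `Ω` is the
epigraph of a `C²` function whose second derivative is Lipschitz continuous. -/
def IsC21Boundary (Ω Γ : Set (Space d)) : Prop :=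
  ∀ x ∈ Γ, ∃ (e : Space d) (f : Space d → ℝ) (K : ℝ≥0),
    ContDiff ℝ 2 f ∧ LipschitzWith K (iteratedFDeriv ℝ 2 f) ∧ IsLocalEpigraph Ω x e f

/-- `ν` is the outward unit normal to `Ω` at the boundary point `x`: up to arbitrarily thin cones,
`Ω` looks near `x` like the half space `{y | ⟪y - x, ν⟫ < 0}`. -/
def IsOutwardUnitNormal (Ω : Set (Space d)) (x ν : Space d) : Prop :=
  ‖ν‖ = 1 ∧ ∀ δ : ℝ, 0 < δ → ∀ᶠ y in 𝓝 x,
    (⟪y - x, ν⟫ < -(δ * ‖y - x‖) → y ∈ Ω) ∧ (δ * ‖y - x‖ < ⟪y - x, ν⟫ → y ∉ Ω)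

/-- The outward unit normal field (it exists and is unique where the boundary is `C¹`). -/
def outwardNormal (Ω : Set (Space d)) (x : Space d) : Space d :=
  Classical.epsilon (IsOutwardUnitNormal Ω x)

/-- The surface measure of `Γ`: the normalised `(d-1)`-dimensional Hausdorff measure on `Γ`. -/
def surface (Γ : Set (Space d)) : Measure (Space d) :=
  (Measure.euclideanHausdorffMeasure (d - 1)).restrict Γ

/-- The inner product `(f, g)_Γ = ∫_Γ f · conj g` of vector fields on `Γ`. -/
def bdInner (Γ : Set (Space d)) (f g : Space d → Fin d → ℂ) : ℂ :=
  ∫ x, f x ⬝ᵥ star (g x) ∂(surface Γ)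

/-- The inner product `(f, g)_Γ = ∫_Γ f conj g` of scalar functions on `Γ`. -/
def bdInnerScalar (Γ : Set (Space d)) (f g : Space d → ℂ) : ℂ :=
  ∫ x, f x * star (g x) ∂(surface Γ)

/-! ### Weak derivatives, Sobolev spaces, traces -/

/-- `g` is the weak derivative `∂_i u` on the open set `U`. -/
def IsWeakPartial (U : Set (Space d)) (i : Fin d) (u g : Space d → ℂ) : Prop :=
  LocallyIntegrableOn u U ∧ LocallyIntegrableOn g U ∧
    ∀ φ : Space d → ℝ, ContDiff ℝ ∞ φ → HasCompactSupport φ → tsupport φ ⊆ U →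
      ∫ x in U, (fderiv ℝ φ x (EuclideanSpace.single i 1) : ℂ) * u x
        = -∫ x in U, (φ x : ℂ) * g x

/-- `u ∈ L²(U)`. -/
def MemL2 (U : Set (Space d)) (u : Space d → ℂ) : Prop :=
  MemLp u 2 (volume.restrict U)

/-- `u ∈ H^s(U)` for `1 < s ≤ 2`: `u` and its weak first derivatives `g` are in `L²(U)` and, when
`s < 2`, `∬ |g(x) - g(y)|² / |x - y|^{2s+d-2} dy dx < ∞`, while, when `s = 2`, the weak first
derivatives of `g` are in `L²(U)`. -/
def MemHs (U : Set (Space d)) (s : ℝ) (u : Space d → ℂ) : Prop :=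
  MemL2 U u ∧ ∀ i, ∃ g, IsWeakPartial U i u g ∧ MemL2 U g ∧
    (s < 2 → ∫⁻ x in U, ∫⁻ y in U,
      ‖g x - g y‖ₑ ^ (2 : ℝ) / ‖x - y‖ₑ ^ (2 * s + d - 2) < ⊤) ∧
    (s = 2 → ∀ j, ∃ k, IsWeakPartial U j g k ∧ MemL2 U k)

/-- `a` is the trace at the boundary point `x` of the function `u` defined on `U`: the mean over
`B(x,r) ∩ U` of `|u - a|` tends to `0` as `r → 0`. -/
def HasTraceAt (U : Set (Space d)) (u : Space d → ℂ) (x : Space d) (a : ℂ) : Prop :=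
  Tendsto (fun r : ℝ => laverage (volume.restrict (Metric.ball x r ∩ U)) fun y => ‖u y - a‖ₑ)
    (𝓝[>] 0) (𝓝 0)

/-- `b ∈ L²(Γ)` is the trace on `Γ` of the function `u` defined on `U`. -/
def IsTrace (U Γ : Set (Space d)) (u b : Space d → ℂ) : Prop :=
  MemLp b 2 (surface Γ) ∧ ∀ᵐ x ∂(surface Γ), HasTraceAt U u x (b x)

/-- `b ∈ L²(Γ)^d` is the trace on `Γ` of the vector field `v` defined on `U`. -/
def IsVectorTrace (U Γ : Set (Space d)) (v b : Space d → Fin d → ℂ) : Prop :=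
  ∀ j, IsTrace U Γ (fun x => v x j) (fun x => b x j)

/-- `G ∈ L²(Γ)^{d×d}` is the trace on `Γ` of the weak gradient `(∇v)_{ij} = ∂_i v_j` on `U`. -/
def IsGradientTrace (U Γ : Set (Space d)) (v : Space d → Fin d → ℂ)
    (G : Space d → Matrix (Fin d) (Fin d) ℂ) : Prop :=
  ∀ i j, ∃ g, IsWeakPartial U i (fun x => v x j) g ∧ IsTrace U Γ g (fun x => G x i j)

/-- `v ∈ H^1_{Γ_Dir}(Ω)^d ∩ H^s(Ω)^d` (for `1 < s ≤ 2`, where `H^s ⊆ H^1`). -/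
def MemHsDir (Ω ΓDir : Set (Space d)) (s : ℝ) (v : Space d → Fin d → ℂ) : Prop :=
  (∀ j, MemHs Ω s (fun x => v x j)) ∧ IsVectorTrace Ω ΓDir v 0

/-! ### Vector calculus on the boundary -/

/-- A real vector seen as a complex one. -/
def toC (w : Space d) : Fin d → ℂ := fun j => (w j : ℂ)

/-- The normal component `ξ · ν`. -/
def normalComp (ν : Space d) (ξ : Fin d → ℂ) : ℂ := ξ ⬝ᵥ toC ν

/-- The normal part `ξ_N = (ξ · ν) ν`. -/
def normalPart (ν : Space d) (ξ : Fin d → ℂ) : Fin d → ℂ := normalComp ν ξ • toC ν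

/-- The tangential part `ξ_T = ξ - ξ_N`. -/
def tangentialPart (ν : Space d) (ξ : Fin d → ℂ) : Fin d → ℂ := ξ - normalPart ν ξ

/-- The tangential divergence of a field with gradient `D_{ij} = ∂_i w_j` at a point with unit
normal `ν`: `∑_j (∇_T w_j)_j`, where `∇_T φ = ∇φ - (∇φ · ν) ν`. -/
def tangentialDiv (ν : Space d) (D : Matrix (Fin d) (Fin d) ℂ) : ℂ :=
  ∑ j, tangentialPart ν (fun i => D i j) j

/-- `q` is the tangential divergence `∇_T · v_T` on `Γ`: the normal is extended to a `C^{1,1}` field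
`N` on a neighbourhood `V` of `Γ`, the field `v_T = v - (v · N) N` is formed on `Ω ∩ V`, and `q` is
obtained from the trace `D` of its gradient. -/
def IsTangentialDivTrace (Ω Γ : Set (Space d)) (v : Space d → Fin d → ℂ) (q : Space d → ℂ) : Prop :=
  ∃ (V : Set (Space d)) (N : Space d → Space d) (K : ℝ≥0)
    (D : Space d → Matrix (Fin d) (Fin d) ℂ),
    IsOpen V ∧ Γ ⊆ V ∧ ContDiffOn ℝ 1 N V ∧ LipschitzOnWith K (fderiv ℝ N) V ∧
    (∀ x ∈ Γ, N x = outwardNormal Ω x) ∧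
    IsGradientTrace (Ω ∩ V) Γ (fun x => tangentialPart (N x) (v x)) D ∧
    ∀ x ∈ Γ, q x = tangentialDiv (outwardNormal Ω x) (D x)

/-- The strain `ε = (∇v + (∇v)ᵀ) / 2`, from the gradient. -/
def strain (G : Matrix (Fin d) (Fin d) ℂ) : Matrix (Fin d) (Fin d) ℂ :=
  (1 / 2 : ℂ) • (G + Gᵀ)

/-- The gradient `(∇h)_{ij} = ∂_i h_j` at a point of the closure of `Ω`, for `h ∈ C¹(closure Ω)`. -/
def gradC (Ω : Set (Space d)) (h : Space d → Space d) (x : Space d) :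
    Matrix (Fin d) (Fin d) ℂ :=
  Matrix.of fun i j => (fderivWithin ℝ h (closure Ω) x (EuclideanSpace.single i 1) j : ℂ)

end RobinBoundary

end

open RobinBoundary

/-!
The identity is a divergence theorem on `ΓDiss`, combined with pointwise algebra.

*Pointwise algebra.* On `ΓDiss` the condition `h × n = 0` means `h = β n` with `β = h · n`.
Splitting `A v = a_T v_T + a_N (v · n) n`, the normal parts of the two sides agree at every point,
and the tangential parts differ by `a_T` times

  `v_T · conj ((∇h) v + (∇v) h) + (h · conj v) (∇_T · v_T)`

(`impedance_identity`). The first summand is `v_T · ∇φ` for `φ = h · conj v`, so that this is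
formally the tangential divergence of the tangential field `φ v_T`, whose integral over `ΓDiss`
vanishes because `ΓDiss` has no boundary: it is closed and separated from `ΓDir`.

*The divergence theorem.* It is used in the form that each operator `n_i ∂_j - n_j ∂_i` has mean
value zero on `ΓDiss`, even for products `m a conj c` of a function `m ∈ C¹(closure Ω)` with
traces `a` and `c` (`IsSmoothPiece.integral_rotForm`). For `C¹` functions on a graph it is
Fubini's theorem and the fundamental theorem of calculus in the parametrising hyperplane
(`GraphData.integral_graph_rot`), where the surface measure is computed by an area formula for
expanding maps (`euclideanHausdorffMeasure_image_eq_lintegral`); functions of class `C¹` only up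
to the boundary are shifted into `Ω` first (`IsChart.integral_rot_smul`). Sobolev functions are
replaced by their averages over small balls inside a cone, which are smooth and
converge in `L²(ΓDiss)` with their gradients. A partition of unity adds up the local formulas.
Applied to `m = n_i h_k (δ_{jl} - n_j n_l)`, with an extension `n` of the normal field, and summed
over the indices, the formula becomes the divergence theorem for `φ v_T`
(`IsSmoothPiece.integral_tangentialDiv_eq_zero`); the derivatives of the extension drop out
because `n` has length one on `ΓDiss`, so that `∑ i, n_i ∂n_i` is normal there
(`sum_normal_curl`).

*Traces.* Near `ΓDiss`, every point of `Ω` within `r` of a boundary point `x` sees inside `Ω` the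
whole ball of radius `r` around `x + M r e` (`ConeCondition`). The mean oscillation of a function
between these two sets is bounded, after integration over `ΓDiss`, by a positive power of `r`,
both for functions with a finite Gagliardo seminorm of order larger than `1/2` and for functions
with a square integrable gradient. Hence the averages over geometrically shrinking balls converge
in `L²(ΓDiss)` and almost everywhere, and the limit is the trace (`exists_trace_of_coneOsc`). For
`v ∈ H^s` with `s > 3/2` this applies to `v` and to its first weak derivatives.
-/

/-! ### The area formula for expanding parametrisations -/

section AreaFormula

open Measure Metric

variable {X Y Z : Type*} [MetricSpace X] [MeasurableSpace X] [BorelSpace X]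
  [MetricSpace Y] [MeasurableSpace Y] [BorelSpace Y]

theorem euclideanHausdorffMeasure_image_le (n : ℕ) {f : X → Y} {K : ℝ≥0} {s : Set X}
    (hf : LipschitzOnWith K f s) : μHE[n] (f '' s) ≤ (K : ℝ≥0∞) ^ n * μHE[n] s := by
  simp only [euclideanHausdorffMeasure_def, Measure.smul_apply, ENNReal.smul_def, smul_eq_mul]
  have := hf.hausdorffMeasure_image_le (d := n) (by positivity)
  rw [ENNReal.rpow_natCast] at this
  calc _ ≤ _ := mul_le_mul_right this _
    _ = _ := by ring

/-- A comparison of the measures of two images of the same set: the map `g x ↦ f x` is Lipschitz. -/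
theorem euclideanHausdorffMeasure_image_le_image (n : ℕ) {f : Z → Y} {g : Z → X} {K : ℝ≥0}
    {s : Set Z} (h : ∀ x ∈ s, ∀ y ∈ s, dist (f x) (f y) ≤ K * dist (g x) (g y)) :
    μHE[n] (f '' s) ≤ (K : ℝ≥0∞) ^ n * μHE[n] (g '' s) := by
  rcases s.eq_empty_or_nonempty with rfl | ⟨z₀, _⟩
  · simp
  have : Nonempty Z := ⟨z₀⟩
  have key : f '' s = (f ∘ Function.invFunOn g s) '' (g '' s) := by
    ext y
    constructor
    · rintro ⟨x, hx, rfl⟩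
      have h1 := Function.invFunOn_mem (f := g) (s := s) ⟨x, hx, rfl⟩
      have h2 := Function.invFunOn_eq (f := g) (s := s) ⟨x, hx, rfl⟩
      refine ⟨g x, ⟨x, hx, rfl⟩, ?_⟩
      have := h _ h1 x hx
      rw [h2, dist_self, mul_zero] at this
      exact dist_le_zero.1 this
    · rintro ⟨_, ⟨x, hx, rfl⟩, rfl⟩
      exact ⟨_, Function.invFunOn_mem (f := g) (s := s) ⟨x, hx, rfl⟩, rfl⟩
  rw [key]
  refine euclideanHausdorffMeasure_image_le n (LipschitzOnWith.of_dist_le_mul ?_)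
  rintro _ ⟨x, hx, rfl⟩ _ ⟨y, hy, rfl⟩
  have h2 := Function.invFunOn_eq (f := g) (s := s) ⟨x, hx, rfl⟩
  have h2' := Function.invFunOn_eq (f := g) (s := s) ⟨y, hy, rfl⟩
  have := h _ (Function.invFunOn_mem (f := g) (s := s) ⟨x, hx, rfl⟩) _
    (Function.invFunOn_mem (f := g) (s := s) ⟨y, hy, rfl⟩)
  rwa [h2, h2'] at this

variable {W E : Type*} [NormedAddCommGroup W] [InnerProductSpace ℝ W] [FiniteDimensional ℝ W]
  [MeasurableSpace W] [BorelSpace W] [NormedAddCommGroup E] [InnerProductSpace ℝ E]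
  [MeasurableSpace E] [BorelSpace E]

/-- **Area formula** for a `C¹` map that does not decrease distances: its image measure has the
density `normDet (fderiv Φ)`. The density is found by differentiation of measures, since on a small
ball `Φ` is up to a factor `1 + ε` as far from an isometry as its derivative. -/
theorem euclideanHausdorffMeasure_image_eq_lintegral {Φ : W → E} (hΦ : ContDiff ℝ 1 Φ)
    (hexp : ∀ a b, dist a b ≤ dist (Φ a) (Φ b)) {A : Set W} (hA : MeasurableSet A) :
    μHE[Module.finrank ℝ W] (Φ '' A)
      = ∫⁻ w in A, ENNReal.ofReal (fderiv ℝ Φ w : W →ₗ[ℝ] E).normDet := by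
  set n := Module.finrank ℝ W with hn
  have hinj : Function.Injective Φ := fun a b hab => by
    have := hexp a b
    rw [hab, dist_self] at this
    exact dist_le_zero.1 this
  have hemb : MeasurableEmbedding Φ := hΦ.continuous.measurableEmbedding hinj
  set ν : Measure W := Measure.comap Φ (μHE[n]) with hν
  have hνa : ∀ s, ν s = μHE[n] (Φ '' s) := fun s => hemb.comap_apply _ s
  have hvol : (μHE[n] : Measure W) = volume :=
    InnerProductSpace.euclideanHausdorffMeasure_eq_volume
  have hloc : ∀ w, ∃ K : ℝ≥0, ∃ t ∈ 𝓝 w, LipschitzOnWith K Φ t := fun w =>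
    hΦ.contDiffAt.exists_lipschitzOnWith
  have : IsLocallyFiniteMeasure ν := by
    refine ⟨fun w => ?_⟩
    obtain ⟨K, t, ht, hK⟩ := hloc w
    obtain ⟨r, hr, hrt⟩ := Metric.nhds_basis_ball.mem_iff.1 ht
    refine ⟨ball w r, ball_mem_nhds _ hr, ?_⟩
    rw [hνa]
    refine (euclideanHausdorffMeasure_image_le n (hK.mono hrt)).trans_lt ?_
    rw [hvol]
    exact ENNReal.mul_lt_top (by simp) measure_ball_lt_top
  have hac : ν ≪ volume := by
    intro s hs
    refine measure_null_of_locally_null s fun w _ => ?_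
    obtain ⟨K, t, ht, hK⟩ := hloc w
    refine ⟨s ∩ t, inter_mem_nhdsWithin s ht, ?_⟩
    rw [hνa]
    refine le_antisymm ((euclideanHausdorffMeasure_image_le n
      (hK.mono inter_subset_right)).trans ?_) bot_le
    rw [hvol, measure_mono_null inter_subset_left hs, mul_zero]
  have hR : ∀ᵐ w ∂(volume : Measure W), ν.rnDeriv volume w
      = ENNReal.ofReal (fderiv ℝ Φ w : W →ₗ[ℝ] E).normDet := by
    filter_upwards [Besicovitch.ae_tendsto_rnDeriv ν volume] with w hw
    set L := fderiv ℝ Φ w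
    set R := ν.rnDeriv volume w
    set J := ENNReal.ofReal (L : W →ₗ[ℝ] E).normDet
    have hL : HasStrictFDerivAt Φ L w := hΦ.contDiffAt.hasStrictFDerivAt one_ne_zero
    have hLexp : ∀ v, ‖v‖ ≤ ‖L v‖ := by
      intro v
      have h1 : Tendsto (fun t : ℝ => t⁻¹ • (Φ (w + t • v) - Φ w)) (𝓝[≠] 0) (𝓝 (L v)) := by
        have := hL.hasFDerivAt.hasLineDerivAt v
        exact hasDerivAt_iff_tendsto_slope_zero.1 this |>.congr fun t => by simp
      refine ge_of_tendsto h1.norm ?_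
      filter_upwards [self_mem_nhdsWithin] with t ht
      have := hexp (w + t • v) w
      rw [dist_eq_norm, dist_eq_norm, add_sub_cancel_left, norm_smul] at this
      have ht' : 0 < ‖t‖ := norm_pos_iff.2 ht
      rw [norm_smul, norm_inv]
      rw [inv_mul_eq_div, le_div_iff₀ ht']
      linarith
    have hJ : ∀ s : Set W, μHE[n] (L '' s) = J * volume s := fun s =>
      LinearMap.euclideanHausdorffMeasure_image_eq_normDet_mul_volume (L : W →ₗ[ℝ] E) s
    have hbd : ∀ ε : ℝ≥0, 0 < ε → R ≤ (1 + ε : ℝ≥0∞) ^ n * J ∧ J ≤ (1 + ε : ℝ≥0∞) ^ n * R := by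
      intro ε hε
      obtain ⟨t, ht, happ⟩ := hL.approximates_deriv_on_nhds (c := ε) (Or.inr hε)
      obtain ⟨δ, hδ, hδt⟩ := Metric.nhds_basis_closedBall.mem_iff.1 ht
      have hev : ∀ᶠ r in 𝓝[>] (0 : ℝ), closedBall w r ⊆ t ∧ 0 < r := by
        filter_upwards [Ioc_mem_nhdsGT hδ] with r hr
        exact ⟨(closedBall_subset_closedBall hr.2).trans hδt, hr.1⟩
      have hcast : ((1 + ε : ℝ≥0) : ℝ≥0∞) = 1 + ε := by push_cast; rfl
      have est : ∀ a ∈ t, ∀ b ∈ t, dist (Φ a) (Φ b) ≤ (1 + ε : ℝ≥0) * dist (L a) (L b) ∧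
          dist (L a) (L b) ≤ (1 + ε : ℝ≥0) * dist (Φ a) (Φ b) := by
        intro a ha b hb
        have h1 := happ a ha b hb
        have h2 := hLexp (a - b)
        have h3 := hexp a b
        have h4 : dist (L a) (L b) = ‖L (a - b)‖ := by rw [dist_eq_norm, map_sub]
        rw [h4]
        rw [dist_eq_norm] at h3 ⊢
        rw [dist_eq_norm] at h3
        have h5 : ‖Φ a - Φ b‖ ≤ ‖Φ a - Φ b - L (a - b)‖ + ‖L (a - b)‖ := by
          simpa using norm_add_le (Φ a - Φ b - L (a - b)) (L (a - b))
        have h6 : ‖L (a - b)‖ ≤ ‖Φ a - Φ b‖ + ‖Φ a - Φ b - L (a - b)‖ := by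
          simpa using norm_sub_le (Φ a - Φ b) (Φ a - Φ b - L (a - b))
        have hε' : (0 : ℝ) < ε := hε
        push_cast
        constructor <;> nlinarith
      constructor
      · refine le_of_tendsto hw ?_
        filter_upwards [hev] with r hr
        rw [ENNReal.div_le_iff (measure_closedBall_pos _ _ hr.2).ne' measure_closedBall_lt_top.ne,
          hνa, mul_assoc, ← hJ, ← hcast]
        exact euclideanHausdorffMeasure_image_le_image n fun x hx y hy =>
          (est x (hr.1 hx) y (hr.1 hy)).1
      · refine ge_of_tendsto (ENNReal.Tendsto.const_mul hw
          (Or.inr (ENNReal.pow_ne_top (by simp)))) ?_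
        filter_upwards [hev] with r hr
        rw [← mul_div_assoc,
          ENNReal.le_div_iff_mul_le (Or.inl (measure_closedBall_pos _ _ hr.2).ne')
            (Or.inl measure_closedBall_lt_top.ne), ← hJ, hνa, ← hcast]
        exact euclideanHausdorffMeasure_image_le_image n fun x hx y hy =>
          (est x (hr.1 hx) y (hr.1 hy)).2
    have hlim : ∀ Q : ℝ≥0∞, Tendsto (fun ε : ℝ≥0 => (1 + ε : ℝ≥0∞) ^ n * Q) (𝓝[>] 0) (𝓝 Q) := by
      intro Q
      have h0 : Tendsto (fun ε : ℝ≥0 => (1 + ε : ℝ≥0∞) ^ n) (𝓝[>] 0) (𝓝 1) := by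
        have : Continuous fun ε : ℝ≥0 => (((1 + ε) ^ n : ℝ≥0) : ℝ≥0∞) := by fun_prop
        have := (this.tendsto 0).mono_left (nhdsWithin_le_nhds (s := Ioi 0))
        simpa using this
      simpa using ENNReal.Tendsto.mul_const h0 (Or.inl one_ne_zero)
    refine le_antisymm (ge_of_tendsto (hlim J) ?_) (ge_of_tendsto (hlim R) ?_)
    · filter_upwards [self_mem_nhdsWithin] with ε hε using (hbd ε hε).1
    · filter_upwards [self_mem_nhdsWithin] with ε hε using (hbd ε hε).2
  rw [← hνa, ← Measure.withDensity_rnDeriv_eq ν volume hac, withDensity_apply _ hA]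
  exact lintegral_congr_ae (ae_restrict_of_ae hR)

end AreaFormula

/-! ### Graphs over hyperplanes and their surface measure -/

/-- A `C²` graph over the hyperplane orthogonal to the unit vector `e`. The height function `g` is
defined on the whole space and does not depend on the component along `e`. -/
structure GraphData (d : ℕ) where
  /-- the vertical direction -/
  e : Space d
  /-- the height function -/
  g : Space d → ℝ
  norm_e : ‖e‖ = 1
  contDiff : ContDiff ℝ 2 g
  shift : ∀ y (t : ℝ), g (y + t • e) = g y

namespace GraphData

variable {d : ℕ} (G : GraphData d)

theorem inner_e_e : ⟪G.e, G.e⟫ = 1 := by rw [real_inner_self_eq_norm_sq, G.norm_e]; norm_num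

theorem differentiable : Differentiable ℝ G.g := G.contDiff.differentiable two_ne_zero

/-- The gradient of the height function. -/
noncomputable def slope (y : Space d) : Space d := gradient G.g y

/-- The defining function of the graph, negative above the graph. -/
noncomputable def height (y : Space d) : ℝ := G.g y - ⟪y, G.e⟫

/-- The area density of the graph. -/
noncomputable def jac (y : Space d) : ℝ := √(1 + ‖G.slope y‖ ^ 2)

/-- The unit normal of the graph that points downwards. -/
noncomputable def normal (y : Space d) : Space d := (G.jac y)⁻¹ • (G.slope y - G.e)

/-- The parametrisation of the graph by the hyperplane orthogonal to `e`. -/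
noncomputable def par (w : (ℝ ∙ G.e)ᗮ) : Space d := w + G.g w • G.e

theorem fderiv_apply (y p : Space d) : fderiv ℝ G.g y p = ⟪G.slope y, p⟫ := by
  rw [slope, gradient, InnerProductSpace.toDual_symm_apply]

theorem innerSL_slope (y : Space d) : innerSL ℝ (G.slope y) = fderiv ℝ G.g y := by
  ext p
  simp [G.fderiv_apply]

theorem slope_shift (y : Space d) (t : ℝ) : G.slope (y + t • G.e) = G.slope y := by
  have h : (fun z => G.g (z + t • G.e)) = G.g := funext fun z => G.shift z t
  have : fderiv ℝ G.g (y + t • G.e) = fderiv ℝ G.g y := by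
    rw [← fderiv_comp_add_right, h]
  rw [slope, slope, gradient, gradient, this]

theorem inner_slope_e (y : Space d) : ⟪G.slope y, G.e⟫ = 0 := by
  rw [← G.fderiv_apply]
  have h1 : HasDerivAt (fun t : ℝ => G.g (y + t • G.e)) (fderiv ℝ G.g y G.e) 0 :=
    (G.differentiable y).hasFDerivAt.hasLineDerivAt G.e
  have h2 : HasDerivAt (fun t : ℝ => G.g (y + t • G.e)) 0 0 := by
    simp only [G.shift]
    exact hasDerivAt_const _ _
  exact h1.unique h2

theorem jac_pos (y : Space d) : 0 < G.jac y := Real.sqrt_pos.2 (by positivity)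

theorem norm_slope_sub_sq (y : Space d) : ‖G.slope y - G.e‖ ^ 2 = 1 + ‖G.slope y‖ ^ 2 := by
  rw [norm_sub_sq_real, G.inner_slope_e, G.norm_e]
  ring

theorem jac_eq (y : Space d) : G.jac y = ‖G.slope y - G.e‖ := by
  rw [jac, ← G.norm_slope_sub_sq, Real.sqrt_sq (norm_nonneg _)]

theorem norm_normal (y : Space d) : ‖G.normal y‖ = 1 := by
  rw [normal, norm_smul, ← G.jac_eq, norm_inv, Real.norm_of_nonneg (G.jac_pos y).le,
    inv_mul_cancel₀ (G.jac_pos y).ne']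

theorem jac_smul_normal (y : Space d) : G.jac y • G.normal y = G.slope y - G.e := by
  rw [normal, smul_smul, mul_inv_cancel₀ (G.jac_pos y).ne', one_smul]

theorem continuous_slope : Continuous G.slope :=
  (InnerProductSpace.toDual ℝ _).symm.continuous.comp
    (G.contDiff.continuous_fderiv two_ne_zero)

theorem contDiff_slope : ContDiff ℝ 1 G.slope :=
  (InnerProductSpace.toDual ℝ (Space d)).symm.toContinuousLinearEquiv.contDiff.comp
    (G.contDiff.fderiv_right (by norm_num))

theorem continuous_jac : Continuous G.jac := by
  have := G.continuous_slope
  unfold jac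
  fun_prop

theorem continuous_height : Continuous G.height := by
  have := G.differentiable.continuous
  unfold height
  fun_prop

theorem hasFDerivAt_height (y : Space d) :
    HasFDerivAt G.height (innerSL ℝ (G.slope y - G.e)) y := by
  have h1 := (G.differentiable y).hasFDerivAt
  have h2 : HasFDerivAt (fun z : Space d => ⟪z, G.e⟫) (innerSL ℝ G.e) y := by
    have := (innerSL ℝ G.e).hasFDerivAt (x := y)
    refine this.congr_of_eventuallyEq (Eventually.of_forall fun z => ?_)
    simp [real_inner_comm]
  rw [map_sub, G.innerSL_slope]
  exact h1.sub h2

theorem height_shift (y : Space d) (t : ℝ) : G.height (y + t • G.e) = G.height y - t := by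
  simp only [height, G.shift, inner_add_left, inner_smul_left, G.inner_e_e]
  simp
  ring

theorem inner_coe_e (w : (ℝ ∙ G.e)ᗮ) : ⟪(w : Space d), G.e⟫ = 0 := by
  rw [real_inner_comm]
  exact Submodule.mem_orthogonal_singleton_iff_inner_right.1 w.2

theorem height_par (w : (ℝ ∙ G.e)ᗮ) : G.height (G.par w) = 0 := by
  rw [par, G.height_shift, height, inner_coe_e]
  ring

theorem slope_par (w : (ℝ ∙ G.e)ᗮ) : G.slope (G.par w) = G.slope w := G.slope_shift _ _

theorem par_proj {y : Space d} (hy : G.height y = 0) :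
    G.par ((ℝ ∙ G.e)ᗮ.orthogonalProjectionOnto y) = y := by
  have h1 : (((ℝ ∙ G.e)ᗮ.orthogonalProjectionOnto y : (ℝ ∙ G.e)ᗮ) : Space d)
      = y + (-⟪y, G.e⟫) • G.e := by
    change (ℝ ∙ G.e)ᗮ.starProjection y = _
    rw [Submodule.starProjection_orthogonal_val,
      Submodule.starProjection_unit_singleton ℝ G.norm_e, real_inner_comm, neg_smul,
      sub_eq_add_neg]
  rw [par, h1, G.shift]
  have : G.g y = ⟪y, G.e⟫ := by rw [height] at hy; linarith
  rw [this, neg_smul]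
  abel

theorem proj_par (w : (ℝ ∙ G.e)ᗮ) : (ℝ ∙ G.e)ᗮ.orthogonalProjectionOnto (G.par w) = w := by
  rw [par, map_add, map_smul, Submodule.orthogonalProjectionOnto_mem_subspace_eq_self]
  have : (ℝ ∙ G.e)ᗮ.orthogonalProjectionOnto G.e = 0 :=
    Submodule.orthogonalProjectionOnto_apply_of_mem_orthogonal
      (Submodule.le_orthogonal_orthogonal _ (Submodule.mem_span_singleton_self _))
  rw [this, smul_zero, add_zero]

theorem range_par : range G.par = {y | G.height y = 0} := by
  ext y
  exact ⟨by rintro ⟨w, rfl⟩; exact G.height_par w, fun h => ⟨_, G.par_proj h⟩⟩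

theorem hasFDerivAt_par (w : (ℝ ∙ G.e)ᗮ) :
    HasFDerivAt G.par ((ℝ ∙ G.e)ᗮ.subtypeL
      + ((innerSL ℝ (G.slope w)).comp (ℝ ∙ G.e)ᗮ.subtypeL).smulRight G.e) w := by
  have h1 : HasFDerivAt (fun w : (ℝ ∙ G.e)ᗮ => (w : Space d)) (ℝ ∙ G.e)ᗮ.subtypeL w :=
    (ℝ ∙ G.e)ᗮ.subtypeL.hasFDerivAt
  have h2 : HasFDerivAt G.g (innerSL ℝ (G.slope w)) (w : Space d) := by
    rw [G.innerSL_slope]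
    exact (G.differentiable (w : Space d)).hasFDerivAt
  exact h1.add ((h2.comp w h1).smul_const G.e)

theorem fderiv_par_apply (w p : (ℝ ∙ G.e)ᗮ) :
    fderiv ℝ G.par w p = (p : Space d) + ⟪G.slope w, p⟫ • G.e := by
  rw [(G.hasFDerivAt_par w).fderiv]
  simp

theorem contDiff_par : ContDiff ℝ 2 G.par := by
  have h1 : ContDiff ℝ 2 (fun w : (ℝ ∙ G.e)ᗮ => (w : Space d)) :=
    (ℝ ∙ G.e)ᗮ.subtypeL.contDiff
  exact h1.add ((G.contDiff.comp h1).smul contDiff_const)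

theorem norm_add_smul_sq (w : (ℝ ∙ G.e)ᗮ) (t : ℝ) :
    ‖(w : Space d) + t • G.e‖ ^ 2 = ‖w‖ ^ 2 + t ^ 2 := by
  rw [norm_add_sq_real, inner_smul_right, inner_coe_e, norm_smul, G.norm_e]
  simp

theorem dist_le_dist_par (a b : (ℝ ∙ G.e)ᗮ) : dist a b ≤ dist (G.par a) (G.par b) := by
  rw [dist_eq_norm, dist_eq_norm]
  have h : G.par a - G.par b = ((a - b : (ℝ ∙ G.e)ᗮ) : Space d) + (G.g a - G.g b) • G.e := by
    simp only [par, Submodule.coe_sub, sub_smul]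
    abel
  have := G.norm_add_smul_sq (a - b) (G.g a - G.g b)
  rw [← h] at this
  refine le_of_sq_le_sq ?_ (norm_nonneg _)
  nlinarith [sq_nonneg (G.g a - G.g b)]

theorem normDet_fderiv_par (w : (ℝ ∙ G.e)ᗮ) :
    (fderiv ℝ G.par w).toLinearMap.normDet = G.jac w := by
  have hmem : G.slope w ∈ (ℝ ∙ G.e)ᗮ :=
    Submodule.mem_orthogonal_singleton_iff_inner_left.2 (G.inner_slope_e w)
  set a : (ℝ ∙ G.e)ᗮ := ⟨G.slope w, hmem⟩
  set L : (ℝ ∙ G.e)ᗮ →ₗ[ℝ] Space d := (fderiv ℝ G.par w).toLinearMap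
  have h1 : L.adjoint ∘ₗ L = LinearMap.transvection (innerₛₗ ℝ a) a := by
    refine LinearMap.ext fun x => ext_inner_left ℝ fun y => ?_
    rw [LinearMap.comp_apply, LinearMap.adjoint_inner_right, LinearMap.transvection.apply]
    have hL : ∀ p, L p = (p : Space d) + ⟪G.slope w, p⟫ • G.e := G.fderiv_par_apply w
    rw [hL, hL]
    simp only [inner_add_left, inner_add_right, inner_smul_left, inner_smul_right, G.inner_e_e,
      inner_coe_e, innerₛₗ_apply_apply]
    rw [real_inner_comm _ G.e, inner_coe_e, real_inner_comm a y]
    simp only [Submodule.coe_inner, a]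
    simp
  have h2 := L.normDet_sq
  rw [h1, LinearMap.transvection.det] at h2
  have h3 : L.normDet ^ 2 = 1 + ‖G.slope w‖ ^ 2 := by
    have h4 : (1 : ℝ) + innerₛₗ ℝ a a = 1 + ‖G.slope w‖ ^ 2 := by
      rw [innerₛₗ_apply_apply, real_inner_self_eq_norm_sq]
      rfl
    rw [← h4]
    exact_mod_cast h2
  rw [jac, ← h3, Real.sqrt_sq (LinearMap.normDet_nonneg _)]

theorem finrank_hyperplane : Module.finrank ℝ (ℝ ∙ G.e)ᗮ = d - 1 := by
  have h := Submodule.finrank_add_finrank_orthogonal (ℝ ∙ G.e)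
  rw [finrank_span_singleton (by rw [← norm_ne_zero_iff, G.norm_e]; norm_num),
    finrank_euclideanSpace_fin] at h
  omega

theorem measurableEmbedding_par : MeasurableEmbedding G.par :=
  G.contDiff_par.continuous.measurableEmbedding fun a b hab => by
    have := G.dist_le_dist_par a b
    rw [hab, dist_self] at this
    exact dist_le_zero.1 this

theorem restrict_graph_eq_map :
    (Measure.euclideanHausdorffMeasure (d - 1) : Measure (Space d)).restrict {y | G.height y = 0}
      = (volume.withDensity fun w => ENNReal.ofReal (G.jac (G.par w))).map G.par := by
  ext A hA
  have hm : MeasurableSet (G.par ⁻¹' A) := G.measurableEmbedding_par.measurable hA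
  rw [Measure.restrict_apply hA, G.measurableEmbedding_par.map_apply, withDensity_apply _ hm]
  have h1 : A ∩ {y | G.height y = 0} = G.par '' (G.par ⁻¹' A) := by
    rw [image_preimage_eq_inter_range, range_par]
  rw [h1, ← G.finrank_hyperplane, euclideanHausdorffMeasure_image_eq_lintegral
    (G.contDiff_par.of_le (by norm_num)) G.dist_le_dist_par hm]
  refine lintegral_congr fun w => ?_
  rw [G.normDet_fderiv_par, jac, jac, G.slope_par]

theorem integral_graph {F : Type*} [NormedAddCommGroup F] [NormedSpace ℝ F] (φ : Space d → F) :
    ∫ y in {y | G.height y = 0}, φ y ∂(Measure.euclideanHausdorffMeasure (d - 1))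
      = ∫ w, G.jac (G.par w) • φ (G.par w) := by
  rw [restrict_graph_eq_map, G.measurableEmbedding_par.integral_map]
  have hc : Continuous fun w => Real.toNNReal (G.jac (G.par w)) :=
    continuous_real_toNNReal.comp (G.continuous_jac.comp G.contDiff_par.continuous)
  have := integral_withDensity_eq_integral_smul (μ := volume) hc.measurable
    (fun w => φ (G.par w))
  rw [show (fun w => ENNReal.ofReal (G.jac (G.par w)))
    = fun w => ((Real.toNNReal (G.jac (G.par w)) : ℝ≥0) : ℝ≥0∞) from rfl, this]
  refine integral_congr_ae (Eventually.of_forall fun w => ?_)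
  simp only [NNReal.smul_def, Real.coe_toNNReal _ (G.jac_pos _).le]

/-- On bounded sets the surface measure of a graph is upper Ahlfors regular. -/
theorem exists_measure_ball_le (x₀ : Space d) (ρ : ℝ) :
    ∃ C : ℝ≥0, ∀ y r, 0 < r → Measure.euclideanHausdorffMeasure (d - 1)
      ({y | G.height y = 0} ∩ Metric.ball x₀ ρ ∩ Metric.ball y r)
        ≤ C * ENNReal.ofReal (r ^ (d - 1)) := by
  obtain ⟨M, hM⟩ := (isCompact_closedBall x₀ ρ).exists_bound_of_continuousOn
    G.continuous_jac.continuousOn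
  refine ⟨Real.toNNReal M * (volume (Metric.ball (0 : (ℝ ∙ G.e)ᗮ) 1)).toNNReal, fun y r hr => ?_⟩
  have hmb : MeasurableSet (Metric.ball x₀ ρ ∩ Metric.ball y r) :=
    measurableSet_ball.inter measurableSet_ball
  rw [inter_assoc, inter_comm, ← Measure.restrict_apply hmb, restrict_graph_eq_map,
    G.measurableEmbedding_par.map_apply,
    withDensity_apply _ (G.measurableEmbedding_par.measurable hmb)]
  calc _ ≤ ∫⁻ w in G.par ⁻¹' (Metric.ball x₀ ρ ∩ Metric.ball y r), (Real.toNNReal M : ℝ≥0∞) := by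
        refine setLIntegral_mono' (G.measurableEmbedding_par.measurable hmb) fun w hw => ?_
        exact ENNReal.ofReal_le_ofReal ((le_abs_self _).trans
          (hM _ (Metric.ball_subset_closedBall hw.1)))
    _ = Real.toNNReal M * volume (G.par ⁻¹' (Metric.ball x₀ ρ ∩ Metric.ball y r)) := by
        rw [setLIntegral_const]
    _ ≤ Real.toNNReal M
        * volume (Metric.ball ((ℝ ∙ G.e)ᗮ.orthogonalProjectionOnto y) r) := by
        gcongr
        intro w hw
        have h1 : dist (G.par w) y < r := hw.2
        have h2 := (ℝ ∙ G.e)ᗮ.lipschitzWith_orthogonalProjectionOnto.dist_le_mul (G.par w) y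
        rw [G.proj_par] at h2
        simp only [NNReal.coe_one, one_mul] at h2
        exact h2.trans_lt h1
    _ = _ := by
        rw [Measure.addHaar_ball_of_pos _ _ hr, G.finrank_hyperplane, ENNReal.coe_mul,
          ENNReal.coe_toNNReal measure_ball_lt_top.ne]
        ring

end GraphData

section Boundary

variable {d : ℕ}

/-! ### Boundary charts and the normal field -/

/-- A `C¹` map whose derivative is locally Lipschitz continuous. -/
def IsC11 {E F : Type*} [NormedAddCommGroup E] [NormedSpace ℝ E] [NormedAddCommGroup F]
    [NormedSpace ℝ F] (m : E → F) : Prop :=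
  ContDiff ℝ 1 m ∧ LocallyLipschitz (fderiv ℝ m)

section C11

variable {E F H : Type*} [NormedAddCommGroup E] [NormedSpace ℝ E] [NormedAddCommGroup F]
  [NormedSpace ℝ F] [NormedAddCommGroup H] [NormedSpace ℝ H]

theorem ContDiff.locallyLipschitz_comp₂ {X : Type*} [PseudoEMetricSpace X] {f : E → F → H}
    {g : X → E} {h : X → F} (hf : ContDiff ℝ 1 (fun p : E × F => f p.1 p.2))
    (hg : LocallyLipschitz g) (hh : LocallyLipschitz h) :
    LocallyLipschitz (fun x => f (g x) (h x)) :=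
  hf.locallyLipschitz.comp (hg.prodMk hh)

theorem ContDiff.isC11 {m : E → F} (hm : ContDiff ℝ 2 m) : IsC11 m :=
  ⟨hm.of_le (by norm_num), (hm.fderiv_right (m := 1) (by norm_num)).locallyLipschitz⟩

theorem IsC11.contDiff_comp {S : F → H} {m : E → F} (hS : ContDiff ℝ 2 S) (hm : IsC11 m) :
    IsC11 (fun y => S (m y)) := by
  refine ⟨(hS.of_le (by norm_num)).comp hm.1, ?_⟩
  have h1 : (fderiv ℝ fun y => S (m y)) = fun y => (fderiv ℝ S (m y)).comp (fderiv ℝ m y) :=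
    funext fun y =>
      fderiv_comp y (hS.differentiable two_ne_zero _) (hm.1.differentiable one_ne_zero _)
  have hS1 : ContDiff ℝ 1 (fderiv ℝ S) := hS.fderiv_right (by norm_num)
  have h2 : ContDiff ℝ 1
      (fun p : (F →L[ℝ] H) × (E →L[ℝ] F) => p.1.comp p.2) := contDiff_fst.clm_comp contDiff_snd
  rw [h1]
  exact ContDiff.locallyLipschitz_comp₂ (f := fun (S : F →L[ℝ] H) (T : E →L[ℝ] F) => S.comp T) h2
    (hS1.locallyLipschitz.comp hm.1.locallyLipschitz) hm.2

theorem IsC11.prodMk {m : E → F} {k : E → H} (hm : IsC11 m) (hk : IsC11 k) :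
    IsC11 (fun y => (m y, k y)) := by
  refine ⟨hm.1.prodMk hk.1, ?_⟩
  have h1 : (fderiv ℝ fun y => (m y, k y)) = fun y => (fderiv ℝ m y).prod (fderiv ℝ k y) :=
    funext fun y => ((hm.1.differentiable one_ne_zero y).hasFDerivAt.prodMk
      (hk.1.differentiable one_ne_zero y).hasFDerivAt).fderiv
  have h2 : ContDiff ℝ 1 (fun p : (E →L[ℝ] F) × (E →L[ℝ] H) => p.1.prod p.2) :=
    (ContinuousLinearMap.prodₗᵢ ℝ (𝕜 := ℝ) (E := E) (F := F) (G := H)).contDiff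
  rw [h1]
  exact ContDiff.locallyLipschitz_comp₂ (f := fun (S : E →L[ℝ] F) (T : E →L[ℝ] H) => S.prod T) h2
    hm.2 hk.2

theorem IsC11.smul {χ : E → ℝ} {m : E → F} (hχ : IsC11 χ) (hm : IsC11 m) :
    IsC11 (fun y => χ y • m y) :=
  IsC11.contDiff_comp (S := fun p : ℝ × F => p.1 • p.2) (by fun_prop) (hχ.prodMk hm)

theorem IsC11.add {m k : E → F} (hm : IsC11 m) (hk : IsC11 k) : IsC11 (m + k) :=
  IsC11.contDiff_comp (S := fun p : F × F => p.1 + p.2) (by fun_prop) (hm.prodMk hk)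

end C11

/-- In the ball `B(x₀, ρ)` the set `Ω` lies strictly above the graph `G`, and `Γ` is the graph. -/
structure IsChart (G : GraphData d) (Ω Γ : Set (Space d)) (x₀ : Space d) (ρ : ℝ) : Prop where
  pos : 0 < ρ
  lip : LocallyLipschitz (fderiv ℝ G.slope)
  mem_domain : ∀ y ∈ Metric.ball x₀ ρ, (y ∈ Ω ↔ G.height y < 0)
  mem_surf : ∀ y ∈ Metric.ball x₀ ρ, (y ∈ Γ ↔ G.height y = 0)

theorem lipschitzWith_fderiv_fderiv {f : Space d → ℝ} {K : ℝ≥0}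
    (hK : LipschitzWith K (iteratedFDeriv ℝ 2 f)) : LipschitzWith K (fderiv ℝ (fderiv ℝ f)) := by
  refine LipschitzWith.of_dist_le_mul fun x y => ?_
  have h1 := hK.dist_le_mul x y
  rw [dist_eq_norm] at h1 ⊢
  have hp : 0 ≤ K * dist x y := by positivity
  refine ContinuousLinearMap.opNorm_le_bound _ hp fun u => ?_
  refine ContinuousLinearMap.opNorm_le_bound _ (by positivity) fun w => ?_
  have h2 := (iteratedFDeriv ℝ 2 f x - iteratedFDeriv ℝ 2 f y).le_opNorm ![u, w]
  rw [Fin.prod_univ_two] at h2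
  simp only [_root_.sub_apply, iteratedFDeriv_two_apply,
    Matrix.cons_val_zero, Matrix.cons_val_one] at h2
  simp only [_root_.sub_apply]
  refine h2.trans ?_
  rw [mul_assoc]
  gcongr

theorem frontier_iff_of_epigraph {Ω : Set (Space d)} (hΩ : IsOpen Ω) (G : GraphData d)
    {x₀ : Space d} {ρ : ℝ} (h : ∀ y ∈ Metric.ball x₀ ρ, (y ∈ Ω ↔ G.height y < 0)) :
    ∀ y ∈ Metric.ball x₀ ρ, (y ∈ frontier Ω ↔ G.height y = 0) := by
  intro y hy
  have hnb := Metric.isOpen_ball.mem_nhds hy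
  rw [hΩ.frontier_eq, Set.mem_sdiff, h y hy, not_lt]
  constructor
  · rintro ⟨hcl, h0⟩
    refine le_antisymm (le_of_not_gt fun hpos => ?_) h0
    rw [mem_closure_iff_nhds] at hcl
    have := G.continuous_height.continuousAt.eventually (lt_mem_nhds hpos)
    obtain ⟨z, ⟨hz1, hz2⟩, hz3⟩ := hcl _ (inter_mem this hnb)
    exact lt_asymm hz1 ((h z hz2).1 hz3)
  · intro h0
    refine ⟨?_, h0.ge⟩
    have hc : Tendsto (fun t : ℝ => y + t • G.e) (𝓝[>] 0) (𝓝 y) := by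
      have : Continuous fun t : ℝ => y + t • G.e := by fun_prop
      simpa using (this.tendsto 0).mono_left (nhdsWithin_le_nhds (s := Ioi (0 : ℝ)))
    refine mem_closure_of_tendsto hc ?_
    filter_upwards [hc.eventually hnb, self_mem_nhdsWithin] with t ht ht0
    rw [h _ ht, G.height_shift, h0]
    simpa using ht0

/-- The charts exist at all points of `Γ`: `ΓDir` is closed and does not meet `Γ`, so that near a
point of `Γ` the whole frontier of `Ω` belongs to `Γ`. -/
theorem exists_isChart {Ω ΓDir Γ : Set (Space d)} (hΩ : IsOpen Ω) (hDir : IsClosed ΓDir)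
    (hcover : ΓDir ∪ Γ = frontier Ω) (hdisj : Disjoint ΓDir Γ) (hreg : IsC21Boundary Ω Γ)
    {x : Space d} (hx : x ∈ Γ) : ∃ (G : GraphData d) (ρ : ℝ), IsChart G Ω Γ x ρ := by
  obtain ⟨e, f, K, hf, hK, he, hloc⟩ := hreg x hx
  set P : Space d →L[ℝ] Space d :=
    ContinuousLinearMap.id ℝ (Space d) - (innerSL ℝ e).smulRight e with hP
  have hPa : ∀ y, P y = y - ⟪y, e⟫ • e := fun y => by simp [hP, real_inner_comm]
  have hee : ⟪e, e⟫ = 1 := by rw [real_inner_self_eq_norm_sq, he]; norm_num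
  have hPe : P e = 0 := by rw [hPa, hee]; simp
  let G : GraphData d :=
    { e := e
      g := fun y => f (P y)
      norm_e := he
      contDiff := hf.comp P.contDiff
      shift := fun y t => by simp only [map_add, map_smul, hPe, smul_zero, add_zero] }
  obtain ⟨ρ₁, hρ₁, hb⟩ := Metric.eventually_nhds_iff_ball.1 hloc
  have hxD : x ∉ ΓDir := fun h => hdisj.le_bot ⟨h, hx⟩
  obtain ⟨ρ₂, hρ₂, hb₂⟩ := Metric.mem_nhds_iff.1 (hDir.isOpen_compl.mem_nhds hxD)
  have hdom : ∀ y ∈ Metric.ball x ρ₁, (y ∈ Ω ↔ G.height y < 0) := by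
    intro y hy
    rw [hb y hy, GraphData.height, sub_neg, ← hPa]
  refine ⟨G, min ρ₁ ρ₂, lt_min hρ₁ hρ₂, ?_,
    fun y hy => hdom y (Metric.ball_subset_ball (min_le_left _ _) hy), fun y hy => ?_⟩
  · have hm : IsC11 (fun y => fderiv ℝ f (P y)) := by
      have h1 : ContDiff ℝ 1 (fderiv ℝ f) := hf.fderiv_right (by norm_num)
      refine ⟨h1.comp P.contDiff, ?_⟩
      have h2 : (fderiv ℝ fun y => fderiv ℝ f (P y))
          = fun y => (fderiv ℝ (fderiv ℝ f) (P y)).comp P := funext fun y =>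
        ((h1.differentiable one_ne_zero (P y)).hasFDerivAt.comp y P.hasFDerivAt).fderiv
      have hlin : ContDiff ℝ 1 (fun T : Space d →L[ℝ] Space d →L[ℝ] ℝ => T.comp P) := by
        fun_prop
      rw [h2]
      exact hlin.locallyLipschitz.comp
        ((lipschitzWith_fderiv_fderiv hK).locallyLipschitz.comp P.lipschitz.locallyLipschitz)
    have hslope : G.slope
        = fun y => (InnerProductSpace.toDual ℝ (Space d)).symm ((fderiv ℝ f (P y)).comp P) := by
      funext y
      have h1 : fderiv ℝ G.g y = (fderiv ℝ f (P y)).comp P :=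
        ((hf.differentiable two_ne_zero (P y)).hasFDerivAt.comp y P.hasFDerivAt).fderiv
      rw [GraphData.slope, gradient, h1]
    have hS : ContDiff ℝ 2 (fun T : Space d →L[ℝ] ℝ =>
        (InnerProductSpace.toDual ℝ (Space d)).symm (T.comp P)) :=
      (InnerProductSpace.toDual ℝ (Space d)).symm.toContinuousLinearEquiv.contDiff.comp
        (by fun_prop : ContDiff ℝ 2 (fun T : Space d →L[ℝ] ℝ => T.comp P))
    rw [hslope]
    exact (hm.contDiff_comp hS).2
  · rw [← frontier_iff_of_epigraph hΩ G hdom y (Metric.ball_subset_ball (min_le_left _ _) hy),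
      ← hcover]
    refine ⟨Or.inr, fun h => h.resolve_left fun hyD => ?_⟩
    exact hb₂ (Metric.ball_subset_ball (min_le_right _ _) hy) hyD

/-- Two half spaces that both approximate `Ω` at `x` up to thin cones have the same normal. -/
theorem IsOutwardUnitNormal.unique {Ω : Set (Space d)} {x ν ν' : Space d}
    (h : IsOutwardUnitNormal Ω x ν) (h' : IsOutwardUnitNormal Ω x ν') : ν = ν' := by
  by_contra hne
  set w := ν' - ν with hw
  have hw0 : 0 < ‖w‖ := norm_pos_iff.2 (sub_ne_zero.2 (Ne.symm hne))
  have hs : ‖w‖ ^ 2 = 2 - 2 * ⟪ν', ν⟫ := by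
    rw [hw, norm_sub_sq_real, h.1, h'.1]
    ring
  have h1 : ⟪w, ν⟫ = -(‖w‖ ^ 2 / 2) := by
    rw [hs, hw, inner_sub_left, real_inner_self_eq_norm_sq, h.1]
    ring
  have h2 : ⟪w, ν'⟫ = ‖w‖ ^ 2 / 2 := by
    rw [hs, hw, inner_sub_left, real_inner_self_eq_norm_sq, h'.1, real_inner_comm]
    ring
  have hδ : 0 < ‖w‖ / 4 := by positivity
  have hc : Tendsto (fun t : ℝ => x + t • w) (𝓝[>] 0) (𝓝 x) := by
    have : Continuous fun t : ℝ => x + t • w := by fun_prop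
    simpa using (this.tendsto 0).mono_left (nhdsWithin_le_nhds (s := Ioi (0 : ℝ)))
  obtain ⟨t, ⟨hA, hB⟩, ht⟩ := ((hc.eventually ((h.2 _ hδ).and (h'.2 _ hδ))).and
    self_mem_nhdsWithin).exists
  have ht0 : 0 < t := ht
  simp only [add_sub_cancel_left, inner_smul_left, norm_smul, Real.norm_of_nonneg ht0.le, h1, h2,
    conj_trivial] at hA hB
  have hp : 0 < t * ‖w‖ ^ 2 := by positivity
  exact hB.2 (by nlinarith) (hA.1 (by nlinarith))

theorem IsChart.isOutwardUnitNormal {G : GraphData d} {Ω Γ : Set (Space d)} {x₀ : Space d} {ρ : ℝ}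
    (h : IsChart G Ω Γ x₀ ρ) {x : Space d} (hx : x ∈ Γ) (hxb : x ∈ Metric.ball x₀ ρ) :
    IsOutwardUnitNormal Ω x (G.normal x) := by
  refine ⟨G.norm_normal x, fun δ hδ => ?_⟩
  have h0 : G.height x = 0 := (h.mem_surf x hxb).1 hx
  have hj := G.jac_pos x
  have hlo := (G.hasFDerivAt_height x).isLittleO.bound (mul_pos hδ hj)
  filter_upwards [hlo, Metric.isOpen_ball.mem_nhds hxb] with y hy hyb
  rw [h0, sub_zero, innerSL_apply_apply, ← G.jac_smul_normal, inner_smul_left, conj_trivial,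
    real_inner_comm, Real.norm_eq_abs, abs_le] at hy
  constructor
  · intro hlt
    rw [h.mem_domain y hyb]
    nlinarith
  · intro hlt
    rw [h.mem_domain y hyb]
    nlinarith

theorem IsChart.outwardNormal_eq {G : GraphData d} {Ω Γ : Set (Space d)} {x₀ : Space d} {ρ : ℝ}
    (h : IsChart G Ω Γ x₀ ρ) {x : Space d} (hx : x ∈ Γ) (hxb : x ∈ Metric.ball x₀ ρ) :
    outwardNormal Ω x = G.normal x :=
  IsOutwardUnitNormal.unique
    (Classical.epsilon_spec (p := IsOutwardUnitNormal Ω x) ⟨_, h.isOutwardUnitNormal hx hxb⟩)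
    (h.isOutwardUnitNormal hx hxb)

theorem exists_smooth_partition {Γ : Set (Space d)} (hΓ : IsCompact Γ)
    (U : Space d → Set (Space d)) (hU : ∀ x ∈ Γ, IsOpen (U x) ∧ x ∈ U x) :
    ∃ (t : Finset (Space d)) (χ : Space d → Space d → ℝ), (∀ x ∈ t, x ∈ Γ) ∧
      (∀ x ∈ t, ContDiff ℝ ∞ (χ x) ∧ tsupport (χ x) ⊆ U x) ∧ ∀ y ∈ Γ, ∑ x ∈ t, χ x y = 1 := by
  obtain ⟨t, htΓ, ht⟩ := hΓ.elim_nhds_subcover U fun x hx => (hU x hx).1.mem_nhds (hU x hx).2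
  obtain ⟨f, hf⟩ := SmoothPartitionOfUnity.exists_isSubordinate (modelWithCornersSelf ℝ (Space d))
    hΓ.isClosed (fun x : t => U x) (fun x => (hU x (htΓ x x.2)).1) (by rwa [iUnion_subtype])
  classical
  refine ⟨t, fun x => if hx : x ∈ t then f ⟨x, hx⟩ else 0, htΓ, fun x hx => ?_, fun y hy => ?_⟩
  · simp only [hx, dite_true]
    exact ⟨(f ⟨x, hx⟩).contMDiff.contDiff, hf ⟨x, hx⟩⟩
  · have h1 := f.sum_eq_one hy
    rw [finsum_eq_sum_of_fintype] at h1
    rw [← Finset.sum_coe_sort, ← h1]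
    refine Finset.sum_congr rfl fun x _ => ?_
    simp

theorem GraphData.isC11_normal (G : GraphData d) (hG : LocallyLipschitz (fderiv ℝ G.slope)) :
    IsC11 G.normal := by
  have hS : ContDiff ℝ 2 (fun a : Space d => (√(1 + ‖a‖ ^ 2))⁻¹ • (a - G.e)) := by
    refine ContDiff.smul (ContDiff.inv (ContDiff.sqrt ?_ fun a => by positivity)
      fun a => by positivity) (by fun_prop)
    exact contDiff_const.add (contDiff_norm_sq ℝ)
  have hm : IsC11 G.slope := ⟨G.contDiff_slope, hG⟩
  exact IsC11.contDiff_comp (S := fun a : Space d => (√(1 + ‖a‖ ^ 2))⁻¹ • (a - G.e)) hS hm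

/-- The outward unit normal on a compact `C^{2,1}` part of the boundary extends to a `C^{1,1}`
field: the normals of the charts are glued with a partition of unity. -/
theorem exists_normalField {Ω Γ : Set (Space d)} (hΓ : IsCompact Γ)
    (hchart : ∀ x ∈ Γ, ∃ (G : GraphData d) (ρ : ℝ), IsChart G Ω Γ x ρ) :
    ∃ N : Space d → Space d, IsC11 N ∧ ∀ x ∈ Γ, N x = outwardNormal Ω x := by
  have : ∀ x ∈ Γ, ∃ (ν : Space d → Space d) (ρ : ℝ), 0 < ρ ∧ IsC11 ν ∧
      ∀ y ∈ Γ, y ∈ Metric.ball x ρ → ν y = outwardNormal Ω y := by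
    intro x hx
    obtain ⟨G, ρ, h⟩ := hchart x hx
    exact ⟨G.normal, ρ, h.pos, G.isC11_normal h.lip,
      fun y hy hyb => (h.outwardNormal_eq hy hyb).symm⟩
  choose! ν ρ hρ hν hνN using this
  obtain ⟨t, χ, htΓ, hχ, hsum⟩ := exists_smooth_partition hΓ (fun x => Metric.ball x (ρ x))
    fun x hx => ⟨Metric.isOpen_ball, Metric.mem_ball_self (hρ x hx)⟩
  refine ⟨∑ x ∈ t, fun y => χ x y • ν x y, ?_, fun y hy => ?_⟩
  · refine Finset.sum_induction _ IsC11 (fun _ _ => IsC11.add) ?_ fun x hx => ?_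
    · exact (contDiff_const (c := (0 : Space d))).isC11
    · exact IsC11.smul ((contDiff_infty.1 (hχ x hx).1 2)).isC11 (hν x (htΓ x hx))
  · rw [Finset.sum_apply]
    calc _ = ∑ x ∈ t, χ x y • outwardNormal Ω y := by
          refine Finset.sum_congr rfl fun x hx => ?_
          by_cases hyb : y ∈ Metric.ball x (ρ x)
          · rw [hνN x (htΓ x hx) y hy hyb]
          · rw [image_eq_zero_of_notMem_tsupport fun h => hyb ((hχ x hx).2 h), zero_smul, zero_smul]
      _ = _ := by rw [← Finset.sum_smul, hsum y hy, one_smul]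

/-! ### The cone condition at the boundary -/

/-- A uniform interior cone condition at the points of `S`: every point of `Ω` within `r` of
`x ∈ S` sees, inside `Ω`, the whole ball of radius `r` around `x + M r e`. -/
structure ConeCondition (Ω S : Set (Space d)) (e : Space d) (M r₀ : ℝ) : Prop where
  norm_e : ‖e‖ = 1
  two_le : 2 ≤ M
  pos : 0 < r₀
  segment_mem : ∀ x ∈ S, ∀ r, 0 < r → r < r₀ → ∀ y ∈ Metric.ball x r ∩ Ω,
    ∀ z ∈ Metric.ball (x + (M * r) • e) r, ∀ t ∈ Icc (0 : ℝ) 1, y + t • (z - y) ∈ Ω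
  ball_subset : ∀ x ∈ S, ∀ r, 0 < r → r < r₀ → Metric.ball (x + (M * r) • e) r ⊆ Ω

/-- Near the chart centre the graph is Lipschitz with some constant `L`, and a displacement by
`M r e` with `M = 2 L + 3` outweighs the change of the height in a ball of radius `2 r`. -/
theorem IsChart.exists_cone {G : GraphData d} {Ω Γ : Set (Space d)} {x₀ : Space d} {ρ : ℝ}
    (h : IsChart G Ω Γ x₀ ρ) : ∃ M r₀ : ℝ, 2 ≤ M ∧ 0 < r₀ ∧
      ∀ x ∈ Metric.ball x₀ (ρ / 2), ∀ r, 0 < r → r < r₀ → ∀ y ∈ Metric.ball x r, G.height y ≤ 0 →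
        ∀ z ∈ Metric.ball (x + (M * r) • G.e) r, ∀ t ∈ Ioc (0 : ℝ) 1, y + t • (z - y) ∈ Ω := by
  obtain ⟨L, hL⟩ := (isCompact_closedBall x₀ ρ).exists_bound_of_continuousOn
    (G.contDiff.continuous_fderiv two_ne_zero).continuousOn
  have hL0 : 0 ≤ L := (norm_nonneg _).trans (hL x₀ (Metric.mem_closedBall_self h.pos.le))
  set M := 2 * L + 3 with hM
  have hM0 : 0 < M + 1 := by linarith
  refine ⟨M, ρ / 2 / (M + 1), by linarith, div_pos (half_pos h.pos) hM0, ?_⟩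
  intro x hx r hr0 hr y hy hyh z hz t ht
  rw [lt_div_iff₀ hM0] at hr
  have hMr : 0 ≤ M * r := by nlinarith
  set ζ := z - y - (M * r) • G.e with hζ
  have hyx : ‖y - x‖ < r := by rwa [← dist_eq_norm]
  have hzx : ‖z - (x + (M * r) • G.e)‖ < r := by rwa [← dist_eq_norm]
  have hxx : ‖x - x₀‖ < ρ / 2 := by rwa [← dist_eq_norm]
  have hζn : ‖ζ‖ ≤ 2 * r := by
    have : ζ = (z - (x + (M * r) • G.e)) - (y - x) := by rw [hζ]; abel
    rw [this]
    exact (norm_sub_le _ _).trans (by linarith)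
  have htz : ‖t • ζ‖ ≤ t * (2 * r) := by
    rw [norm_smul, Real.norm_of_nonneg ht.1.le]
    exact mul_le_mul_of_nonneg_left hζn ht.1.le
  have htr : t * (2 * r) ≤ 2 * r := by nlinarith [ht.2]
  have hpt : y + t • (z - y) = y + t • ζ + (t * (M * r)) • G.e := by
    rw [hζ, smul_sub t (z - y), smul_smul]; abel
  have hmem1 : y ∈ Metric.closedBall x₀ ρ := by
    rw [mem_closedBall_iff_norm]
    have := norm_add_le (y - x) (x - x₀)
    rw [sub_add_sub_cancel] at this
    nlinarith
  have hmem2 : y + t • ζ ∈ Metric.closedBall x₀ ρ := by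
    rw [mem_closedBall_iff_norm]
    have h1 : y + t • ζ - x₀ = (y - x) + (x - x₀) + t • ζ := by abel
    rw [h1]
    have := norm_add₃_le (a := y - x) (b := x - x₀) (c := t • ζ)
    nlinarith
  have hlip := (convex_closedBall x₀ ρ).norm_image_sub_le_of_norm_fderiv_le
    (fun w _ => G.differentiable w) (fun w hw => hL w hw) hmem1 hmem2
  rw [add_sub_cancel_left, Real.norm_eq_abs, abs_le] at hlip
  have hin : -‖t • ζ‖ ≤ ⟪t • ζ, G.e⟫ := by
    have := abs_real_inner_le_norm (t • ζ) G.e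
    rw [G.norm_e, mul_one] at this
    exact (abs_le.1 this).1
  have hball : y + t • (z - y) ∈ Metric.ball x₀ ρ := by
    rw [mem_ball_iff_norm]
    have h1 : y + t • (z - y) - x₀
        = (1 - t) • (y - x) + (x - x₀) + t • (z - (x + (M * r) • G.e)) + (t * (M * r)) • G.e := by
      rw [mul_smul]; module
    rw [h1]
    have h2 := norm_add_le ((1 - t) • (y - x) + (x - x₀) + t • (z - (x + (M * r) • G.e)))
      ((t * (M * r)) • G.e)
    have h3 := norm_add₃_le (a := (1 - t) • (y - x)) (b := x - x₀)
      (c := t • (z - (x + (M * r) • G.e)))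
    rw [norm_smul, norm_smul, Real.norm_of_nonneg ht.1.le,
      Real.norm_of_nonneg (by linarith [ht.2])] at h3
    rw [norm_smul (t * (M * r)), G.norm_e, mul_one, Real.norm_of_nonneg
      (mul_nonneg ht.1.le hMr)] at h2
    have h4 : t * (M * r) ≤ M * r := by nlinarith [ht.2]
    have h5 : (1 - t) * ‖y - x‖ ≤ (1 - t) * r :=
      mul_le_mul_of_nonneg_left hyx.le (by linarith [ht.2])
    have h6 : t * ‖z - (x + (M * r) • G.e)‖ ≤ t * r := mul_le_mul_of_nonneg_left hzx.le ht.1.le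
    nlinarith
  rw [h.mem_domain _ hball, hpt, G.height_shift]
  have hexp : G.height (y + t • ζ) = G.height y + (G.g (y + t • ζ) - G.g y) - ⟪t • ζ, G.e⟫ := by
    simp only [GraphData.height, inner_add_left]; ring
  rw [hexp]
  have h7 : L * ‖t • ζ‖ ≤ L * (t * (2 * r)) := mul_le_mul_of_nonneg_left htz hL0
  have h8 : 0 < t * r := mul_pos ht.1 hr0
  have h9 : t * (M * r) = L * (t * (2 * r)) + t * (2 * r) + t * r := by rw [hM]; ring
  linarith [hlip.2]

theorem IsChart.exists_coneCondition {G : GraphData d} {Ω Γ : Set (Space d)} {x₀ : Space d} {ρ : ℝ}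
    (h : IsChart G Ω Γ x₀ ρ) :
    ∃ M r₀ : ℝ, ConeCondition Ω (Γ ∩ Metric.ball x₀ (ρ / 2)) G.e M r₀ := by
  obtain ⟨M, r₀, hM, hr₀, H⟩ := h.exists_cone
  have hr₁ : 0 < min r₀ (ρ / 2) := lt_min hr₀ (half_pos h.pos)
  refine ⟨M, min r₀ (ρ / 2), G.norm_e, hM, hr₁, ?_, ?_⟩
  · intro x hx r hr0 hr y hy z hz t ht
    rcases ht.1.eq_or_lt with rfl | ht0
    · simpa using hy.2
    · refine H x hx.2 r hr0 (hr.trans_le (min_le_left _ _)) y hy.1 ?_ z hz t ⟨ht0, ht.2⟩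
      refine ((h.mem_domain y ?_).1 hy.2).le
      have h1 : dist y x < r := hy.1
      have h2 : dist x x₀ < ρ / 2 := hx.2
      have h3 := hr.trans_le (min_le_right _ _)
      rw [Metric.mem_ball]
      linarith [dist_triangle y x x₀]
  · intro x hx r hr0 hr z hz
    have h0 : G.height x ≤ 0 :=
      ((h.mem_surf x (Metric.ball_subset_ball (half_le_self h.pos.le) hx.2)).1 hx.1).le
    simpa using H x hx.2 r hr0 (hr.trans_le (min_le_left _ _)) x (Metric.mem_ball_self hr0) h0 z hz
      1 ⟨one_pos, le_rfl⟩

/-- The closure of `Ω` contains the convex hull of a point of `Γ` and a ball. -/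
theorem IsChart.uniqueDiffWithinAt {G : GraphData d} {Ω Γ : Set (Space d)} {x₀ : Space d} {ρ : ℝ}
    (h : IsChart G Ω Γ x₀ ρ) {x : Space d} (hx : x ∈ Γ) (hxb : x ∈ Metric.ball x₀ (ρ / 2)) :
    UniqueDiffWithinAt ℝ (closure Ω) x := by
  obtain ⟨M, r₀, hM, hr₀, H⟩ := h.exists_cone
  have h0 : G.height x = 0 :=
    (h.mem_surf x (Metric.ball_subset_ball (half_le_self h.pos.le) hxb)).1 hx
  have hr : 0 < r₀ / 2 := half_pos hr₀
  have hxc : x ∈ closure Ω := by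
    have h1 := (frontier_iff_of_epigraph (Ω := {y | G.height y < 0})
      (isOpen_lt G.continuous_height continuous_const) G (x₀ := x₀) (ρ := ρ) (fun _ _ => Iff.rfl)
      x (Metric.ball_subset_ball (half_le_self h.pos.le) hxb)).2 h0
    have h2 : x ∈ closure {y | G.height y < 0} := h1.1
    rw [mem_closure_iff_nhds] at h2 ⊢
    intro s hs
    obtain ⟨z, ⟨hz1, hz2⟩, hz3⟩ := h2 _ (inter_mem hs (Metric.isOpen_ball.mem_nhds
      (Metric.ball_subset_ball (half_le_self h.pos.le) hxb)))
    exact ⟨z, hz1, (h.mem_domain z hz2).2 hz3⟩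
  set B := Metric.ball (x + (M * (r₀ / 2)) • G.e) (r₀ / 2)
  have hne : B.Nonempty := ⟨_, Metric.mem_ball_self hr⟩
  have hsub : convexHull ℝ (insert x B) ⊆ closure Ω := by
    rw [convexHull_insert hne, (convex_ball _ _).convexHull_eq]
    intro p hp
    obtain ⟨a, ha, z, hz, hp⟩ := mem_convexJoin.1 hp
    rw [mem_singleton_iff.1 ha, segment_eq_image'] at hp
    obtain ⟨t, ht, rfl⟩ := hp
    rcases ht.1.eq_or_lt with rfl | ht0
    · simpa using hxc
    · exact subset_closure (H x hxb (r₀ / 2) hr (half_lt_self hr₀) x (Metric.mem_ball_self hr)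
        h0.le z hz t ⟨ht0, ht.2⟩)
  refine (uniqueDiffWithinAt_convex (convex_convexHull ℝ _) ?_
    (subset_closure (subset_convexHull ℝ _ (mem_insert _ _)))).mono hsub
  obtain ⟨z, hz⟩ := hne
  refine ⟨z, mem_interior.2 ⟨B, ?_, Metric.isOpen_ball, hz⟩⟩
  exact (subset_insert _ _).trans (subset_convexHull ℝ _)

/-! ### Mollification of functions with weak derivatives -/

/-- The average `∫_U k(y - p) u(y) dy` of `u` over `U` with the kernel `k` moved to `p`. -/
noncomputable def smear (k : Space d → ℝ) (U : Set (Space d)) (u : Space d → ℂ) (p : Space d) : ℂ :=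
  ∫ y in U, (k (y - p) : ℂ) * u y

theorem smear_eq_convolution {k : Space d → ℝ} {U : Set (Space d)} (hU : MeasurableSet U)
    (u : Space d → ℂ) : smear k U u = convolution (U.indicator u) (fun z => k (-z))
      (ContinuousLinearMap.lsmul ℝ ℝ).flip volume := by
  funext p
  rw [smear, convolution, ← integral_indicator hU]
  refine integral_congr_ae (Eventually.of_forall fun y => ?_)
  by_cases hy : y ∈ U <;> simp [hy]

theorem hasFDerivAt_smear {k : Space d → ℝ} (hk : ContDiff ℝ ∞ k) (hkc : HasCompactSupport k)
    {U : Set (Space d)} (hU : MeasurableSet U) {u : Space d → ℂ} (hu : IntegrableOn u U) :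
    ContDiff ℝ ∞ (smear k U u) ∧ ∀ p v, fderiv ℝ (smear k U u) p v
      = -∫ y in U, (fderiv ℝ k (y - p) v : ℂ) * u y := by
  have hli : LocallyIntegrable (U.indicator u) :=
    ((integrable_indicator_iff hU).2 hu).locallyIntegrable
  have hk' : ContDiff ℝ ∞ (fun z => k (-z)) := hk.comp contDiff_neg
  have hkc' : HasCompactSupport (fun z => k (-z)) :=
    hkc.comp_homeomorph (Homeomorph.neg (Space d))
  rw [smear_eq_convolution hU]
  refine ⟨hkc'.contDiff_convolution_right _ hli hk', fun p v => ?_⟩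
  rw [(hkc'.hasFDerivAt_convolution_right (ContinuousLinearMap.lsmul ℝ ℝ).flip hli
    (hk'.of_le (by exact_mod_cast le_top)) p).fderiv, convolution_precompR_apply _ hli
    (hkc'.fderiv ℝ) (hk'.continuous_fderiv (by simp)), convolution, ← integral_neg,
    ← integral_indicator hU]
  refine integral_congr_ae (Eventually.of_forall fun y => ?_)
  have h1 : fderiv ℝ (fun z => k (-z)) (p - y) v = -fderiv ℝ k (y - p) v := by
    have := ((hk.differentiable (by simp) (-(p - y))).hasFDerivAt.comp (p - y)
      (hasFDerivAt_id (p - y)).neg).fderiv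
    have h2 : fderiv ℝ (fun z => k (-z)) (p - y)
      = (fderiv ℝ k (-(p - y))).comp (-ContinuousLinearMap.id ℝ (Space d)) := this
    rw [h2]
    simp
  by_cases hy : y ∈ U <;> simp [hy, h1]

theorem fderiv_smear_of_weakPartial {k : Space d → ℝ} (hk : ContDiff ℝ ∞ k)
    (hkc : HasCompactSupport k) {U : Set (Space d)} (hU : IsOpen U) {u g : Space d → ℂ}
    (hu : IntegrableOn u U) {i : Fin d} (hw : IsWeakPartial U i u g) {p : Space d}
    (hp : ∀ y, y - p ∈ tsupport k → y ∈ U) :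
    fderiv ℝ (smear k U u) p (EuclideanSpace.single i 1) = smear k U g p := by
  rw [(hasFDerivAt_smear hk hkc hU.measurableSet hu).2]
  have hts : tsupport (fun y => k (y - p)) = (fun y => y - p) ⁻¹' tsupport k :=
    tsupport_comp_eq_preimage k (Homeomorph.subRight p)
  have h1 := hw.2.2 (fun y => k (y - p)) (hk.comp (contDiff_id.sub contDiff_const))
    (hkc.comp_homeomorph (Homeomorph.subRight p)) (by rw [hts]; exact hp)
  simp only [fderiv_comp_sub] at h1
  rw [h1, neg_neg, smear]

theorem sq_lintegral_le {α : Type*} [MeasurableSpace α] {μ : Measure α} {a : α → ℝ≥0∞}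
    (ha : AEMeasurable a μ) : (∫⁻ x, a x ∂μ) ^ (2 : ℝ) ≤ μ univ * ∫⁻ x, a x ^ (2 : ℝ) ∂μ := by
  have h := ENNReal.lintegral_mul_le_Lp_mul_Lq μ (Real.HolderConjugate.two_two) ha
    (aemeasurable_const (b := (1 : ℝ≥0∞)))
  simp only [Pi.mul_apply, mul_one, ENNReal.one_rpow, lintegral_const, one_mul] at h
  calc _ ≤ _ := ENNReal.rpow_le_rpow h zero_le_two
    _ = _ := by
      rw [ENNReal.mul_rpow_of_nonneg _ _ zero_le_two, ← ENNReal.rpow_mul, ← ENNReal.rpow_mul,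
        mul_comm]
      norm_num

/-- Averaging with a probability density does not increase the `L²` norm. -/
theorem lintegral_smear_sq_le {k : Space d → ℝ} (hk : Continuous k) (hk0 : ∀ z, 0 ≤ k z)
    (hk1 : ∫⁻ z, ENNReal.ofReal (k z) = 1) {U : Set (Space d)} {g : Space d → ℂ}
    (hg : AEMeasurable g (volume.restrict U)) :
    ∫⁻ p, ‖smear k U g p‖ₑ ^ (2 : ℝ) ≤ ∫⁻ y in U, ‖g y‖ₑ ^ (2 : ℝ) := by
  have hkm : ∀ p : Space d, Measurable fun y => ENNReal.ofReal (k (y - p)) := fun p => by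
    fun_prop
  have h1 : ∀ p, ‖smear k U g p‖ₑ ^ (2 : ℝ)
      ≤ ∫⁻ y in U, ENNReal.ofReal (k (y - p)) * ‖g y‖ₑ ^ (2 : ℝ) := by
    intro p
    set ν := (volume.restrict U).withDensity fun y => ENNReal.ofReal (k (y - p))
    have hν : ν univ ≤ 1 := by
      rw [withDensity_apply _ MeasurableSet.univ, Measure.restrict_univ]
      refine (setLIntegral_le_lintegral _ _).trans ?_
      rw [lintegral_sub_right_eq_self (fun y => ENNReal.ofReal (k y)) p, hk1]
    have hac : ν ≪ volume.restrict U := withDensity_absolutelyContinuous _ _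
    calc ‖smear k U g p‖ₑ ^ (2 : ℝ) ≤ (∫⁻ y in U, ENNReal.ofReal (k (y - p)) * ‖g y‖ₑ) ^
      (2 : ℝ) := by
          refine ENNReal.rpow_le_rpow ((enorm_integral_le_lintegral_enorm _).trans_eq
            ?_) zero_le_two
          refine lintegral_congr fun y => ?_
          rw [enorm_mul, ← ofReal_norm (k (y - p) : ℂ), Complex.norm_real,
            Real.norm_of_nonneg (hk0 _)]
      _ = (∫⁻ y, ‖g y‖ₑ ∂ν) ^ (2 : ℝ) := by
          rw [lintegral_withDensity_eq_lintegral_mul₀ (hkm p).aemeasurable hg.enorm]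
          rfl
      _ ≤ ν univ * ∫⁻ y, ‖g y‖ₑ ^ (2 : ℝ) ∂ν := sq_lintegral_le (hg.mono_ac hac).enorm
      _ ≤ 1 * ∫⁻ y, ‖g y‖ₑ ^ (2 : ℝ) ∂ν := by gcongr
      _ = _ := by
          rw [one_mul, lintegral_withDensity_eq_lintegral_mul₀ (hkm p).aemeasurable
            (hg.enorm.pow_const _)]
          rfl
  calc _ ≤ ∫⁻ p, ∫⁻ y in U, ENNReal.ofReal (k (y - p)) * ‖g y‖ₑ ^ (2 : ℝ) := lintegral_mono h1
    _ = ∫⁻ y in U, ∫⁻ p, ENNReal.ofReal (k (y - p)) * ‖g y‖ₑ ^ (2 : ℝ) := by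
        refine lintegral_lintegral_swap (AEMeasurable.mul ?_ ?_)
        · have : Continuous fun q : Space d × Space d => k (q.2 - q.1) := by fun_prop
          exact (ENNReal.measurable_ofReal.comp this.measurable).aemeasurable
        · exact (hg.enorm.pow_const _).comp_quasiMeasurePreserving
            Measure.quasiMeasurePreserving_snd
    _ = ∫⁻ y in U, ‖g y‖ₑ ^ (2 : ℝ) := by
        refine lintegral_congr fun y => ?_
        rw [lintegral_mul_const _ (by fun_prop),
          lintegral_sub_left_eq_self (fun y => ENNReal.ofReal (k y)) y, hk1, one_mul]

/-- A sequence of mollifiers. -/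
noncomputable def mollifier (d n : ℕ) : ContDiffBump (0 : Space d) :=
  ⟨1 / (2 * (n + 1)), 1 / (n + 1), by positivity, by
    rw [one_div_lt_one_div (by positivity) (by positivity)]
    linarith [(Nat.cast_nonneg n : (0 : ℝ) ≤ n)]⟩

theorem tendsto_smear_mollifier {U : Set (Space d)} (hU : MeasurableSet U) {u : Space d → ℂ}
    (hu : IntegrableOn u U) : ∀ᵐ x, Tendsto (fun n => smear ((mollifier d n).normed volume) U u x)
      atTop (𝓝 (U.indicator u x)) := by
  have hli : LocallyIntegrable (U.indicator u) :=
    ((integrable_indicator_iff hU).2 hu).locallyIntegrable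
  have hlim : Tendsto (fun n => (mollifier d n).rOut) atTop (𝓝 0) :=
    tendsto_one_div_add_atTop_nhds_zero_nat
  filter_upwards [ContDiffBump.ae_convolution_tendsto_right_of_locallyIntegrable (K := 2) hlim
    (Eventually.of_forall fun n => by
      change (1 : ℝ) / (n + 1) ≤ 2 * (1 / (2 * (n + 1)))
      apply le_of_eq
      field_simp) hli] with x hx
  refine hx.congr fun n => ?_
  rw [smear_eq_convolution hU, ← convolution_flip]
  simp only [convolution, ContinuousLinearMap.flip_apply]
  refine integral_congr_ae (Eventually.of_forall fun y => ?_)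
  simp only [ContDiffBump.normed_neg]

theorem lintegral_ofReal_normed (φ : ContDiffBump (0 : Space d)) :
    ∫⁻ z, ENNReal.ofReal (φ.normed volume z) = 1 := by
  rw [← ofReal_integral_eq_lintegral_ofReal φ.integrable_normed
    (Eventually.of_forall φ.nonneg_normed), φ.integral_normed, ENNReal.ofReal_one]

/-- The difference of the values of a smooth function at the ends of a segment, in terms of its
partial derivatives. -/
theorem enorm_sub_sq_le_lintegral {s : Space d → ℂ} (hs : ContDiff ℝ 1 s) (y τ : Space d) :
    ‖s (y + τ) - s y‖ₑ ^ (2 : ℝ) ≤ ‖τ‖ₑ ^ (2 : ℝ) * ∫⁻ t in Icc (0 : ℝ) 1,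
      ∑ i, ‖fderiv ℝ s (y + t • τ) (EuclideanSpace.single i 1)‖ₑ ^ (2 : ℝ) := by
  have hc : Continuous fun t : ℝ => fderiv ℝ s (y + t • τ) τ :=
    ((hs.continuous_fderiv one_ne_zero).comp (by fun_prop)).clm_apply continuous_const
  have h1 : s (y + τ) - s y = ∫ t in (0 : ℝ)..1, fderiv ℝ s (y + t • τ) τ := by
    have hd : ∀ t ∈ uIcc (0 : ℝ) 1,
        HasDerivAt (fun t : ℝ => s (y + t • τ)) (fderiv ℝ s (y + t • τ) τ) t := by
      intro t _
      have ha : HasDerivAt (fun t : ℝ => y + t • τ) τ t := by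
        simpa using ((hasDerivAt_id t).smul_const τ).const_add y
      exact (hs.differentiable one_ne_zero _).hasFDerivAt.comp_hasDerivAt t ha
    rw [intervalIntegral.integral_eq_sub_of_hasDerivAt hd (hc.intervalIntegrable _ _)]
    simp
  have h2 : ∀ z, ‖fderiv ℝ s z τ‖ₑ ^ (2 : ℝ)
      ≤ ‖τ‖ₑ ^ (2 : ℝ) * ∑ i, ‖fderiv ℝ s z (EuclideanSpace.single i 1)‖ₑ ^ (2 : ℝ) := by
    intro z
    have hτ : τ = ∑ i, τ i • EuclideanSpace.single i (1 : ℝ) := by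
      have := (EuclideanSpace.basisFun (Fin d) ℝ).sum_repr τ
      simpa using this.symm
    have hn : ‖fderiv ℝ s z τ‖ ≤ ∑ i, |τ i| * ‖fderiv ℝ s z (EuclideanSpace.single i 1)‖ := by
      conv_lhs => rw [hτ, map_sum]
      refine (norm_sum_le _ _).trans_eq (Finset.sum_congr rfl fun i _ => ?_)
      rw [map_smul, norm_smul, Real.norm_eq_abs]
    have hcs := Finset.sum_mul_sq_le_sq_mul_sq Finset.univ (fun i => |τ i|)
      (fun i => ‖fderiv ℝ s z (EuclideanSpace.single i 1)‖)
    have hr : ‖fderiv ℝ s z τ‖ ^ 2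
        ≤ ‖τ‖ ^ 2 * ∑ i, ‖fderiv ℝ s z (EuclideanSpace.single i 1)‖ ^ 2 := by
      rw [EuclideanSpace.norm_sq_eq]
      refine (pow_le_pow_left₀ (norm_nonneg _) hn 2).trans ?_
      simpa using hcs
    have := ENNReal.ofReal_le_ofReal hr
    rw [ENNReal.ofReal_mul (by positivity), ENNReal.ofReal_sum_of_nonneg (fun i _ => by positivity),
      ENNReal.ofReal_pow (norm_nonneg _), ENNReal.ofReal_pow (norm_nonneg _)] at this
    simp only [ENNReal.ofReal_pow (norm_nonneg _), ofReal_norm] at this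
    simpa using this
  calc ‖s (y + τ) - s y‖ₑ ^ (2 : ℝ)
      ≤ (∫⁻ t in Icc (0 : ℝ) 1, ‖fderiv ℝ s (y + t • τ) τ‖ₑ) ^ (2 : ℝ) := by
        refine ENNReal.rpow_le_rpow ?_ zero_le_two
        rw [h1, intervalIntegral.integral_of_le zero_le_one, ← integral_Icc_eq_integral_Ioc]
        exact enorm_integral_le_lintegral_enorm _
    _ ≤ (volume.restrict (Icc (0 : ℝ) 1)) univ
          * ∫⁻ t in Icc (0 : ℝ) 1, ‖fderiv ℝ s (y + t • τ) τ‖ₑ ^ (2 : ℝ) :=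
        sq_lintegral_le hc.measurable.enorm.aemeasurable
    _ ≤ 1 * ∫⁻ t in Icc (0 : ℝ) 1, ‖τ‖ₑ ^ (2 : ℝ)
          * ∑ i, ‖fderiv ℝ s (y + t • τ) (EuclideanSpace.single i 1)‖ₑ ^ (2 : ℝ) := by
        gcongr
        · simp
        · exact h2 _
    _ = _ := by
        rw [one_mul, lintegral_const_mul']
        exact ENNReal.rpow_ne_top_of_nonneg zero_le_two enorm_ne_top

/-- Translation estimate: the `L²` norm of a difference of translates is controlled by the weak
gradient on the region that is swept by the translation. -/
theorem lintegral_translate_sub_sq_le {U : Set (Space d)} (hU : IsOpen U) {u : Space d → ℂ}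
    {g : Fin d → Space d → ℂ} (hu : IntegrableOn u U) (hg : ∀ i, IntegrableOn (g i) U)
    (hw : ∀ i, IsWeakPartial U i u (g i)) {P : Set (Space d)} (hP : MeasurableSet P) {τ : Space d}
    (hseg : ∀ y ∈ P, ∀ t ∈ Icc (0 : ℝ) 1, y + t • τ ∈ U) :
    ∫⁻ y in P, ‖u (y + τ) - u y‖ₑ ^ (2 : ℝ)
      ≤ ‖τ‖ₑ ^ (2 : ℝ) * ∑ i, ∫⁻ y in U, ‖g i y‖ₑ ^ (2 : ℝ) := by
  set k : ℕ → Space d → ℝ := fun n => (mollifier d n).normed volume with hkdef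
  have hk : ∀ n, ContDiff ℝ ∞ (k n) := fun n => (mollifier d n).contDiff_normed
  have hkc : ∀ n, HasCompactSupport (k n) := fun n => (mollifier d n).hasCompactSupport_normed
  set s : ℕ → Space d → ℂ := fun n => smear (k n) U u with hs
  set F : ℕ → Space d → ℝ≥0∞ := fun n y => ‖τ‖ₑ ^ (2 : ℝ) * ∫⁻ t in Icc (0 : ℝ) 1,
      ∑ i, ‖smear (k n) U (g i) (y + t • τ)‖ₑ ^ (2 : ℝ) with hF
  have hgc : ∀ n i, Continuous (smear (k n) U (g i)) := fun n i =>
    (hasFDerivAt_smear (hk n) (hkc n) hU.measurableSet (hg i)).1.continuous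
  have hτtop : ‖τ‖ₑ ^ (2 : ℝ) ≠ ⊤ := ENNReal.rpow_ne_top_of_nonneg zero_le_two enorm_ne_top
  have hmeas : ∀ n, Measurable fun q : Space d × ℝ =>
      ∑ i, ‖smear (k n) U (g i) (q.1 + q.2 • τ)‖ₑ ^ (2 : ℝ) := by
    intro n
    refine Finset.measurable_sum _ fun i _ => ?_
    have : Continuous fun q : Space d × ℝ => smear (k n) U (g i) (q.1 + q.2 • τ) :=
      (hgc n i).comp (by fun_prop)
    exact this.measurable.enorm.pow_const _
  have hFm : ∀ n, Measurable (F n) := fun n => (hmeas n).lintegral_prod_right'.const_mul _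
  have hpt : ∀ᵐ y ∂(volume.restrict P),
      ‖u (y + τ) - u y‖ₑ ^ (2 : ℝ) ≤ liminf (fun n => F n y) atTop := by
    have hae := tendsto_smear_mollifier hU.measurableSet hu
    have hae' : ∀ᵐ y, Tendsto (fun n => s n (y + τ)) atTop (𝓝 (U.indicator u (y + τ))) :=
      (measurePreserving_add_right volume τ).quasiMeasurePreserving.ae hae
    filter_upwards [ae_restrict_mem hP, ae_restrict_of_ae hae, ae_restrict_of_ae hae']
      with y hy h1 h2
    have hy0 : y ∈ U := by simpa using hseg y hy 0 ⟨le_rfl, zero_le_one⟩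
    have hy1 : y + τ ∈ U := by simpa using hseg y hy 1 ⟨zero_le_one, le_rfl⟩
    rw [indicator_of_mem hy0] at h1
    rw [indicator_of_mem hy1] at h2
    have hlim : Tendsto (fun n => ‖s n (y + τ) - s n y‖ₑ ^ (2 : ℝ)) atTop
        (𝓝 (‖u (y + τ) - u y‖ₑ ^ (2 : ℝ))) := (h2.sub h1).enorm.ennrpow_const 2
    rw [← hlim.liminf_eq]
    refine liminf_le_liminf ?_
    have hcomp : IsCompact ((fun t : ℝ => y + t • τ) '' Icc 0 1) :=
      isCompact_Icc.image (by fun_prop)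
    obtain ⟨δ, hδ, hδU⟩ := hcomp.exists_thickening_subset_open hU
      (by rintro _ ⟨t, ht, rfl⟩; exact hseg y hy t ht)
    filter_upwards [(tendsto_one_div_add_atTop_nhds_zero_nat (𝕜 := ℝ)).eventually (gt_mem_nhds hδ)]
      with n hn
    have hsm := (hasFDerivAt_smear (hk n) (hkc n) hU.measurableSet hu).1
    refine (enorm_sub_sq_le_lintegral (hsm.of_le (by exact_mod_cast le_top)) y τ).trans_eq ?_
    simp only [hF]
    congr 1
    refine setLIntegral_congr_fun measurableSet_Icc fun t ht => ?_
    refine Finset.sum_congr rfl fun i _ => ?_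
    rw [fderiv_smear_of_weakPartial (hk n) (hkc n) hU hu (hw i)]
    intro z hz
    refine hδU (Metric.mem_thickening_iff.2 ⟨_, ⟨t, ht, rfl⟩, ?_⟩)
    rw [hkdef, ContDiffBump.tsupport_normed_eq, mem_closedBall_zero_iff, ← dist_eq_norm] at hz
    exact hz.trans_lt hn
  refine (lintegral_mono_ae hpt).trans ?_
  refine (lintegral_liminf_le hFm).trans ?_
  refine liminf_le_of_frequently_le' (Eventually.frequently (Eventually.of_forall fun n => ?_))
  simp only [hF]
  rw [lintegral_const_mul' _ _ hτtop]
  gcongr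
  rw [lintegral_lintegral_swap (hmeas n).aemeasurable]
  calc _ ≤ ∫⁻ t in Icc (0 : ℝ) 1, ∑ i, ∫⁻ y in U, ‖g i y‖ₑ ^ (2 : ℝ) := by
        refine lintegral_mono fun t => ?_
        rw [lintegral_finsetSum _ fun i _ => ?_]
        · refine Finset.sum_le_sum fun i _ => ?_
          refine (setLIntegral_le_lintegral _ _).trans ?_
          rw [lintegral_add_right_eq_self (fun y => ‖smear (k n) U (g i) y‖ₑ ^ (2 : ℝ)) (t • τ)]
          exact lintegral_smear_sq_le (hk n).continuous (mollifier d n).nonneg_normed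
            (lintegral_ofReal_normed _) (hg i).aemeasurable
        · exact ((hgc n i).comp (by fun_prop : Continuous fun y => y + t •
          τ)).measurable.enorm.pow_const _
    _ = _ := by simp

/-! ### Traces of functions with small mean oscillation near the boundary -/

/-- A smooth bump of integral one in the ball of radius `1 / 2`. -/
noncomputable def unitBump (d : ℕ) : ContDiffBump (0 : Space d) :=
  ⟨1 / 4, 1 / 2, by norm_num, by norm_num⟩

/-- A smooth kernel of integral one in the ball of radius `r` around `M r e`. -/
noncomputable def coneKernel (e : Space d) (M r : ℝ) (z : Space d) : ℝ :=
  (r ^ d)⁻¹ * (unitBump d).normed volume (r⁻¹ • z - M • e)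

/-- The average of `u` over the ball of radius `r` around `x + M r e`, as a function of `x`. -/
noncomputable def coneMean (Ω : Set (Space d)) (e : Space d) (M r : ℝ) (u : Space d → ℂ) :
    Space d → ℂ :=
  smear (coneKernel e M r) Ω u

/-- The total squared difference of the values of `u` in the two balls of radius `r` around `x` and
`x + M r e`. -/
noncomputable def coneOsc (Ω : Set (Space d)) (e : Space d) (M r : ℝ) (u : Space d → ℂ)
    (x : Space d) : ℝ≥0∞ :=
  ∫⁻ y in Metric.ball x r ∩ Ω, ∫⁻ z in Metric.ball (x + (M * r) • e) r, ‖u y - u z‖ₑ ^ (2 : ℝ)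

section Kernel

variable (e : Space d) (M : ℝ) {r : ℝ}

theorem coneKernel_nonneg (hr : 0 < r) (z : Space d) : 0 ≤ coneKernel e M r z :=
  mul_nonneg (by positivity) ((unitBump d).nonneg_normed _)

theorem contDiff_coneKernel (r : ℝ) : ContDiff ℝ ∞ (coneKernel e M r) :=
  contDiff_const.mul ((unitBump d).contDiff_normed.comp
    ((contDiff_const_smul _).sub contDiff_const))

theorem norm_sub_le_of_mem_tsupport (hr : 0 < r) {z : Space d}
    (hz : z ∈ tsupport (coneKernel e M r)) : ‖z - (M * r) • e‖ ≤ r / 2 := by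
  have hcl : IsClosed {z : Space d | ‖z - (M * r) • e‖ ≤ r / 2} :=
    isClosed_le (by fun_prop) continuous_const
  refine closure_minimal (fun w hw => ?_) hcl hz
  have h1 : (unitBump d).normed volume (r⁻¹ • w - M • e) ≠ 0 := right_ne_zero_of_mul hw
  have h2 : r⁻¹ • w - M • e ∈ Metric.ball (0 : Space d) (1 / 2) := by
    have := Function.mem_support.2 h1
    rwa [ContDiffBump.support_normed_eq] at this
  rw [mem_ball_zero_iff] at h2
  have h3 : w - (M * r) • e = r • (r⁻¹ • w - M • e) := by
    rw [smul_sub, smul_smul, smul_smul, mul_inv_cancel₀ hr.ne', one_smul, mul_comm]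
  rw [mem_ofPred_eq, h3, norm_smul, Real.norm_of_nonneg hr.le]
  nlinarith

theorem hasCompactSupport_coneKernel (hr : 0 < r) : HasCompactSupport (coneKernel e M r) :=
  HasCompactSupport.of_support_subset_isCompact (isCompact_closedBall ((M * r) • e) (r / 2))
    fun z hz => by
      rw [mem_closedBall_iff_norm]
      exact norm_sub_le_of_mem_tsupport e M hr (subset_tsupport _ hz)

theorem integral_coneKernel (hr : 0 < r) : ∫ z, coneKernel e M r z = 1 := by
  simp only [coneKernel]
  rw [integral_const_mul, Measure.integral_comp_smul volume
    (fun w => (unitBump d).normed volume (w - M • e)), integral_sub_right_eq_self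
    (fun w => (unitBump d).normed volume w), ContDiffBump.integral_normed,
    finrank_euclideanSpace_fin]
  have : 0 < r ^ d := by positivity
  simp only [inv_pow, inv_inv, smul_eq_mul, mul_one]
  rw [abs_of_pos this, inv_mul_cancel₀ this.ne']

theorem exists_coneKernel_le (d : ℕ) : ∃ K : ℝ≥0, ∀ (e : Space d) (M r : ℝ), 0 < r → ∀ z,
    ENNReal.ofReal (coneKernel e M r z) ≤ K * (ENNReal.ofReal r ^ d)⁻¹ := by
  obtain ⟨B, hB⟩ := (unitBump d).contDiff_normed (μ := volume) (n := 0)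
    |>.continuous.bounded_above_of_compact_support (unitBump d).hasCompactSupport_normed
  refine ⟨Real.toNNReal B, fun e M r hr z => ?_⟩
  rw [coneKernel, ENNReal.ofReal_mul (by positivity), mul_comm, ENNReal.ofReal_inv_of_pos
    (by positivity), ENNReal.ofReal_pow hr.le]
  gcongr
  exact ENNReal.ofReal_le_ofReal ((le_abs_self _).trans (hB _))

end Kernel

theorem enorm_coneKernel {e : Space d} {M r : ℝ} (hr : 0 < r) (z : Space d) :
    ‖(coneKernel e M r z : ℂ)‖ₑ = ENNReal.ofReal (coneKernel e M r z) := by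
  rw [← ofReal_norm, Complex.norm_real, Real.norm_of_nonneg (coneKernel_nonneg e M hr z)]

/-- A constant is compared with a cone mean by averaging the difference. -/
theorem enorm_sub_coneMean_le {Ω : Set (Space d)} {u : Space d → ℂ}
    (hu : IntegrableOn u Ω) {e : Space d} {M r : ℝ} (hr : 0 < r) {x : Space d}
    (hsub : Metric.ball (x + (M * r) • e) r ⊆ Ω) {K : ℝ≥0}
    (hK : ∀ z, ENNReal.ofReal (coneKernel e M r z) ≤ K * (ENNReal.ofReal r ^ d)⁻¹) (a : ℂ) :
    ‖a - coneMean Ω e M r u x‖ₑ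
      ≤ K * (ENNReal.ofReal r ^ d)⁻¹ * ∫⁻ z in Metric.ball (x + (M * r) • e) r, ‖a - u z‖ₑ := by
  set k := coneKernel e M r
  have hzero : ∀ z, z ∉ Metric.ball (x + (M * r) • e) r → k (z - x) = 0 := by
    intro z hz
    by_contra hne
    have := norm_sub_le_of_mem_tsupport e M hr (subset_tsupport _ (Function.mem_support.2 hne))
    refine hz (mem_ball_iff_norm.2 ?_)
    rw [sub_sub] at this
    linarith
  have hkint : Integrable (fun z => (k (z - x) : ℂ)) :=
    (((contDiff_coneKernel e M r).continuous.integrable_of_hasCompactSupport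
      (hasCompactSupport_coneKernel e M hr)).comp_sub_right x).ofReal
  have h1 : a = ∫ z in Ω, (k (z - x) : ℂ) * a := by
    rw [integral_mul_const, setIntegral_eq_integral_of_forall_compl_eq_zero]
    · rw [integral_complex_ofReal, integral_sub_right_eq_self k x, integral_coneKernel e M hr]
      simp
    · intro z hz
      rw [hzero z fun h => hz (hsub h), Complex.ofReal_zero]
  have hbd : ∃ B, ∀ z, ‖(k (z - x) : ℂ)‖ ≤ B := by
    obtain ⟨B, hB⟩ := (contDiff_coneKernel e M r).continuous.bounded_above_of_compact_support
      (hasCompactSupport_coneKernel e M hr)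
    exact ⟨B, fun z => by rw [Complex.norm_real]; exact hB _⟩
  obtain ⟨B, hB⟩ := hbd
  have hkm : AEStronglyMeasurable (fun z => (k (z - x) : ℂ)) (volume.restrict Ω) :=
    hkint.aestronglyMeasurable.restrict
  have h2 : Integrable (fun z => (k (z - x) : ℂ) * u z) (volume.restrict Ω) :=
    hu.bdd_mul hkm (Eventually.of_forall hB)
  have h3 : a - coneMean Ω e M r u x = ∫ z in Ω, (k (z - x) : ℂ) * (a - u z) := by
    rw [coneMean, smear]
    conv_lhs => rw [h1]
    rw [← integral_sub (hkint.restrict.mul_const a) h2]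
    simp only [mul_sub]
  rw [h3]
  calc _ ≤ ∫⁻ z in Ω, ‖(k (z - x) : ℂ) * (a - u z)‖ₑ := enorm_integral_le_lintegral_enorm _
    _ ≤ ∫⁻ z in Metric.ball (x + (M * r) • e) r, ‖(k (z - x) : ℂ) * (a - u z)‖ₑ := by
        rw [← lintegral_indicator measurableSet_ball]
        refine (setLIntegral_le_lintegral _ _).trans (lintegral_mono fun z => ?_)
        by_cases hz : z ∈ Metric.ball (x + (M * r) • e) r
        · rw [indicator_of_mem hz]
        · rw [indicator_of_notMem hz, hzero z hz]
          simp
    _ ≤ ∫⁻ z in Metric.ball (x + (M * r) • e) r, K * (ENNReal.ofReal r ^ d)⁻¹ * ‖a - u z‖ₑ := by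
        refine lintegral_mono fun z => ?_
        rw [enorm_mul, enorm_coneKernel hr]
        gcongr
        exact hK _
    _ = _ := by
        rw [lintegral_const_mul']
        exact ENNReal.mul_ne_top ENNReal.coe_ne_top (ENNReal.inv_ne_top.2
          (pow_ne_zero _ (ENNReal.ofReal_pos.2 hr).ne'))

theorem measurable_coneOsc {Ω : Set (Space d)} (hΩ : IsOpen Ω) (e : Space d) (M r : ℝ)
    {u : Space d → ℂ} (hu : Measurable u) : Measurable (coneOsc Ω e M r u) := by
  have h1 : coneOsc Ω e M r u = fun x => ∫⁻ y, ∫⁻ z,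
      {q : (Space d × Space d) × Space d | dist q.1.2 q.1.1 < r ∧ q.1.2 ∈ Ω ∧
        dist q.2 (q.1.1 + (M * r) • e) < r}.indicator
        (fun q => ‖u q.1.2 - u q.2‖ₑ ^ (2 : ℝ)) ((x, y), z) := by
    funext x
    rw [coneOsc, ← lintegral_indicator (Metric.isOpen_ball.inter hΩ).measurableSet]
    refine lintegral_congr fun y => ?_
    by_cases hy : y ∈ Metric.ball x r ∩ Ω
    · rw [indicator_of_mem hy, ← lintegral_indicator measurableSet_ball]
      refine lintegral_congr fun z => ?_
      have hy1 : dist y x < r := hy.1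
      have hy2 : y ∈ Ω := hy.2
      by_cases hz : z ∈ Metric.ball (x + (M * r) • e) r
      · have hz' : dist z (x + (M * r) • e) < r := hz
        rw [indicator_of_mem hz, indicator_of_mem]
        exact ⟨hy1, hy2, hz'⟩
      · rw [indicator_of_notMem hz, indicator_of_notMem]
        exact fun h => hz h.2.2
    · rw [indicator_of_notMem hy]
      symm
      rw [lintegral_eq_zero_of_ae_eq_zero]
      refine Eventually.of_forall fun z => ?_
      exact indicator_of_notMem (fun h => hy ⟨h.1, h.2.1⟩) _
  rw [h1]
  suffices h : Measurable ({q : (Space d × Space d) × Space d | dist q.1.2 q.1.1 < r ∧ q.1.2 ∈ Ω ∧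
      dist q.2 (q.1.1 + (M * r) • e) < r}.indicator (fun q => ‖u q.1.2 - u q.2‖ₑ ^ (2 : ℝ))) from
    h.lintegral_prod_right'.lintegral_prod_right'
  refine Measurable.indicator ?_ ?_
  · fun_prop
  refine (measurableSet_lt (f := fun q : (Space d × Space d) × Space d => dist q.1.2 q.1.1)
    (by fun_prop)
      measurable_const).inter (MeasurableSet.inter ?_ ?_)
  · have hf : Measurable fun q : (Space d × Space d) × Space d => q.1.2 := by fun_prop
    exact hf hΩ.measurableSet
  · exact measurableSet_lt (f := fun q : (Space d × Space d) × Space d => dist q.2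
    (q.1.1 + (M * r) • e)) (by fun_prop)
      measurable_const

/-- A sequence in `L²` with geometrically decaying increments converges in `L²` and almost
everywhere. -/
theorem exists_limit_of_geometric {α : Type*} [MeasurableSpace α] {μ : Measure α} {f : ℕ → α → ℂ}
    (hf : ∀ n, MemLp (f n) 2 μ) {C q : ℝ} (hC : 0 ≤ C) (hq0 : 0 ≤ q) (hq : q < 1)
    (h : ∀ n, eLpNorm (f (n + 1) - f n) 2 μ ≤ ENNReal.ofReal (C * q ^ n)) :
    ∃ b, MemLp b 2 μ ∧ (∀ᵐ x ∂μ, Tendsto (fun n => f n x) atTop (𝓝 (b x))) ∧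
      Tendsto (fun n => eLpNorm (f n - b) 2 μ) atTop (𝓝 0) := by
  have hq1 : 0 < 1 - q := by linarith
  have key : ∀ N j, eLpNorm (f (N + j) - f N) 2 μ
      ≤ ENNReal.ofReal (C * q ^ N * (1 - q ^ j) / (1 - q)) := by
    intro N j
    induction j with
    | zero => simp
    | succ j ih =>
      have h1 : f (N + (j + 1)) - f N = (f (N + j + 1) - f (N + j)) + (f (N + j) - f N) := by
        rw [← add_assoc]; abel
      have hqj : q ^ j ≤ 1 := pow_le_one₀ hq0 hq.le
      rw [h1]
      refine (eLpNorm_add_le ((hf _).sub (hf _)).1 ((hf _).sub (hf _)).1 one_le_two).trans ?_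
      refine (add_le_add (h (N + j)) ih).trans ?_
      rw [← ENNReal.ofReal_add (by positivity)
        (div_nonneg (mul_nonneg (by positivity) (by linarith)) hq1.le)]
      refine ENNReal.ofReal_le_ofReal (le_of_eq ?_)
      field_simp
      ring
  set B : ℕ → ℝ≥0∞ := fun N => ENNReal.ofReal ((2 * C / (1 - q)) * q ^ N + (1 / 2) ^ N) with hB
  have hsum : ∑' N, B N ≠ ⊤ := by
    rw [hB, ← ENNReal.ofReal_tsum_of_nonneg (fun n => by positivity)]
    · exact ENNReal.ofReal_ne_top
    · exact ((summable_geometric_of_lt_one hq0 hq).mul_left _).add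
        (summable_geometric_of_lt_one (by norm_num) (by norm_num))
  have key2 : ∀ N n, N ≤ n → eLpNorm (f n - f N) 2 μ ≤ ENNReal.ofReal (C / (1 - q) * q ^ N) := by
    intro N n hn
    obtain ⟨j, rfl⟩ := Nat.exists_eq_add_of_le hn
    refine (key N j).trans (ENNReal.ofReal_le_ofReal ?_)
    rw [mul_comm (C / (1 - q)), ← mul_div_assoc, mul_comm (q ^ N)]
    have : 0 ≤ q ^ j := by positivity
    have h2 : 0 ≤ C * q ^ N := by positivity
    refine div_le_div_of_nonneg_right ?_ hq1.le
    nlinarith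
  have hcau : ∀ N n m : ℕ, N ≤ n → N ≤ m → eLpNorm (f n - f m) 2 μ < B N := by
    intro N n m hn hm
    have h1 : f n - f m = (f n - f N) - (f m - f N) := by abel
    rw [h1]
    refine (eLpNorm_sub_le ((hf _).sub (hf _)).1 ((hf _).sub (hf _)).1 one_le_two).trans_lt ?_
    refine (add_le_add (key2 N n hn) (key2 N m hm)).trans_lt ?_
    rw [← ENNReal.ofReal_add (by positivity) (by positivity)]
    refine (ENNReal.ofReal_lt_ofReal_iff (by positivity)).2 ?_
    have : (0 : ℝ) < (1 / 2) ^ N := by positivity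
    have h2 : C / (1 - q) * q ^ N + C / (1 - q) * q ^ N = 2 * C / (1 - q) * q ^ N := by ring
    linarith
  have hlim := Lp.ae_tendsto_of_cauchy_eLpNorm (fun n => (hf n).1) one_le_two hsum hcau
  obtain ⟨b, hb, hblim⟩ := exists_stronglyMeasurable_limit_of_tendsto_ae (fun n => (hf n).1) hlim
  have hL2 := Lp.cauchy_tendsto_of_tendsto (p := 2) (fun n => (hf n).1) b hsum hcau hblim
  refine ⟨b, ?_, hblim, hL2⟩
  obtain ⟨n, hn⟩ := (hL2.eventually (gt_mem_nhds ENNReal.zero_lt_top)).exists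
  have h1 : MemLp (f n - b) 2 μ := ⟨(hf n).1.sub hb.aestronglyMeasurable, hn⟩
  have h2 := (hf n).sub h1
  simpa using h2

theorem volume_ball_eq (x : Space d) {r : ℝ} (hr : 0 < r) : volume (Metric.ball x r)
    = ENNReal.ofReal r ^ d * volume (Metric.ball (0 : Space d) 1) := by
  rw [Measure.addHaar_ball_of_pos _ _ hr, finrank_euclideanSpace_fin, ENNReal.ofReal_pow hr.le]

/-- The mean difference of the values of `u` in the two balls, controlled by Cauchy-Schwarz. -/
theorem sq_lintegral_lintegral_le_coneOsc {Ω : Set (Space d)} (e : Space d) (M : ℝ)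
    {r : ℝ} (hr : 0 < r) {u : Space d → ℂ} (hu : Measurable u) (x : Space d) :
    (∫⁻ y in Metric.ball x r ∩ Ω, ∫⁻ z in Metric.ball (x + (M * r) • e) r, ‖u y - u z‖ₑ) ^ (2 : ℝ)
      ≤ (ENNReal.ofReal r ^ d * volume (Metric.ball (0 : Space d) 1)) ^ 2
        * coneOsc Ω e M r u x := by
  set V := ENNReal.ofReal r ^ d * volume (Metric.ball (0 : Space d) 1)
  have hm : Measurable fun q : Space d × Space d => ‖u q.1 - u q.2‖ₑ := by fun_prop
  have hV : V ≠ ⊤ := ENNReal.mul_ne_top (ENNReal.pow_ne_top ENNReal.ofReal_ne_top)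
    measure_ball_lt_top.ne
  refine (sq_lintegral_le hm.lintegral_prod_right'.aemeasurable).trans ?_
  rw [Measure.restrict_apply_univ, sq, mul_assoc]
  refine mul_le_mul' ((measure_mono inter_subset_left).trans_eq (volume_ball_eq x hr)) ?_
  rw [coneOsc, ← lintegral_const_mul' _ _ hV]
  refine lintegral_mono fun y => ?_
  refine (sq_lintegral_le (by fun_prop)).trans_eq ?_
  rw [Measure.restrict_apply_univ, volume_ball_eq _ hr]

/-- **Trace theorem.** If the mean oscillations of `u` at scale `r` near the points of `S` decay
like a power of `r` in `L²(μ)`, then the averages of `u` over small balls inside the cones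
converge in `L²(μ)`, and the limit is the trace of `u` at almost every point. -/
theorem exists_trace_of_coneOsc {Ω S : Set (Space d)} (hΩ : IsOpen Ω) {e : Space d} {M r₀ : ℝ}
    (hcone : ConeCondition Ω S e M r₀) {μ : Measure (Space d)} [IsFiniteMeasure μ]
    (hμ : ∀ᵐ x ∂μ, x ∈ S) {u : Space d → ℂ} (hum : Measurable u) (hu : IntegrableOn u Ω)
    {C : ℝ≥0} {α : ℝ} (hα : 0 < α)
    (hosc : ∀ r, 0 < r → r < r₀ → ∫⁻ x, coneOsc Ω e M r u x ∂μ
      ≤ C * (ENNReal.ofReal r ^ d) ^ 2 * ENNReal.ofReal (r ^ α)) :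
    ∃ b, MemLp b 2 μ ∧ (∀ᵐ x ∂μ, HasTraceAt Ω u x (b x)) ∧
      Tendsto (fun k : ℕ => eLpNorm (coneMean Ω e M (r₀ / 2 * (1 / (M + 1)) ^ k) u - b) 2 μ)
        atTop (𝓝 0) := by
  have hM := hcone.two_le
  have hr₀ := hcone.pos
  set l : ℝ := 1 / (M + 1) with hl
  have hl0 : 0 < l := by rw [hl]; positivity
  have hl1 : l < 1 := by rw [hl, div_lt_one (by linarith)]; linarith
  set R : ℕ → ℝ := fun k => r₀ / 2 * l ^ k with hR
  have hRpos : ∀ k, 0 < R k := fun k => by simp only [hR]; positivity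
  have hRlt : ∀ k, R k < r₀ := fun k => by
    have : l ^ k ≤ 1 := pow_le_one₀ hl0.le hl1.le
    simp only [hR]
    nlinarith
  have hRsucc : ∀ k, R (k + 1) = l * R k := fun k => by simp only [hR]; ring
  obtain ⟨K, hK⟩ := exists_coneKernel_le d
  set κ := volume (Metric.ball (0 : Space d) 1) with hκ
  have hκ0 : κ ≠ 0 := (Metric.measure_ball_pos _ _ one_pos).ne'
  have hκt : κ ≠ ⊤ := measure_ball_lt_top.ne
  set D : ℕ → ℝ≥0∞ := fun k => ENNReal.ofReal (R k) ^ d with hD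
  have hD0 : ∀ k, D k ≠ 0 := fun k => pow_ne_zero _ (ENNReal.ofReal_pos.2 (hRpos k)).ne'
  have hDt : ∀ k, D k ≠ ⊤ := fun k => ENNReal.pow_ne_top ENNReal.ofReal_ne_top
  set L : ℝ≥0∞ := ENNReal.ofReal l ^ d with hLdef
  have hL0 : L ≠ 0 := pow_ne_zero _ (ENNReal.ofReal_pos.2 hl0).ne'
  have hLt : L ≠ ⊤ := ENNReal.pow_ne_top ENNReal.ofReal_ne_top
  have hDsucc : ∀ k, D (k + 1) = L * D k := fun k => by
    simp only [hD, hLdef, hRsucc, ENNReal.ofReal_mul hl0.le, mul_pow]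
  set A : ℕ → Space d → ℂ := fun k => coneMean Ω e M (R k) u with hA
  set J : ℕ → Space d → ℝ≥0∞ := fun k x => ∫⁻ y in Metric.ball x (R k) ∩ Ω,
    ∫⁻ z in Metric.ball (x + (M * R k) • e) (R k), ‖u y - u z‖ₑ with hJ
  -- the normalised oscillation at scale `R k`
  set a : ℕ → Space d → ℝ≥0∞ := fun k x => (D k)⁻¹ * ((D k)⁻¹ * J k x) with ha
  have hsub : ∀ k, ∀ x ∈ S, Metric.ball (x + (M * R (k + 1)) • e) (R (k + 1)) ⊆ Metric.ball x
      (R k) ∩ Ω := by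
    intro k x hx
    refine subset_inter ?_ (hcone.ball_subset x hx _ (hRpos _) (hRlt _))
    refine Metric.ball_subset_ball' ?_
    rw [dist_eq_norm, add_sub_cancel_left, norm_smul, hcone.norm_e, mul_one,
      Real.norm_of_nonneg (mul_nonneg (by linarith) (hRpos _).le), hRsucc]
    have : l * (M + 1) = 1 := by rw [hl]; field_simp
    nlinarith [hRpos k]
  have hE1 : ∀ k, ∀ x ∈ S, ∫⁻ y in Metric.ball x (R k) ∩ Ω, ‖u y - A k x‖ₑ
      ≤ K * D k * a k x := by
    intro k x hx
    calc _ ≤ ∫⁻ y in Metric.ball x (R k) ∩ Ω, K * (D k)⁻¹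
          * ∫⁻ z in Metric.ball (x + (M * R k) • e) (R k), ‖u y - u z‖ₑ :=
          lintegral_mono fun y => enorm_sub_coneMean_le hu (hRpos k)
            (hcone.ball_subset x hx _ (hRpos k) (hRlt k)) (hK e M _ (hRpos k)) (u y)
      _ = K * (D k)⁻¹ * J k x := lintegral_const_mul' _ _
          (ENNReal.mul_ne_top ENNReal.coe_ne_top (ENNReal.inv_ne_top.2 (hD0 k)))
      _ = K * (D k * (D k)⁻¹) * ((D k)⁻¹ * J k x) := by
          rw [ENNReal.mul_inv_cancel (hD0 k) (hDt k), mul_one, mul_assoc]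
      _ = _ := by simp only [ha]; ring
  have hE2 : ∀ k, ∀ x ∈ S, ‖A (k + 1) x - A k x‖ₑ ≤ K * K * L⁻¹ * a k x := by
    intro k x hx
    have hsub := hsub k x hx
    rw [← enorm_neg, neg_sub]
    calc _ ≤ K * (D (k + 1))⁻¹
          * ∫⁻ z in Metric.ball (x + (M * R (k + 1)) • e) (R (k + 1)), ‖A k x - u z‖ₑ :=
          enorm_sub_coneMean_le hu (hRpos _)
            (hcone.ball_subset x hx _ (hRpos _) (hRlt _)) (hK e M _ (hRpos _)) (A k x)
      _ ≤ K * (D (k + 1))⁻¹ * (K * D k * a k x) := by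
          gcongr
          refine (lintegral_mono_set hsub).trans ((hE1 k x hx).trans' (le_of_eq ?_))
          refine lintegral_congr fun y => ?_
          rw [← enorm_neg, neg_sub]
      _ = K * K * L⁻¹ * ((D k)⁻¹ * D k) * a k x := by
          rw [hDsucc, ENNReal.mul_inv (Or.inl hL0) (Or.inl hLt)]
          ring
      _ = _ := by rw [ENNReal.inv_mul_cancel (hD0 k) (hDt k), mul_one]
  have hasq : ∀ k x, a k x ^ (2 : ℝ) ≤ κ ^ 2 * ((D k)⁻¹ ^ 2 * coneOsc Ω e M (R k) u x) := by
    intro k x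
    have h1 := sq_lintegral_lintegral_le_coneOsc (Ω := Ω) e M (hRpos k) hum x
    have h2 : a k x ^ (2 : ℝ) = (D k)⁻¹ ^ 2 * (D k)⁻¹ ^ 2 * J k x ^ (2 : ℝ) := by
      simp only [ha]
      rw [ENNReal.mul_rpow_of_nonneg _ _ zero_le_two, ENNReal.mul_rpow_of_nonneg _ _ zero_le_two,
        ENNReal.rpow_two, ← mul_assoc]
    rw [h2]
    calc _ ≤ (D k)⁻¹ ^ 2 * (D k)⁻¹ ^ 2 * ((D k * κ) ^ 2 * coneOsc Ω e M (R k) u x) := by gcongr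
      _ = ((D k)⁻¹ * D k) ^ 2 * (κ ^ 2 * ((D k)⁻¹ ^ 2 * coneOsc Ω e M (R k) u x)) := by ring
      _ = _ := by rw [ENNReal.inv_mul_cancel (hD0 k) (hDt k), one_pow, one_mul]
  have hmosc : ∀ k, Measurable (coneOsc Ω e M (R k) u) := fun k => measurable_coneOsc hΩ e M _ hum
  set B : ℕ → Space d → ℝ≥0∞ := fun k x => κ ^ 2 * ((D k)⁻¹ ^ 2 * coneOsc Ω e M (R k) u x) with hB
  have hBm : ∀ k, Measurable (B k) := fun k => ((hmosc k).const_mul _).const_mul _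
  have hBint : ∀ k, ∫⁻ x, B k x ∂μ ≤ κ ^ 2 * C * ENNReal.ofReal (R k ^ α) := by
    intro k
    simp only [hB]
    rw [lintegral_const_mul _ ((hmosc k).const_mul _), lintegral_const_mul _ (hmosc k)]
    calc _ ≤ κ ^ 2 * ((D k)⁻¹ ^ 2 * (C * (D k) ^ 2 * ENNReal.ofReal (R k ^ α))) :=
          mul_le_mul' le_rfl (mul_le_mul' le_rfl (hosc _ (hRpos k) (hRlt k)))
      _ = ((D k)⁻¹ * D k) ^ 2 * (κ ^ 2 * C * ENNReal.ofReal (R k ^ α)) := by ring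
      _ = _ := by rw [ENNReal.inv_mul_cancel (hD0 k) (hDt k), one_pow, one_mul]
  have hRpow : ∀ (β : ℝ) (k : ℕ), R k ^ β = (r₀ / 2) ^ β * (l ^ β) ^ k := by
    intro β k
    simp only [hR]
    rw [Real.mul_rpow (by positivity) (by positivity), ← Real.rpow_natCast l, ← Real.rpow_mul
      hl0.le, mul_comm (k : ℝ) β, Real.rpow_mul hl0.le, Real.rpow_natCast]
  have hlpow : ∀ β : ℝ, 0 < β → l ^ β < 1 := fun β hβ => Real.rpow_lt_one hl0.le hl1 hβ
  -- the oscillations tend to zero almost everywhere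
  have hato : ∀ᵐ x ∂μ, Tendsto (fun k => a k x) atTop (𝓝 0) := by
    have hsum : ∫⁻ x, ∑' k, B k x ∂μ ≠ ⊤ := by
      rw [lintegral_tsum fun k => (hBm k).aemeasurable]
      refine ne_top_of_le_ne_top ?_ (ENNReal.tsum_le_tsum hBint)
      rw [ENNReal.tsum_mul_left]
      refine ENNReal.mul_ne_top (ENNReal.mul_ne_top (ENNReal.pow_ne_top hκt) ENNReal.coe_ne_top) ?_
      rw [← ENNReal.ofReal_tsum_of_nonneg fun k => by have := hRpos k; positivity]
      · exact ENNReal.ofReal_ne_top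
      · simp only [hRpow]
        exact (summable_geometric_of_lt_one (by positivity) (hlpow α hα)).mul_left _
    filter_upwards [ae_lt_top (Measurable.tsum hBm) hsum] with x hx
    have h1 : Tendsto (fun k => B k x) atTop (𝓝 0) :=
      ENNReal.tendsto_atTop_zero_of_tsum_ne_top hx.ne
    have h2 : Tendsto (fun k => a k x ^ (2 : ℝ)) atTop (𝓝 0) :=
      tendsto_of_tendsto_of_tendsto_of_le_of_le tendsto_const_nhds h1 (fun _ => bot_le)
        fun k => hasq k x
    have h3 := h2.ennrpow_const (1 / 2)
    rw [ENNReal.zero_rpow_of_pos (by norm_num)] at h3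
    refine h3.congr fun k => ?_
    rw [← ENNReal.rpow_mul]
    norm_num
  have hAL2 : ∀ k, MemLp (A k) 2 μ := by
    intro k
    have hc : Continuous (A k) := (hasFDerivAt_smear (contDiff_coneKernel e M _)
      (hasCompactSupport_coneKernel e M (hRpos k)) hΩ.measurableSet hu).1.continuous
    obtain ⟨b, hb⟩ := (contDiff_coneKernel e M (R k)).continuous.bounded_above_of_compact_support
      (hasCompactSupport_coneKernel e M (hRpos k))
    refine MemLp.of_bound hc.aestronglyMeasurable (∫ y in Ω, b * ‖u y‖) (Eventually.of_forall ?_)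
    intro x
    refine norm_integral_le_of_norm_le (hu.norm.const_mul b) (Eventually.of_forall fun y => ?_)
    rw [norm_mul, Complex.norm_real]
    gcongr
    exact hb _
  set Q : ℝ≥0∞ := (K * K * L⁻¹) ^ (2 : ℝ) * (κ ^ 2 * C) with hQ
  have hQt : Q ≠ ⊤ := by
    refine ENNReal.mul_ne_top (ENNReal.rpow_ne_top_of_nonneg zero_le_two ?_)
      (ENNReal.mul_ne_top (ENNReal.pow_ne_top hκt) ENNReal.coe_ne_top)
    exact ENNReal.mul_ne_top (ENNReal.mul_ne_top ENNReal.coe_ne_top ENNReal.coe_ne_top)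
      (ENNReal.inv_ne_top.2 hL0)
  have hinc : ∀ k, eLpNorm (A (k + 1) - A k) 2 μ
      ≤ ENNReal.ofReal ((Q ^ (1 / 2 : ℝ)).toReal * (r₀ / 2) ^ (α / 2) * (l ^ (α / 2)) ^ k) := by
    intro k
    rw [eLpNorm_eq_lintegral_rpow_enorm_toReal two_ne_zero ENNReal.ofNat_ne_top]
    have h1 : ∫⁻ x, ‖(A (k + 1) - A k) x‖ₑ ^ (2 : ℝ) ∂μ ≤ Q * ENNReal.ofReal (R k ^ α) := by
      calc _ ≤ ∫⁻ x, (K * K * L⁻¹) ^ (2 : ℝ) * B k x ∂μ := by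
            refine lintegral_mono_ae (hμ.mono fun x hx => ?_)
            rw [Pi.sub_apply]
            refine (ENNReal.rpow_le_rpow (hE2 k x hx) zero_le_two).trans ?_
            rw [ENNReal.mul_rpow_of_nonneg _ _ zero_le_two]
            gcongr
            exact hasq k x
        _ = (K * K * L⁻¹) ^ (2 : ℝ) * ∫⁻ x, B k x ∂μ := lintegral_const_mul _ (hBm k)
        _ ≤ _ := by
            refine (mul_le_mul' le_rfl (hBint k)).trans_eq ?_
            rw [hQ]
            ring
    have h2 : (2 : ℝ≥0∞).toReal = 2 := by norm_num
    rw [h2]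
    refine (ENNReal.rpow_le_rpow h1 (by norm_num)).trans_eq ?_
    rw [ENNReal.mul_rpow_of_nonneg _ _ (by norm_num), mul_assoc,
      ENNReal.ofReal_mul ENNReal.toReal_nonneg, ENNReal.ofReal_toReal
        (ENNReal.rpow_ne_top_of_nonneg (by norm_num) hQt), ← hRpow,
      ENNReal.ofReal_rpow_of_nonneg (by have := hRpos k; positivity) (by norm_num),
      ← Real.rpow_mul (hRpos k).le]
    congr 3
    ring
  obtain ⟨b, hb, hblim, hbL2⟩ := exists_limit_of_geometric hAL2
    (C := (Q ^ (1 / 2 : ℝ)).toReal * (r₀ / 2) ^ (α / 2)) (q := l ^ (α / 2)) (by positivity)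
    (by positivity) (hlpow _ (half_pos hα)) hinc
  refine ⟨b, hb, ?_, hbL2⟩
  filter_upwards [hμ, hato, hblim] with x hx hax hbx
  -- the bound for the mean distance from the trace, at scales comparable with `R k`
  set c : ℕ → ℝ≥0∞ := fun k => (L * L * κ)⁻¹ * K * a k x + ‖A k x - b x‖ₑ with hc
  have hLκ0 : L * L * κ ≠ 0 := mul_ne_zero (mul_ne_zero hL0 hL0) hκ0
  have hLκt : L * L * κ ≠ ⊤ := ENNReal.mul_ne_top (ENNReal.mul_ne_top hLt hLt) hκt
  have hc0 : Tendsto c atTop (𝓝 0) := by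
    have h1 := ENNReal.Tendsto.const_mul (a := (L * L * κ)⁻¹ * K) hax
      (Or.inr (ENNReal.mul_ne_top (ENNReal.inv_ne_top.2 hLκ0) ENNReal.coe_ne_top))
    have h2 : Tendsto (fun k => ‖A k x - b x‖ₑ) atTop (𝓝 0) := by
      simpa using (hbx.sub_const (b x)).enorm
    simpa using h1.add h2
  have hbound : ∀ k r, R (k + 1) < r → r ≤ R k →
      laverage (volume.restrict (Metric.ball x r ∩ Ω)) (fun y => ‖u y - b x‖ₑ) ≤ c k := by
    intro k r hr1 hr2
    set E := Metric.ball x r ∩ Ω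
    have hEk : E ⊆ Metric.ball x (R k) ∩ Ω :=
      inter_subset_inter_left _ (Metric.ball_subset_ball hr2)
    have hlow : L * L * κ * D k ≤ volume E := by
      have h1 : volume (Metric.ball (x + (M * R (k + 1 + 1)) • e) (R (k + 1 + 1)))
          = L * L * κ * D k := by
        rw [volume_ball_eq _ (hRpos _)]
        change D (k + 1 + 1) * κ = _
        rw [hDsucc, hDsucc]
        ring
      rw [← h1]
      exact measure_mono ((hsub (k + 1) x hx).trans
        (inter_subset_inter_left _ (Metric.ball_subset_ball hr1.le)))
    have hlow0 : L * L * κ * D k ≠ 0 := mul_ne_zero hLκ0 (hD0 k)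
    have hE0 : volume E ≠ 0 := fun h => hlow0 (le_antisymm (hlow.trans_eq h) bot_le)
    have hEt : volume E ≠ ⊤ := ((measure_mono inter_subset_left).trans_lt measure_ball_lt_top).ne
    rw [laverage_eq, Measure.restrict_apply_univ]
    have h1 : ∫⁻ y in E, ‖u y - b x‖ₑ ≤ K * D k * a k x + ‖A k x - b x‖ₑ * volume E := by
      calc _ ≤ ∫⁻ y in E, (‖u y - A k x‖ₑ + ‖A k x - b x‖ₑ) := by
            refine lintegral_mono fun y => ?_
            simpa using enorm_add_le (u y - A k x) (A k x - b x)
        _ = (∫⁻ y in E, ‖u y - A k x‖ₑ) + ‖A k x - b x‖ₑ * volume E := by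
            rw [lintegral_add_right _ measurable_const, setLIntegral_const]
        _ ≤ _ := by
            gcongr
            exact (lintegral_mono_set hEk).trans (hE1 k x hx)
    refine (ENNReal.div_le_div_right h1 _).trans ?_
    rw [ENNReal.add_div, ENNReal.mul_div_cancel_right hE0 hEt]
    refine add_le_add_left ((ENNReal.div_le_div_left hlow _).trans_eq ?_) _
    rw [div_eq_mul_inv, ENNReal.mul_inv (Or.inl hLκ0) (Or.inl hLκt)]
    calc _ = (L * L * κ)⁻¹ * K * a k x * (D k * (D k)⁻¹) := by ring
      _ = _ := by rw [ENNReal.mul_inv_cancel (hD0 k) (hDt k), mul_one]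
  rw [HasTraceAt, ENNReal.tendsto_nhds_zero]
  intro ε hε
  obtain ⟨k₀, hk₀⟩ := eventually_atTop.1 ((ENNReal.tendsto_nhds_zero.1 hc0) ε hε)
  filter_upwards [Ioc_mem_nhdsGT (hRpos k₀)] with r hr
  obtain ⟨k, hk1, hk2⟩ := exists_nat_pow_near_of_lt_one (x := r / (r₀ / 2)) (y := l)
    (by have := hr.1; positivity) (by
      rw [div_le_one (by positivity)]
      refine hr.2.trans ?_
      have : l ^ k₀ ≤ 1 := pow_le_one₀ hl0.le hl1.le
      simp only [hR]
      nlinarith) hl0 hl1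
  rw [lt_div_iff₀' (by positivity)] at hk1
  rw [div_le_iff₀' (by positivity)] at hk2
  refine (hbound k r hk1 hk2).trans (hk₀ k ?_)
  have h1 : R (k + 1) < R k₀ := hk1.trans_le hr.2
  by_contra hlt
  push Not at hlt
  have h2 : l ^ k₀ ≤ l ^ (k + 1) := pow_le_pow_of_le_one hl0.le hl1.le hlt
  have h3 : R k₀ ≤ R (k + 1) := by
    simp only [hR]
    gcongr
  linarith

/-! ### Trace regularity of Sobolev functions -/

theorem RobinBoundary.HasTraceAt.congr {U : Set (Space d)} {u u' : Space d → ℂ} {x : Space d}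
    {a : ℂ} (h : HasTraceAt U u x a) (huu : u =ᵐ[volume.restrict U] u') : HasTraceAt U u' x a := by
  refine Tendsto.congr (fun r => laverage_congr ?_) h
  have h1 : u =ᵐ[volume.restrict (Metric.ball x r ∩ U)] u' :=
    ae_restrict_of_ae_restrict_of_subset inter_subset_right huu
  filter_upwards [h1] with y hy
  rw [hy]

theorem MeasureTheory.LocallyIntegrableOn.congr_ae {U : Set (Space d)} {u u' : Space d → ℂ}
    (h : LocallyIntegrableOn u U) (huu : u =ᵐ[volume.restrict U] u') :
    LocallyIntegrableOn u' U := by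
  intro x hx
  obtain ⟨s, hs, hi⟩ := h x hx
  refine ⟨s ∩ U, inter_mem hs self_mem_nhdsWithin, (hi.mono_set inter_subset_left).congr ?_⟩
  exact ae_restrict_of_ae_restrict_of_subset inter_subset_right huu

theorem RobinBoundary.IsWeakPartial.congr {U : Set (Space d)} {i : Fin d} {u u' g g' : Space d → ℂ}
    (h : IsWeakPartial U i u g) (huu : u =ᵐ[volume.restrict U] u')
    (hgg : g =ᵐ[volume.restrict U] g') : IsWeakPartial U i u' g' := by
  refine ⟨?_, ?_, fun φ hφ hφc hφU => ?_⟩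
  · exact h.1.congr_ae huu
  · exact h.2.1.congr_ae hgg
  · have h1 := h.2.2 φ hφ hφc hφU
    have e1 : ∫ x in U, (fderiv ℝ φ x (EuclideanSpace.single i 1) : ℂ) * u x
        = ∫ x in U, (fderiv ℝ φ x (EuclideanSpace.single i 1) : ℂ) * u' x :=
      integral_congr_ae (huu.mono fun x hx => by simp only [hx])
    have e2 : ∫ x in U, (φ x : ℂ) * g x = ∫ x in U, (φ x : ℂ) * g' x :=
      integral_congr_ae (hgg.mono fun x hx => by simp only [hx])
    rw [← e1, h1, e2]

theorem RobinBoundary.IsWeakPartial.mono {U V : Set (Space d)} {i : Fin d} {u g : Space d → ℂ}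
    (h : IsWeakPartial U i u g) (hU : MeasurableSet U) (hVU : V ⊆ U) : IsWeakPartial V i u g := by
  refine ⟨h.1.mono_set hVU, h.2.1.mono_set hVU, fun φ hφ hφc hφV => ?_⟩
  have h1 := h.2.2 φ hφ hφc (hφV.trans hVU)
  have h0 : ∀ x ∈ U \ V, φ x = 0 := fun x hx =>
    image_eq_zero_of_notMem_tsupport fun hx' => hx.2 (hφV hx')
  have h0' : ∀ x ∈ U \ V, fderiv ℝ φ x = 0 := fun x hx =>
    image_eq_zero_of_notMem_tsupport fun hx' => hx.2 (hφV (tsupport_fderiv_subset ℝ hx'))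
  rwa [setIntegral_eq_of_subset_of_forall_sdiff_eq_zero hU hVU fun x hx => by simp [h0' x hx],
    setIntegral_eq_of_subset_of_forall_sdiff_eq_zero hU hVU fun x hx => by simp [h0 x hx]] at h1

theorem smear_congr {k : Space d → ℝ} {U : Set (Space d)} {u u' : Space d → ℂ}
    (huu : u =ᵐ[volume.restrict U] u') : smear k U u = smear k U u' := by
  funext p
  refine integral_congr_ae ?_
  filter_upwards [huu] with y hy
  rw [hy]

/-- Tonelli's theorem for the incidence relation `dist y x < R`. -/
theorem lintegral_lintegral_ball_le {Ω : Set (Space d)}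
    {μ : Measure (Space d)} [SFinite μ] {f : Space d → ℝ≥0∞} (hf : Measurable f) {R : ℝ}
    {c : ℝ≥0∞} (hμ : ∀ y, μ (Metric.ball y R) ≤ c) :
    ∫⁻ x, (∫⁻ y in Metric.ball x R ∩ Ω, f y) ∂μ ≤ c * ∫⁻ y in Ω, f y := by
  have hm : MeasurableSet {q : Space d × Space d | dist q.2 q.1 < R} :=
    measurableSet_lt (by fun_prop) measurable_const
  have h1 : ∀ x, ∫⁻ y in Metric.ball x R ∩ Ω, f y = ∫⁻ y in Ω,
      {q : Space d × Space d | dist q.2 q.1 < R}.indicator (fun q => f q.2) (x, y) := by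
    intro x
    rw [← Measure.restrict_restrict Metric.isOpen_ball.measurableSet,
      ← lintegral_indicator Metric.isOpen_ball.measurableSet]
    rfl
  simp_rw [h1]
  rw [lintegral_lintegral_swap (f := fun x y => {q : Space d × Space d | dist q.2 q.1 < R}.indicator
    (fun q => f q.2) (x, y)) ((hf.comp measurable_snd).indicator hm).aemeasurable,
    ← lintegral_const_mul _ hf]
  refine lintegral_mono fun y => ?_
  have h2 : ∀ x, {q : Space d × Space d | dist q.2 q.1 < R}.indicator (fun q => f q.2) (x, y)
      = (Metric.ball y R).indicator (fun _ => f y) x := by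
    intro x
    simp only [indicator, mem_ofPred_eq, Metric.mem_ball, dist_comm]
  simp_rw [h2]
  rw [lintegral_indicator Metric.isOpen_ball.measurableSet, setLIntegral_const, mul_comm]
  exact mul_le_mul_left (hμ y) _

/-- The oscillation of a function with finite Gagliardo seminorm. -/
theorem lintegral_coneOsc_le_gagliardo {Ω S : Set (Space d)} (hΩ : IsOpen Ω) {e : Space d}
    {M r₀ : ℝ} (hcone : ConeCondition Ω S e M r₀) {μ : Measure (Space d)} [SFinite μ]
    (hμS : ∀ᵐ x ∂μ, x ∈ S) {u : Space d → ℂ} (hu : Measurable u) {r : ℝ} (hr : 0 < r)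
    (hr₀ : r < r₀) {c : ℝ≥0∞} (hμ : ∀ y, μ (Metric.ball y r) ≤ c) {p : ℝ} (hp : 0 < p) :
    ∫⁻ x, coneOsc Ω e M r u x ∂μ ≤ ENNReal.ofReal ((M + 2) * r) ^ p
      * (c * ∫⁻ x in Ω, ∫⁻ y in Ω, ‖u x - u y‖ₑ ^ (2 : ℝ) / ‖x - y‖ₑ ^ p) := by
  have hM := hcone.two_le
  set k := ENNReal.ofReal ((M + 2) * r) ^ p
  have hk : k ≠ ⊤ := ENNReal.rpow_ne_top_of_nonneg hp.le ENNReal.ofReal_ne_top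
  set f : Space d → ℝ≥0∞ := fun x => ∫⁻ y in Ω, ‖u x - u y‖ₑ ^ (2 : ℝ) / ‖x - y‖ₑ ^ p
  have hf : Measurable f := by
    refine Measurable.lintegral_prod_right' (f := fun q : Space d × Space d =>
      ‖u q.1 - u q.2‖ₑ ^ (2 : ℝ) / ‖q.1 - q.2‖ₑ ^ p) ?_
    fun_prop
  calc _ ≤ ∫⁻ x, (k * ∫⁻ y in Metric.ball x r ∩ Ω, f y) ∂μ := by
        refine lintegral_mono_ae (hμS.mono fun x hx => ?_)
        rw [coneOsc, ← lintegral_const_mul' _ _ hk]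
        refine setLIntegral_mono' (Metric.isOpen_ball.inter hΩ).measurableSet fun y hy => ?_
        rw [← lintegral_const_mul' _ _ hk]
        refine (setLIntegral_mono' Metric.isOpen_ball.measurableSet fun z hz => ?_).trans
          (lintegral_mono_set (hcone.ball_subset x hx r hr hr₀))
        rcases eq_or_ne y z with rfl | hyz
        · simp
        · have h1 : ‖y - z‖ₑ ≤ ENNReal.ofReal ((M + 2) * r) := by
            rw [← ofReal_norm]
            refine ENNReal.ofReal_le_ofReal ?_
            have e1 : dist y x < r := hy.1
            have e2 : dist z (x + (M * r) • e) < r := hz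
            rw [dist_eq_norm] at e1 e2
            have e3 : ‖(M * r) • e‖ = M * r := by
              rw [norm_smul, hcone.norm_e, mul_one, Real.norm_of_nonneg (by positivity)]
            have e4 : y - z = (y - x) - (z - (x + (M * r) • e)) - (M * r) • e := by abel
            rw [e4]
            have := norm_sub_le ((y - x) - (z - (x + (M * r) • e))) ((M * r) • e)
            have := norm_sub_le (y - x) (z - (x + (M * r) • e))
            linarith
          have h0 : ‖y - z‖ₑ ^ p ≠ 0 := by
            simp [hp, sub_eq_zero, hyz]
          have ht : ‖y - z‖ₑ ^ p ≠ ⊤ := ENNReal.rpow_ne_top_of_nonneg hp.le enorm_ne_top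
          calc _ = ‖y - z‖ₑ ^ p * (‖u y - u z‖ₑ ^ (2 : ℝ) / ‖y - z‖ₑ ^ p) :=
                (ENNReal.mul_div_cancel h0 ht).symm
            _ ≤ _ := mul_le_mul_left (ENNReal.rpow_le_rpow h1 hp.le) _
    _ = k * ∫⁻ x, (∫⁻ y in Metric.ball x r ∩ Ω, f y) ∂μ := lintegral_const_mul' _ _ hk
    _ ≤ _ := mul_le_mul_right (lintegral_lintegral_ball_le hf hμ) _

/-- The second of the two points in the mean oscillation is the first one moved by a vector of norm
at most `(M + 2) r`, along a segment in `Ω`. -/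
theorem coneOsc_le_gradient {Ω S : Set (Space d)} (hΩ : IsOpen Ω) {e : Space d}
    {M r₀ : ℝ} (hcone : ConeCondition Ω S e M r₀) {u : Space d → ℂ} {g : Fin d → Space d → ℂ}
    (hum : Measurable u) (hgm : ∀ i, Measurable (g i)) (hu : IntegrableOn u Ω)
    (hg : ∀ i, IntegrableOn (g i) Ω) (hw : ∀ i, IsWeakPartial Ω i u (g i)) {r : ℝ} (hr : 0 < r)
    (hr₀ : r < r₀) {x : Space d} (hx : x ∈ S) :
    coneOsc Ω e M r u x ≤ volume (Metric.ball (0 : Space d) ((M + 2) * r))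
      * ENNReal.ofReal ((M + 2) * r) ^ (2 : ℝ)
      * ∫⁻ y in Metric.ball x ((M + 2) * r) ∩ Ω, ∑ i, ‖g i y‖ₑ ^ (2 : ℝ) := by
  have hM := hcone.two_le
  set R := (M + 2) * r with hR
  set B := Metric.ball x r ∩ Ω with hB
  set c' := x + (M * r) • e with hc'
  have hBm : MeasurableSet B := (Metric.isOpen_ball.inter hΩ).measurableSet
  have e3 : ‖c' - x‖ = M * r := by
    rw [hc', add_sub_cancel_left, norm_smul, hcone.norm_e, mul_one,
      Real.norm_of_nonneg (by positivity)]
  have hTm : MeasurableSet {q : Space d × Space d | q.1 + q.2 ∈ Metric.ball c' r} :=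
    Metric.isOpen_ball.measurableSet.preimage (measurable_fst.add measurable_snd)
  set F : Space d × Space d → ℝ≥0∞ :=
    {q | q.1 + q.2 ∈ Metric.ball c' r}.indicator fun q => ‖u q.1 - u (q.1 + q.2)‖ₑ ^ (2 : ℝ)
    with hF
  have hFm : Measurable F := by
    refine Measurable.indicator ?_ hTm
    fun_prop
  -- the second point is the first one moved by a vector `τ`
  have h1 : ∀ y ∈ B, ∫⁻ z in Metric.ball c' r, ‖u y - u z‖ₑ ^ (2 : ℝ)
      = ∫⁻ τ in Metric.ball 0 R, F (y, τ) := by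
    intro y hy
    rw [← lintegral_indicator Metric.isOpen_ball.measurableSet,
      ← lintegral_indicator Metric.isOpen_ball.measurableSet,
      ← lintegral_add_left_eq_self _ y]
    refine lintegral_congr fun τ => ?_
    simp only [hF, indicator, mem_ofPred_eq]
    by_cases hτ : y + τ ∈ Metric.ball c' r
    · have : τ ∈ Metric.ball (0 : Space d) R := by
        have e1 : dist y x < r := hy.1
        have e2 : dist (y + τ) c' < r := hτ
        rw [dist_eq_norm] at e1 e2
        rw [mem_ball_zero_iff]
        have e4 : τ = (y + τ - c') - (y - x) + (c' - x) := by abel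
        rw [e4]
        have := norm_add_le ((y + τ - c') - (y - x)) (c' - x)
        have := norm_sub_le (y + τ - c') (y - x)
        rw [hR]
        linarith
      rw [if_pos hτ, if_pos this]
    · rw [if_neg hτ, ite_self]
  rw [coneOsc, setLIntegral_congr_fun hBm h1,
    lintegral_lintegral_swap (f := fun y τ => F (y, τ)) hFm.aemeasurable]
  set E := ∑ i, ∫⁻ y in Metric.ball x R ∩ Ω, ‖g i y‖ₑ ^ (2 : ℝ) with hE
  have h2 : ∀ τ ∈ Metric.ball (0 : Space d) R,
      ∫⁻ y in B, F (y, τ) ≤ ENNReal.ofReal R ^ (2 : ℝ) * E := by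
    intro τ hτ
    have hPm : MeasurableSet {y | y + τ ∈ Metric.ball c' r} :=
      Metric.isOpen_ball.measurableSet.preimage (measurable_id.add_const τ)
    have h3 : ∫⁻ y in B, F (y, τ) = ∫⁻ y in {y | y + τ ∈ Metric.ball c' r} ∩ B,
        ‖u (y + τ) - u y‖ₑ ^ (2 : ℝ) := by
      rw [← Measure.restrict_restrict hPm, ← lintegral_indicator hPm]
      refine lintegral_congr fun y => ?_
      simp only [hF, indicator, mem_ofPred_eq]
      rw [← enorm_neg (u y - _), neg_sub]
    rw [h3]
    have hseg : ∀ y ∈ {y | y + τ ∈ Metric.ball c' r} ∩ B, ∀ t ∈ Icc (0 : ℝ) 1,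
        y + t • τ ∈ Metric.ball x R ∩ Ω := by
      rintro y ⟨hy1, hy2⟩ t ht
      have hy1 : y + τ ∈ Metric.ball c' r := hy1
      have e1 : y ∈ Metric.ball x R := Metric.ball_subset_ball (by rw [hR]; nlinarith) hy2.1
      have e2 : y + τ ∈ Metric.ball x R := by
        refine Metric.ball_subset_ball' ?_ hy1
        rw [dist_eq_norm, e3, hR]
        nlinarith
      have h5 := (convex_ball x R).add_smul_sub_mem e1 e2 ht
      have h6 := hcone.segment_mem x hx r hr hr₀ y hy2 (y + τ) hy1 t ht
      rw [add_sub_cancel_left] at h5 h6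
      exact ⟨h5, h6⟩
    have h4 := lintegral_translate_sub_sq_le (Metric.isOpen_ball.inter hΩ)
      (hu.mono_set inter_subset_right) (fun i => (hg i).mono_set inter_subset_right)
      (fun i => (hw i).mono hΩ.measurableSet inter_subset_right) (hPm.inter hBm) hseg
    refine h4.trans (mul_le_mul_left (ENNReal.rpow_le_rpow ?_ zero_le_two) _)
    rw [← ofReal_norm]
    exact ENNReal.ofReal_le_ofReal (mem_ball_zero_iff.1 hτ).le
  refine (setLIntegral_mono' Metric.isOpen_ball.measurableSet h2).trans_eq ?_
  rw [setLIntegral_const, lintegral_finsetSum _ fun i _ => by have := hgm i; fun_prop]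
  ring

/-- The oscillation of a function with square integrable weak gradient. -/
theorem lintegral_coneOsc_le_gradient {Ω S : Set (Space d)} (hΩ : IsOpen Ω) {e : Space d}
    {M r₀ : ℝ} (hcone : ConeCondition Ω S e M r₀) {μ : Measure (Space d)} [SFinite μ]
    (hμS : ∀ᵐ x ∂μ, x ∈ S) {u : Space d → ℂ} {g : Fin d → Space d → ℂ} (hum : Measurable u)
    (hgm : ∀ i, Measurable (g i)) (hu : IntegrableOn u Ω) (hg : ∀ i, IntegrableOn (g i) Ω)
    (hw : ∀ i, IsWeakPartial Ω i u (g i)) {r : ℝ} (hr : 0 < r)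
    (hr₀ : r < r₀) {c : ℝ≥0∞} (hμ : ∀ y, μ (Metric.ball y ((M + 2) * r)) ≤ c) :
    ∫⁻ x, coneOsc Ω e M r u x ∂μ ≤ volume (Metric.ball (0 : Space d) ((M + 2) * r))
      * ENNReal.ofReal ((M + 2) * r) ^ (2 : ℝ)
      * (c * ∫⁻ y in Ω, ∑ i, ‖g i y‖ₑ ^ (2 : ℝ)) := by
  have hM := hcone.two_le
  set R := (M + 2) * r with hR
  have hk : volume (Metric.ball (0 : Space d) R) * ENNReal.ofReal R ^ (2 : ℝ) ≠ ⊤ :=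
    ENNReal.mul_ne_top measure_ball_lt_top.ne
      (ENNReal.rpow_ne_top_of_nonneg zero_le_two ENNReal.ofReal_ne_top)
  have hf : Measurable fun y => ∑ i, ‖g i y‖ₑ ^ (2 : ℝ) :=
    Finset.measurable_fun_sum _ fun i _ => by have := hgm i; fun_prop
  refine (lintegral_mono_ae (hμS.mono fun x hx =>
    coneOsc_le_gradient hΩ hcone hum hgm hu hg hw hr hr₀ hx)).trans ?_
  rw [lintegral_const_mul' _ _ hk]
  exact mul_le_mul_right (lintegral_lintegral_ball_le hf hμ) _

/-- The regularity of order larger than `1/2` which gives traces on hypersurfaces: a finite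
Gagliardo seminorm of some order `s - 1 > 1/2`, or a square integrable weak gradient. -/
def HasTraceRegularity (Ω : Set (Space d)) (u : Space d → ℂ) : Prop :=
  MemL2 Ω u ∧ ((∃ s : ℝ, 3 / 2 < s ∧ ∫⁻ x in Ω, ∫⁻ y in Ω,
      ‖u x - u y‖ₑ ^ (2 : ℝ) / ‖x - y‖ₑ ^ (2 * s + d - 2) < ⊤) ∨
    ∀ i, ∃ g, IsWeakPartial Ω i u g ∧ MemL2 Ω g)

theorem RobinBoundary.MemL2.integrableOn {Ω : Set (Space d)} (hΩ : Bornology.IsBounded Ω)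
    {u : Space d → ℂ} (hu : MemL2 Ω u) : IntegrableOn u Ω := by
  have : IsFiniteMeasure (volume.restrict Ω) := ⟨by
    rw [Measure.restrict_apply_univ]; exact hΩ.measure_lt_top⟩
  exact hu.integrable one_le_two

theorem RobinBoundary.MemL2.lintegral_lt_top {Ω : Set (Space d)} {u : Space d → ℂ}
    (hu : MemL2 Ω u) : ∫⁻ x in Ω, ‖u x‖ₑ ^ (2 : ℝ) < ⊤ := by
  have := lintegral_rpow_enorm_lt_top_of_eLpNorm_lt_top two_ne_zero ENNReal.ofNat_ne_top hu.2
  simpa using this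

/-- The two cases of the regularity give the decay rates `r ^ (2 s - 3)` and `r` of the mean
oscillation, beyond the factor `r ^ (2 d)` from the volumes of the balls. -/
theorem HasTraceRegularity.exists_trace {Ω S : Set (Space d)} (hd : 1 ≤ d) (hΩ : IsOpen Ω)
    (hb : Bornology.IsBounded Ω) {e : Space d} {M r₀ : ℝ} (hcone : ConeCondition Ω S e M r₀)
    {μ : Measure (Space d)} [IsFiniteMeasure μ] (hμS : ∀ᵐ x ∂μ, x ∈ S) {C : ℝ≥0}
    (hμ : ∀ y r, 0 < r → μ (Metric.ball y r) ≤ C * ENNReal.ofReal (r ^ (d - 1)))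
    {u : Space d → ℂ} (hu : HasTraceRegularity Ω u) :
    ∃ b, MemLp b 2 μ ∧ (∀ᵐ x ∂μ, HasTraceAt Ω u x (b x)) ∧
      Tendsto (fun k : ℕ => eLpNorm (coneMean Ω e M (r₀ / 2 * (1 / (M + 1)) ^ k) u - b) 2 μ)
        atTop (𝓝 0) := by
  have hM := hcone.two_le
  obtain ⟨hu2, hu3⟩ := hu
  have hui := hu2.integrableOn hb
  set u' := hui.aestronglyMeasurable.mk u with hu'
  have huu : u =ᵐ[volume.restrict Ω] u' := hui.aestronglyMeasurable.ae_eq_mk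
  have hum : Measurable u' := hui.aestronglyMeasurable.stronglyMeasurable_mk.measurable
  have hui' : IntegrableOn u' Ω := hui.congr huu
  suffices ∃ (C : ℝ≥0) (α : ℝ), 0 < α ∧ ∀ r, 0 < r → r < r₀ → ∫⁻ x, coneOsc Ω e M r u' x ∂μ
      ≤ C * (ENNReal.ofReal r ^ d) ^ 2 * ENNReal.ofReal (r ^ α) by
    obtain ⟨C, α, hα, hosc⟩ := this
    obtain ⟨b, h1, h2, h3⟩ := exists_trace_of_coneOsc hΩ hcone hμS hum hui' hα hosc
    refine ⟨b, h1, h2.mono fun x hx => hx.congr huu.symm, h3.congr fun k => ?_⟩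
    rw [coneMean, coneMean, smear_congr huu]
  have hrd : ∀ r : ℝ, 0 < r → (ENNReal.ofReal r ^ d) ^ 2 = ENNReal.ofReal (r ^ (2 * d : ℝ)) := by
    intro r hr
    rw [← ENNReal.ofReal_pow hr.le, ← ENNReal.ofReal_pow (by positivity), ← pow_mul,
      ← Real.rpow_natCast]
    push_cast
    rw [mul_comm (d : ℝ)]
  have hrd' : ∀ r : ℝ, 0 < r → r ^ (d - 1) = r ^ ((d : ℝ) - 1) := by
    intro r hr
    rw [← Real.rpow_natCast, Nat.cast_sub hd, Nat.cast_one]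
  have hd' : (1 : ℝ) ≤ d := by exact_mod_cast hd
  rcases hu3 with ⟨s, hs, hgag⟩ | hgrad
  · have hgag' : ∫⁻ x in Ω, ∫⁻ y in Ω,
        ‖u' x - u' y‖ₑ ^ (2 : ℝ) / ‖x - y‖ₑ ^ (2 * s + d - 2) ≠ ⊤ := by
      refine ne_of_lt (hgag.trans_eq' (lintegral_congr_ae (huu.mono fun x hx =>
        lintegral_congr_ae (huu.mono fun y hy => ?_))))
      simp only [hx, hy]
    set E := ∫⁻ x in Ω, ∫⁻ y in Ω,
        ‖u' x - u' y‖ₑ ^ (2 : ℝ) / ‖x - y‖ₑ ^ (2 * s + d - 2)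
    have hp : 0 < 2 * s + d - 2 := by linarith
    refine ⟨Real.toNNReal ((M + 2) ^ (2 * s + d - 2)) * (C * E.toNNReal), 2 * s - 3, by linarith,
      fun r hr hr0 => ?_⟩
    refine (lintegral_coneOsc_le_gagliardo hΩ hcone hμS hum hr hr0 (fun y => hμ y r hr)
      hp).trans_eq ?_
    rw [ENNReal.ofReal_rpow_of_pos (by positivity), Real.mul_rpow (by positivity) hr.le,
      ENNReal.ofReal_mul (by positivity), hrd r hr, hrd' r hr]
    push_cast
    rw [ENNReal.coe_toNNReal hgag', ENNReal.ofNNReal_toNNReal]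
    have : ENNReal.ofReal (r ^ (2 * s + d - 2)) * ENNReal.ofReal (r ^ ((d : ℝ) - 1))
        = ENNReal.ofReal (r ^ (2 * d : ℝ)) * ENNReal.ofReal (r ^ (2 * s - 3)) := by
      rw [← ENNReal.ofReal_mul (by positivity), ← ENNReal.ofReal_mul (by positivity),
        ← Real.rpow_add hr, ← Real.rpow_add hr]
      congr 2
      ring
    calc _ = ENNReal.ofReal ((M + 2) ^ (2 * s + d - 2)) * (C * E)
          * (ENNReal.ofReal (r ^ (2 * s + d - 2)) * ENNReal.ofReal (r ^ ((d : ℝ) - 1))) := by ring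
      _ = _ := by rw [this]; ring
  · choose g hw hg using hgrad
    have hgi := fun i => (hg i).integrableOn hb
    set g' : Fin d → Space d → ℂ := fun i => (hgi i).aestronglyMeasurable.mk (g i) with hg'
    have hgg : ∀ i, g i =ᵐ[volume.restrict Ω] g' i := fun i =>
      (hgi i).aestronglyMeasurable.ae_eq_mk
    have hgm : ∀ i, Measurable (g' i) := fun i =>
      (hgi i).aestronglyMeasurable.stronglyMeasurable_mk.measurable
    have hE : ∫⁻ y in Ω, ∑ i, ‖g' i y‖ₑ ^ (2 : ℝ) ≠ ⊤ := by
      rw [lintegral_finsetSum _ fun i _ => by have := hgm i; fun_prop]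
      refine (ENNReal.sum_lt_top.2 fun i _ => ?_).ne
      exact MemL2.lintegral_lt_top ((memLp_congr_ae (hgg i)).1 (hg i))
    set E := ∫⁻ y in Ω, ∑ i, ‖g' i y‖ₑ ^ (2 : ℝ)
    set κ := volume (Metric.ball (0 : Space d) 1) with hκ
    have hκt : κ ≠ ⊤ := measure_ball_lt_top.ne
    refine ⟨Real.toNNReal ((M + 2) ^ (2 * d + 1 : ℝ)) * κ.toNNReal * (C * E.toNNReal), 1, one_pos,
      fun r hr hr0 => ?_⟩
    have hR : 0 < (M + 2) * r := by positivity
    refine (lintegral_coneOsc_le_gradient hΩ hcone hμS hum hgm hui' (fun i => (hgi i).congr (hgg i))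
      (fun i => (hw i).congr huu (hgg i)) hr hr0 (fun y => hμ y _ hR)).trans_eq ?_
    rw [volume_ball_eq _ hR, hrd r hr, hrd' _ hR]
    push_cast
    rw [ENNReal.coe_toNNReal hE, ENNReal.ofNNReal_toNNReal, ENNReal.coe_toNNReal hκt]
    have : ENNReal.ofReal ((M + 2) * r) ^ d * ENNReal.ofReal ((M + 2) * r) ^ (2 : ℝ)
          * ENNReal.ofReal (((M + 2) * r) ^ ((d : ℝ) - 1))
        = ENNReal.ofReal ((M + 2) ^ (2 * d + 1 : ℝ))
          * (ENNReal.ofReal (r ^ (2 * d : ℝ)) * ENNReal.ofReal (r ^ (1 : ℝ))) := by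
      rw [← ENNReal.rpow_natCast, ENNReal.ofReal_rpow_of_pos hR, ENNReal.ofReal_rpow_of_pos hR,
        ← ENNReal.ofReal_mul (by positivity), ← ENNReal.ofReal_mul (by positivity),
        ← ENNReal.ofReal_mul (by positivity), ← ENNReal.ofReal_mul (by positivity),
        ← Real.rpow_add hR, ← Real.rpow_add hR, ← Real.rpow_add hr, ← Real.mul_rpow
          (by positivity) hr.le]
      congr 2
      ring
    calc _ = κ * (C * E)
          * (ENNReal.ofReal ((M + 2) * r) ^ d * ENNReal.ofReal ((M + 2) * r) ^ (2 : ℝ)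
          * ENNReal.ofReal (((M + 2) * r) ^ ((d : ℝ) - 1))) := by ring
      _ = _ := by rw [this]; ring

/-! ### Calculus of pointwise traces and weak derivatives -/

section PointwiseTrace

variable {U : Set (Space d)} {u w : Space d → ℂ} {x : Space d} {a b : ℂ}

theorem RobinBoundary.HasTraceAt.of_bound {κ : ℝ≥0∞} (hκ : κ ≠ ⊤) (hu : HasTraceAt U u x a)
    (hw : ∀ᶠ y in 𝓝 x, ‖w y - b‖ₑ ≤ κ * ‖u y - a‖ₑ) : HasTraceAt U w x b := by
  have h1 := ENNReal.Tendsto.const_mul (a := κ) hu (Or.inr hκ)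
  rw [mul_zero] at h1
  refine tendsto_of_tendsto_of_tendsto_of_le_of_le' tendsto_const_nhds h1
    (Eventually.of_forall fun _ => bot_le) ?_
  obtain ⟨δ, hδ, hball⟩ := Metric.eventually_nhds_iff_ball.1 hw
  filter_upwards [Ioc_mem_nhdsGT hδ] with r hr
  rw [laverage_eq, laverage_eq, ← mul_div_assoc, ← lintegral_const_mul' _ _ hκ]
  refine ENNReal.div_le_div_right (lintegral_mono_ae ?_) _
  refine ae_restrict_of_ae_restrict_of_subset inter_subset_left ?_
  filter_upwards [ae_restrict_mem Metric.isOpen_ball.measurableSet] with y hy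
  exact hball y (Metric.ball_subset_ball hr.2 hy)

theorem RobinBoundary.HasTraceAt.of_continuousAt (hu : ContinuousAt u x) :
    HasTraceAt U u x (u x) := by
  rw [HasTraceAt, ENNReal.tendsto_nhds_zero]
  intro ε hε
  rcases eq_or_ne ε ⊤ with rfl | hεt
  · exact Eventually.of_forall fun _ => le_top
  have h0 : Tendsto (fun y => ‖u y - u x‖ₑ) (𝓝 x) (𝓝 0) := by
    simpa using (hu.tendsto.sub_const (u x)).enorm
  obtain ⟨δ, hδ, hball⟩ := Metric.eventually_nhds_iff_ball.1 ((ENNReal.tendsto_nhds_zero.1 h0) ε hε)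
  filter_upwards [Ioc_mem_nhdsGT hδ] with r hr
  have h2 : ∫⁻ y in Metric.ball x r ∩ U, ‖u y - u x‖ₑ
      ≤ ∫⁻ _ in Metric.ball x r ∩ U, ε := by
    refine lintegral_mono_ae (ae_restrict_of_ae_restrict_of_subset inter_subset_left ?_)
    filter_upwards [ae_restrict_mem Metric.isOpen_ball.measurableSet] with y hy
    exact hball y (Metric.ball_subset_ball hr.2 hy)
  rw [laverage_eq, Measure.restrict_apply_univ]
  refine ENNReal.div_le_of_le_mul ?_
  rwa [setLIntegral_const] at h2

theorem RobinBoundary.HasTraceAt.add_of_aemeasurable (hu : HasTraceAt U u x a)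
    (hw : HasTraceAt U w x b) (hum : AEStronglyMeasurable u (volume.restrict U)) :
    HasTraceAt U (fun y => u y + w y) x (a + b) := by
  have h1 := hu.add hw
  rw [add_zero] at h1
  refine tendsto_of_tendsto_of_tendsto_of_le_of_le tendsto_const_nhds h1
    (fun _ => bot_le) fun r => ?_
  simp only [laverage_eq]
  rw [← ENNReal.add_div]
  refine ENNReal.div_le_div_right ?_ _
  have hm : AEMeasurable (fun y => ‖u y - a‖ₑ) (volume.restrict (Metric.ball x r ∩ U)) :=
    ((hum.mono_measure (Measure.restrict_mono inter_subset_right le_rfl)).sub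
      aestronglyMeasurable_const).enorm
  rw [← lintegral_add_left' hm]
  refine lintegral_mono fun y => ?_
  rw [add_sub_add_comm]
  exact enorm_add_le _ _

theorem RobinBoundary.HasTraceAt.sum {ι : Type*} {s : Finset ι} {f : ι → Space d → ℂ} {c : ι → ℂ}
    (h : ∀ i ∈ s, HasTraceAt U (f i) x (c i))
    (hm : ∀ i ∈ s, AEStronglyMeasurable (f i) (volume.restrict U)) :
    HasTraceAt U (fun y => ∑ i ∈ s, f i y) x (∑ i ∈ s, c i) := by
  classical
  induction s using Finset.induction_on with
  | empty =>
    simp only [Finset.sum_empty]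
    exact RobinBoundary.HasTraceAt.of_continuousAt (U := U) (u := fun _ => (0 : ℂ))
      continuousAt_const
  | insert i s hi ih =>
    simp only [Finset.sum_insert hi]
    exact (h i (Finset.mem_insert_self i s)).add_of_aemeasurable
      (ih (fun j hj => h j (Finset.mem_insert_of_mem hj))
        fun j hj => hm j (Finset.mem_insert_of_mem hj)) (hm i (Finset.mem_insert_self i s))

theorem RobinBoundary.HasTraceAt.mul_continuousAt (hu : HasTraceAt U u x a) {c : Space d → ℂ}
    (hc : ContinuousAt c x) (hcm : AEStronglyMeasurable c (volume.restrict U)) :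
    HasTraceAt U (fun y => c y * u y) x (c x * a) := by
  -- `c u - c(x) a = c (u - a) + (c - c(x)) a`
  have h1 : HasTraceAt U (fun y => c y * a) x (c x * a) :=
    RobinBoundary.HasTraceAt.of_continuousAt (u := fun y => c y * a) (hc.mul continuousAt_const)
  have hb : ∀ᶠ y in 𝓝 x, ‖c y‖ₑ ≤ ‖c x‖ₑ + 1 :=
    (hc.enorm.tendsto.eventually (gt_mem_nhds
      (ENNReal.lt_add_right enorm_ne_top one_ne_zero))).mono fun y hy => hy.le
  have hκ : ‖c x‖ₑ + 1 ≠ ⊤ := ENNReal.add_ne_top.2 ⟨enorm_ne_top, ENNReal.one_ne_top⟩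
  have h2 : HasTraceAt U (fun y => c y * (u y - a)) x 0 := by
    refine hu.of_bound hκ (hb.mono fun y hy => ?_)
    rw [sub_zero, enorm_mul]
    exact mul_le_mul_left hy _
  have h3 := h1.add_of_aemeasurable h2 (hcm.mul_const a)
  simpa [← mul_add] using h3

theorem RobinBoundary.HasTraceAt.unique (hU : IsOpen U) (hx : x ∈ closure U)
    (hum : AEStronglyMeasurable u (volume.restrict U)) (ha : HasTraceAt U u x a)
    (hb : HasTraceAt U u x b) : a = b := by
  have h1 := ha.add hb
  rw [add_zero] at h1
  have h2 : ∀ᶠ r in 𝓝[>] (0 : ℝ), ‖a - b‖ₑ ≤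
      laverage (volume.restrict (Metric.ball x r ∩ U)) (fun y => ‖u y - a‖ₑ)
      + laverage (volume.restrict (Metric.ball x r ∩ U)) (fun y => ‖u y - b‖ₑ) := by
    filter_upwards [self_mem_nhdsWithin] with r hr
    have hr : 0 < r := hr
    obtain ⟨y, hyU, hyx⟩ := Metric.mem_closure_iff.1 hx r hr
    have h0 : volume (Metric.ball x r ∩ U) ≠ 0 :=
      ((Metric.isOpen_ball.inter hU).measure_pos _ ⟨y, by
        rwa [Metric.mem_ball, dist_comm], hyU⟩).ne'
    have ht : volume (Metric.ball x r ∩ U) ≠ ⊤ :=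
      ((measure_mono inter_subset_left).trans_lt measure_ball_lt_top).ne
    have hm : AEMeasurable (fun y => ‖u y - a‖ₑ) (volume.restrict (Metric.ball x r ∩ U)) :=
      ((hum.mono_measure (Measure.restrict_mono inter_subset_right le_rfl)).sub
        aestronglyMeasurable_const).enorm
    rw [laverage_eq, laverage_eq, ← ENNReal.add_div, Measure.restrict_apply_univ,
      ENNReal.le_div_iff_mul_le (Or.inl h0) (Or.inl ht), ← lintegral_add_left' hm,
      ← setLIntegral_const]
    refine lintegral_mono fun y => ?_
    rw [← enorm_neg (u y - a), neg_sub]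
    simpa using enorm_add_le (a - u y) (u y - b)
  have h3 : ‖a - b‖ₑ ≤ 0 := ge_of_tendsto h1 h2
  simpa [sub_eq_zero] using h3

theorem hasTraceAt_inter_iff {V : Set (Space d)} (hV : V ∈ 𝓝 x) :
    HasTraceAt (U ∩ V) u x a ↔ HasTraceAt U u x a := by
  obtain ⟨δ, hδ, hball⟩ := Metric.mem_nhds_iff.1 hV
  refine tendsto_congr' ?_
  filter_upwards [Ioc_mem_nhdsGT hδ] with r hr
  have : Metric.ball x r ∩ (U ∩ V) = Metric.ball x r ∩ U := by
    rw [← inter_assoc, inter_eq_left]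
    exact fun y hy => hball (Metric.ball_subset_ball hr.2 hy.1)
  rw [this]

end PointwiseTrace

section WeakPartial

variable {U : Set (Space d)} {i : Fin d} {u g g' : Space d → ℂ}

theorem RobinBoundary.IsWeakPartial.aestronglyMeasurable (h : IsWeakPartial U i u g) :
    AEStronglyMeasurable u (volume.restrict U) ∧ AEStronglyMeasurable g (volume.restrict U) :=
  ⟨h.1.aestronglyMeasurable, h.2.1.aestronglyMeasurable⟩

theorem MeasureTheory.LocallyIntegrableOn.integrableOn_mul_of_tsupport_subset
    (hu : LocallyIntegrableOn u U) {φ : Space d → ℝ} (hφ : Continuous φ)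
    (hφc : HasCompactSupport φ) (hφU : tsupport φ ⊆ U) :
    IntegrableOn (fun x => (φ x : ℂ) * u x) U := by
  have h1 : IntegrableOn (fun x => (φ x : ℂ) * u x) (tsupport φ) :=
    (hu.integrableOn_compact_subset hφU hφc).continuousOn_mul
      (Complex.continuous_ofReal.comp hφ).continuousOn hφc
  refine (integrableOn_iff_integrable_of_support_subset ?_).1 h1 |>.integrableOn
  intro x hx
  by_contra h0
  exact hx (by simp [image_eq_zero_of_notMem_tsupport h0])

theorem RobinBoundary.IsWeakPartial.unique (hU : IsOpen U) (h : IsWeakPartial U i u g)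
    (h' : IsWeakPartial U i u g') : g =ᵐ[volume.restrict U] g' := by
  have h1 := hU.ae_eq_zero_of_integral_contDiff_smul_eq_zero (μ := volume)
      (f := fun x => g x - g' x)
    (h.2.1.sub h'.2.1) fun φ hφ hφc hφU => by
    have e1 := h.2.2 φ hφ hφc hφU
    rw [h'.2.2 φ hφ hφc hφU, neg_inj] at e1
    have h0 : ∀ x ∉ U, φ x = 0 := fun x hx =>
      image_eq_zero_of_notMem_tsupport fun hx' => hx (hφU hx')
    rw [← setIntegral_eq_integral_of_forall_compl_eq_zero (s := U) fun x hx => by simp [h0 x hx]]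
    simp only [Complex.real_smul, mul_sub]
    rw [integral_sub (h.2.1.integrableOn_mul_of_tsupport_subset hφ.continuous hφc hφU)
      (h'.2.1.integrableOn_mul_of_tsupport_subset hφ.continuous hφc hφU), e1, sub_self]
  filter_upwards [ae_restrict_of_ae h1, ae_restrict_mem hU.measurableSet] with x hx hxU
  exact sub_eq_zero.1 (hx hxU)

/-- The defining identity of the weak derivative holds for test functions of class `C¹`. -/
theorem RobinBoundary.IsWeakPartial.integral_eq_of_contDiff_one (hU : IsOpen U)
    (h : IsWeakPartial U i u g) {ψ : Space d → ℝ} (hψ : ContDiff ℝ 1 ψ) (hψc : HasCompactSupport ψ)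
    (hψU : tsupport ψ ⊆ U) : ∫ x in U, (fderiv ℝ ψ x (EuclideanSpace.single i 1) : ℂ) * u x
        = -∫ x in U, (ψ x : ℂ) * g x := by
  obtain ⟨δ, hδ, hδU⟩ := hψc.exists_cthickening_subset_open hU hψU
  set T := Metric.cthickening δ (tsupport ψ) with hT
  have hTc : IsCompact T := hψc.cthickening
  have hlim : Tendsto (fun n => (mollifier d n).rOut) atTop (𝓝 0) :=
    tendsto_one_div_add_atTop_nhds_zero_nat
  set k : ℕ → Space d → ℝ := fun n => (mollifier d n).normed volume with hkdef
  have hki : ∀ n, LocallyIntegrable (k n) := fun n =>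
    ((mollifier d n).continuous_normed).locallyIntegrable
  -- the mollifications of a continuous function with support in that of `ψ`
  have key : ∀ φ : Space d → ℝ, Continuous φ → tsupport φ ⊆ tsupport ψ →
      ∀ f : Space d → ℂ, LocallyIntegrableOn f U → Tendsto (fun n => ∫ x in U,
        ((convolution (k n) φ (ContinuousLinearMap.lsmul ℝ ℝ) volume x : ℝ) : ℂ) * f x) atTop
        (𝓝 (∫ x in U, (φ x : ℂ) * f x)) ∧ ∀ᶠ n in atTop,
        tsupport (convolution (k n) φ (ContinuousLinearMap.lsmul ℝ ℝ) volume) ⊆ T := by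
    intro φ hφ hφψ f hf
    have hφc : HasCompactSupport φ := hψc.of_isClosed_subset (isClosed_tsupport _) hφψ
    obtain ⟨B, hB⟩ := hφ.bounded_above_of_compact_support hφc
    have hB0 : 0 ≤ B := (norm_nonneg _).trans (hB 0)
    have hcont : ∀ n, Continuous (convolution (k n) φ (ContinuousLinearMap.lsmul ℝ ℝ) volume) :=
      fun n => hφc.continuous_convolution_right _ (hki n) hφ
    have hbd : ∀ n x, ‖convolution (k n) φ (ContinuousLinearMap.lsmul ℝ ℝ) volume x‖ ≤ B := by
      intro n x
      have := dist_convolution_le (f := k n) (g := φ) (μ := volume) (x₀ := x) (z₀ := 0)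
        (R := (mollifier d n).rOut) (ε := B) hB0
        ((mollifier d n).support_normed_eq (μ := volume)).subset (mollifier d n).nonneg_normed
        (mollifier d n).integral_normed hφ.aestronglyMeasurable fun y _ => by simpa using hB y
      simpa using this
    have hsupp : ∀ᶠ n in atTop,
        tsupport (convolution (k n) φ (ContinuousLinearMap.lsmul ℝ ℝ) volume) ⊆ T := by
      filter_upwards [hlim.eventually (gt_mem_nhds hδ)] with n hn
      refine closure_minimal ((support_convolution_subset _).trans ?_) Metric.isClosed_cthickening
      rintro _ ⟨y, hy, z, hz, rfl⟩
      refine Metric.mem_cthickening_of_dist_le _ z _ _ (hφψ (subset_tsupport _ hz)) ?_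
      rw [hkdef, ContDiffBump.support_normed_eq, mem_ball_zero_iff] at hy
      simpa using (hy.trans hn).le
    refine ⟨?_, hsupp⟩
    refine tendsto_integral_filter_of_dominated_convergence
      (T.indicator fun x => B * ‖f x‖) ?_ ?_ ?_ ?_
    · refine Eventually.of_forall fun n => ?_
      exact (Complex.continuous_ofReal.comp (hcont n)).aestronglyMeasurable.mul
        hf.aestronglyMeasurable
    · filter_upwards [hsupp] with n hn
      refine Eventually.of_forall fun x => ?_
      by_cases hx : x ∈ T
      · rw [indicator_of_mem hx, norm_mul, Complex.norm_real]
        exact mul_le_mul_of_nonneg_right (hbd n x) (norm_nonneg _)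
      · rw [indicator_of_notMem hx, image_eq_zero_of_notMem_tsupport fun h => hx (hn h)]
        simp
    · rw [integrable_indicator_iff hTc.measurableSet]
      have hfT : Integrable f ((volume.restrict U).restrict T) := by
        rw [Measure.restrict_restrict hTc.measurableSet]
        exact (hf.integrableOn_compact_subset hδU hTc).mono_set inter_subset_left
      exact hfT.norm.const_mul B
    · refine Eventually.of_forall fun x => ?_
      have h2 := ContDiffBump.convolution_tendsto_right_of_continuous (μ := volume) hlim hφ x
      exact ((Complex.continuous_ofReal.tendsto _).comp h2).mul_const _
  have hψ' : Continuous fun x => fderiv ℝ ψ x (EuclideanSpace.single i 1) :=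
    (hψ.continuous_fderiv one_ne_zero).clm_apply continuous_const
  have h1 := (key _ hψ' (tsupport_fderiv_apply_subset ℝ (f := ψ) _) u h.1).1
  obtain ⟨h2, hsupp⟩ := key _ hψ.continuous Subset.rfl g h.2.1
  refine tendsto_nhds_unique h1 (h2.neg.congr' ?_)
  filter_upwards [hsupp] with n hn
  have hsm : ContDiff ℝ ∞ (convolution (k n) ψ (ContinuousLinearMap.lsmul ℝ ℝ) volume) :=
    (mollifier d n).hasCompactSupport_normed.contDiff_convolution_left _
      (mollifier d n).contDiff_normed hψ.continuous.locallyIntegrable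
  rw [← h.2.2 _ hsm (hTc.of_isClosed_subset (isClosed_tsupport _) hn) (hn.trans hδU)]
  congr 1
  funext x
  rw [(hψc.hasFDerivAt_convolution_right _ (hki n) hψ x).fderiv,
    convolution_precompR_apply _ (hki n) (hψc.fderiv ℝ) (hψ.continuous_fderiv one_ne_zero)]

theorem RobinBoundary.IsWeakPartial.sub {w k : Space d → ℂ} (h : IsWeakPartial U i u g)
    (h' : IsWeakPartial U i w k) :
    IsWeakPartial U i (fun x => u x - w x) (fun x => g x - k x) := by
  refine ⟨h.1.sub h'.1, h.2.1.sub h'.2.1, fun φ hφ hφc hφU => ?_⟩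
  have hφ' : Continuous fun x => fderiv ℝ φ x (EuclideanSpace.single i 1) :=
    (hφ.continuous_fderiv (by simp)).clm_apply continuous_const
  have hs := tsupport_fderiv_apply_subset ℝ (f := φ) (EuclideanSpace.single i 1)
  have hc := hφc.of_isClosed_subset (isClosed_tsupport _) hs
  simp only [mul_sub]
  rw [integral_sub (h.1.integrableOn_mul_of_tsupport_subset hφ' hc (hs.trans hφU))
      (h'.1.integrableOn_mul_of_tsupport_subset hφ' hc (hs.trans hφU)),
    integral_sub (h.2.1.integrableOn_mul_of_tsupport_subset hφ.continuous hφc hφU)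
      (h'.2.1.integrableOn_mul_of_tsupport_subset hφ.continuous hφc hφU),
    h.2.2 φ hφ hφc hφU, h'.2.2 φ hφ hφc hφU]
  ring

theorem RobinBoundary.IsWeakPartial.sum {ι : Type*} {s : Finset ι} {u g : ι → Space d → ℂ}
    (h : ∀ l ∈ s, IsWeakPartial U i (u l) (g l)) :
    IsWeakPartial U i (fun x => ∑ l ∈ s, u l x) (fun x => ∑ l ∈ s, g l x) := by
  classical
  have h0 : IsWeakPartial U i (fun _ => (0 : ℂ)) (fun _ => 0) :=
    ⟨locallyIntegrableOn_const _, locallyIntegrableOn_const _, by simp⟩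
  induction s using Finset.induction_on with
  | empty => simpa using h0
  | insert l s hl ih =>
    have h1 := ((h l (Finset.mem_insert_self l s))).sub
      (h0.sub (ih fun j hj => h j (Finset.mem_insert_of_mem hj)))
    simp only [Finset.sum_insert hl]
    simpa using h1

/-- The product rule for a weakly differentiable function and a `C¹` coefficient. -/
theorem RobinBoundary.IsWeakPartial.mul (hU : IsOpen U) (h : IsWeakPartial U i u g)
    {c : Space d → ℝ} (hc : ContDiffOn ℝ 1 c U) :
    IsWeakPartial U i (fun x => (c x : ℂ) * u x) (fun x => (c x : ℂ) * g x
      + (fderiv ℝ c x (EuclideanSpace.single i 1) : ℂ) * u x) := by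
  have hcc : ContinuousOn (fun x => (c x : ℂ)) U :=
    Complex.continuous_ofReal.comp_continuousOn hc.continuousOn
  have hcd : ContinuousOn (fun x => fderiv ℝ c x (EuclideanSpace.single i 1)) U :=
    (hc.continuousOn_fderiv_of_isOpen hU le_rfl).clm_apply continuousOn_const
  have hcd' : ContinuousOn (fun x => (fderiv ℝ c x (EuclideanSpace.single i 1) : ℂ)) U :=
    Complex.continuous_ofReal.comp_continuousOn hcd
  have l1 := h.1.continuousOn_mul hcc hU.isLocallyClosed
  have l2 := h.2.1.continuousOn_mul hcc hU.isLocallyClosed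
  have l3 := h.1.continuousOn_mul hcd' hU.isLocallyClosed
  refine ⟨l1, l2.add l3, fun φ hφ hφc hφU => ?_⟩
  have hψts : tsupport (fun x => φ x * c x) ⊆ tsupport φ := tsupport_mul_subset_left
  have hψc : HasCompactSupport (fun x => φ x * c x) :=
    hφc.of_isClosed_subset (isClosed_tsupport _) hψts
  have hψ : ContDiff ℝ 1 (fun x => φ x * c x) := by
    rw [contDiff_iff_contDiffAt]
    intro x
    by_cases hx : x ∈ tsupport φ
    · exact ((hφ.of_le (by exact_mod_cast le_top)).contDiffAt).mul
        (hc.contDiffAt (hU.mem_nhds (hφU hx)))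
    · have h0 : (fun x => φ x * c x) =ᶠ[𝓝 x] fun _ => 0 := by
        filter_upwards [(isClosed_tsupport φ).isOpen_compl.mem_nhds hx] with y hy
        rw [image_eq_zero_of_notMem_tsupport hy, zero_mul]
      exact contDiffAt_const.congr_of_eventuallyEq h0
  have hmain := h.integral_eq_of_contDiff_one hU hψ hψc (hψts.trans hφU)
  have hφ' : Continuous fun x => fderiv ℝ φ x (EuclideanSpace.single i 1) :=
    (hφ.continuous_fderiv (by simp)).clm_apply continuous_const
  have hs := tsupport_fderiv_apply_subset ℝ (f := φ) (EuclideanSpace.single i 1)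
  have hsc := hφc.of_isClosed_subset (isClosed_tsupport _) hs
  have i1 := l1.integrableOn_mul_of_tsupport_subset hφ' hsc (hs.trans hφU)
  have i2 := l2.integrableOn_mul_of_tsupport_subset hφ.continuous hφc hφU
  have i3 := l3.integrableOn_mul_of_tsupport_subset hφ.continuous hφc hφU
  have hfd : ∀ x ∈ U, (fderiv ℝ (fun x => φ x * c x) x (EuclideanSpace.single i 1) : ℂ) * u x
      = (fderiv ℝ φ x (EuclideanSpace.single i 1) : ℂ) * ((c x : ℂ) * u x)
        + (φ x : ℂ) * ((fderiv ℝ c x (EuclideanSpace.single i 1) : ℂ) * u x) := by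
    intro x hx
    have hcx : DifferentiableAt ℝ c x :=
      (hc.contDiffAt (hU.mem_nhds hx)).differentiableAt one_ne_zero
    have hφx : DifferentiableAt ℝ φ x := hφ.differentiable (by simp) x
    rw [fderiv_fun_mul hφx hcx]
    simp only [_root_.add_apply, _root_.smul_apply, smul_eq_mul]
    push_cast
    ring
  rw [setIntegral_congr_fun hU.measurableSet hfd, integral_add i1 i3] at hmain
  simp only [mul_add]
  rw [integral_add i2 i3]
  have e : ∀ x, ((φ x * c x : ℝ) : ℂ) * g x = (φ x : ℂ) * ((c x : ℂ) * g x) := fun x => by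
    push_cast; ring
  simp only [e] at hmain
  linear_combination hmain

end WeakPartial

/-! ### Traces on smooth pieces of the boundary -/

/-- `Γ` is a compact part of the boundary of the bounded open set `Ω` that is locally the graph of
a `C^{2,1}` function, with `Ω` on one side. -/
structure IsSmoothPiece (Ω Γ : Set (Space d)) : Prop where
  one_le : 1 ≤ d
  isOpen : IsOpen Ω
  isBounded : Bornology.IsBounded Ω
  isCompact : IsCompact Γ
  exists_chart : ∀ x ∈ Γ, ∃ (G : GraphData d) (ρ : ℝ), IsChart G Ω Γ x ρ

theorem IsChart.exists_surface_ball_le {G : GraphData d} {Ω Γ : Set (Space d)} {x₀ : Space d}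
    {ρ : ℝ} (h : IsChart G Ω Γ x₀ ρ) : ∃ C : ℝ≥0, ∀ y r, 0 < r →
      surface (Γ ∩ Metric.ball x₀ (ρ / 2)) (Metric.ball y r) ≤ C * ENNReal.ofReal
        (r ^ (d - 1)) := by
  obtain ⟨C, hC⟩ := G.exists_measure_ball_le x₀ ρ
  refine ⟨C, fun y r hr => (hC y r hr).trans' ?_⟩
  rw [surface, Measure.restrict_apply Metric.isOpen_ball.measurableSet]
  refine measure_mono fun z hz => ⟨⟨?_, ?_⟩, hz.1⟩
  · exact (h.mem_surf z (Metric.ball_subset_ball (half_le_self h.pos.le) hz.2.2)).1 hz.2.1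
  · exact Metric.ball_subset_ball (half_le_self h.pos.le) hz.2.2

theorem IsChart.isFiniteMeasure {G : GraphData d} {Ω Γ : Set (Space d)} {x₀ : Space d} {ρ : ℝ}
    (h : IsChart G Ω Γ x₀ ρ) : IsFiniteMeasure (surface (Γ ∩ Metric.ball x₀ (ρ / 2))) := by
  obtain ⟨C, hC⟩ := h.exists_surface_ball_le
  refine ⟨?_⟩
  have h1 : surface (Γ ∩ Metric.ball x₀ (ρ / 2)) univ
      ≤ surface (Γ ∩ Metric.ball x₀ (ρ / 2)) (Metric.ball x₀ (ρ / 2)) := by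
    rw [surface, Measure.restrict_apply_univ, Measure.restrict_apply
      Metric.isOpen_ball.measurableSet]
    exact measure_mono (subset_inter inter_subset_right Subset.rfl)
  exact (h1.trans (hC x₀ _ (half_pos h.pos))).trans_lt
    (ENNReal.mul_lt_top ENNReal.coe_lt_top ENNReal.ofReal_lt_top)

namespace IsSmoothPiece

variable {Ω Γ : Set (Space d)}

theorem measurableSet (hΓ : IsSmoothPiece Ω Γ) : MeasurableSet Γ := hΓ.isCompact.measurableSet

theorem ae_mem (hΓ : IsSmoothPiece Ω Γ) : ∀ᵐ x ∂surface Γ, x ∈ Γ :=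
  ae_restrict_mem hΓ.measurableSet

theorem subset_closure (hΓ : IsSmoothPiece Ω Γ) : Γ ⊆ closure Ω := by
  intro x hx
  obtain ⟨G, ρ, h⟩ := hΓ.exists_chart x hx
  simpa using (h.uniqueDiffWithinAt hx (Metric.mem_ball_self (half_pos h.pos))).mem_closure

/-- A partial trace, from the cone condition in a chart. -/
theorem exists_local_trace (hΓ : IsSmoothPiece Ω Γ) {G : GraphData d} {x₀ : Space d} {ρ : ℝ}
    (h : IsChart G Ω Γ x₀ ρ) {M r₀ : ℝ}
    (hcone : ConeCondition Ω (Γ ∩ Metric.ball x₀ (ρ / 2)) G.e M r₀) {u : Space d → ℂ}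
    (hu : HasTraceRegularity Ω u) :
    ∃ b, MemLp b 2 (surface (Γ ∩ Metric.ball x₀ (ρ / 2))) ∧
      (∀ᵐ x ∂surface (Γ ∩ Metric.ball x₀ (ρ / 2)), HasTraceAt Ω u x (b x)) ∧
      Tendsto (fun k : ℕ => eLpNorm (coneMean Ω G.e M (r₀ / 2 * (1 / (M + 1)) ^ k) u - b) 2
        (surface (Γ ∩ Metric.ball x₀ (ρ / 2)))) atTop (𝓝 0) := by
  have := h.isFiniteMeasure
  obtain ⟨C, hC⟩ := h.exists_surface_ball_le
  exact hu.exists_trace (μ := surface (Γ ∩ Metric.ball x₀ (ρ / 2))) hΓ.one_le hΓ.isOpen hΓ.isBounded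
    hcone (ae_restrict_mem (hΓ.measurableSet.inter Metric.isOpen_ball.measurableSet)) hC

theorem ae_eq_of_hasTraceAt (hΓ : IsSmoothPiece Ω Γ) {S : Set (Space d)} (hS : MeasurableSet S)
    (hSΓ : S ⊆ Γ) {u b b' : Space d → ℂ}
    (hu : AEStronglyMeasurable u (volume.restrict Ω))
    (h : ∀ᵐ x ∂surface S, HasTraceAt Ω u x (b x)) (h' : ∀ᵐ x ∂surface S, HasTraceAt Ω u x (b' x)) :
    b =ᵐ[surface S] b' := by
  filter_upwards [h, h', ae_restrict_mem hS] with x hx hx' hxS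
  exact hx.unique hΓ.isOpen (hΓ.subset_closure (hSΓ hxS)) hu hx'

theorem surface_mono {S T : Set (Space d)} (h : S ⊆ T) : surface S ≤ surface T :=
  Measure.restrict_mono h le_rfl

/-- Near a point of `Γ`, the trace is the limit in `L²` of the averages over small balls. -/
theorem tendsto_coneMean (hΓ : IsSmoothPiece Ω Γ) {G : GraphData d} {x₀ : Space d} {ρ : ℝ}
    (h : IsChart G Ω Γ x₀ ρ) {M r₀ : ℝ}
    (hcone : ConeCondition Ω (Γ ∩ Metric.ball x₀ (ρ / 2)) G.e M r₀) {u b : Space d → ℂ}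
    (hu : HasTraceRegularity Ω u) (hb : IsTrace Ω Γ u b) :
    Tendsto (fun k : ℕ => eLpNorm (coneMean Ω G.e M (r₀ / 2 * (1 / (M + 1)) ^ k) u - b) 2
        (surface (Γ ∩ Metric.ball x₀ (ρ / 2)))) atTop (𝓝 0) := by
  obtain ⟨b', -, h2, h3⟩ := hΓ.exists_local_trace h hcone hu
  have hbb : b' =ᵐ[surface (Γ ∩ Metric.ball x₀ (ρ / 2))] b :=
    hΓ.ae_eq_of_hasTraceAt (hΓ.measurableSet.inter Metric.isOpen_ball.measurableSet)
      inter_subset_left hu.1.1 h2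
      (ae_restrict_of_ae_restrict_of_subset inter_subset_left hb.2)
  refine h3.congr fun k => eLpNorm_congr_ae ?_
  filter_upwards [hbb] with x hx
  simp only [Pi.sub_apply, hx]

/-- The local traces agree almost everywhere on overlaps, so that they define a trace on `Γ`. -/
theorem exists_isTrace (hΓ : IsSmoothPiece Ω Γ) {u : Space d → ℂ} (hu : HasTraceRegularity Ω u) :
    ∃ b, IsTrace Ω Γ u b := by
  classical
  have hloc : ∀ x ∈ Γ, ∃ (R : ℝ) (b : Space d → ℂ), 0 < R ∧
      MemLp b 2 (surface (Γ ∩ Metric.ball x R)) ∧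
      ∀ᵐ y ∂surface (Γ ∩ Metric.ball x R), HasTraceAt Ω u y (b y) := by
    intro x hx
    obtain ⟨G, ρ, h⟩ := hΓ.exists_chart x hx
    obtain ⟨M, r₀, hcone⟩ := h.exists_coneCondition
    obtain ⟨b, h1, h2, -⟩ := hΓ.exists_local_trace h hcone hu
    exact ⟨ρ / 2, b, half_pos h.pos, h1, h2⟩
  choose! R b hR hb htr using hloc
  obtain ⟨t, htΓ, ht⟩ := hΓ.isCompact.elim_nhds_subcover (fun x => Metric.ball x (R x))
    fun x hx => Metric.ball_mem_nhds x (hR x hx)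
  have hcov : Γ = ⋃ x : t, Γ ∩ Metric.ball (x : Space d) (R x) := by
    rw [← inter_iUnion, eq_comm, inter_eq_left]
    refine ht.trans_eq ?_
    rw [iUnion_subtype]
  set B : Space d → ℂ := fun y => if h : ∃ a, HasTraceAt Ω u y a then h.choose else 0 with hB
  have hBtr : ∀ y a, HasTraceAt Ω u y a → HasTraceAt Ω u y (B y) := by
    intro y a ha
    have hex : ∃ a, HasTraceAt Ω u y a := ⟨a, ha⟩
    simp only [hB, dif_pos hex]
    exact hex.choose_spec
  have hae : ∀ x : t, b x =ᵐ[surface (Γ ∩ Metric.ball (x : Space d) (R x))] B := fun x =>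
    hΓ.ae_eq_of_hasTraceAt (hΓ.measurableSet.inter Metric.isOpen_ball.measurableSet)
      inter_subset_left hu.1.1 (htr x (htΓ x x.2))
        ((htr x (htΓ x x.2)).mono fun y hy => hBtr y _ hy)
  have hmem : ∀ x : t, MemLp B 2 (surface (Γ ∩ Metric.ball (x : Space d) (R x))) := fun x =>
    (memLp_congr_ae (hae x)).1 (hb x (htΓ x x.2))
  refine ⟨B, ?_, ?_⟩
  · have hm : AEStronglyMeasurable B (surface Γ) := by
      rw [surface, hcov]
      exact aestronglyMeasurable_iUnion_iff.2 fun x => (hmem x).1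
    rw [memLp_two_iff_integrable_sq_norm hm, surface, hcov]
    exact (integrableOn_finite_iUnion).2 fun x =>
      (memLp_two_iff_integrable_sq_norm (hmem x).1).1 (hmem x)
  · rw [surface, hcov, ae_restrict_iUnion_eq, eventually_iSup]
    intro x
    exact (htr x (htΓ x x.2)).mono fun y hy => hBtr y _ hy

theorem memLp_mul (hΓ : IsSmoothPiece Ω Γ) {c f : Space d → ℂ} (hc : ContinuousOn c Γ)
    (hf : MemLp f 2 (surface Γ)) : MemLp (fun x => c x * f x) 2 (surface Γ) := by
  obtain ⟨B, hB⟩ := hΓ.isCompact.exists_bound_of_continuousOn hc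
  refine hf.of_le_mul (c := B) ((hc.aestronglyMeasurable hΓ.measurableSet).mul hf.1) ?_
  filter_upwards [hΓ.ae_mem] with x hx
  rw [norm_mul]
  exact mul_le_mul_of_nonneg_right (hB x hx) (norm_nonneg _)

theorem continuousOn_outwardNormal_coord (hΓ : IsSmoothPiece Ω Γ) (j : Fin d) :
    ContinuousOn (fun x => ((outwardNormal Ω x j : ℝ) : ℂ)) Γ := by
  obtain ⟨N, hN, hNn⟩ := exists_normalField hΓ.isCompact hΓ.exists_chart
  refine (Complex.continuous_ofReal.comp
    ((contDiff_euclidean.1 hN.1) j).continuous).continuousOn.congr fun x hx => ?_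
  simp [hNn x hx]

theorem memLp_normalComp (hΓ : IsSmoothPiece Ω Γ) {ξ : Space d → Fin d → ℂ}
    (hξ : ∀ j, MemLp (fun x => ξ x j) 2 (surface Γ)) :
    MemLp (fun x => normalComp (outwardNormal Ω x) (ξ x)) 2 (surface Γ) := by
  simp only [normalComp, dotProduct, toC]
  refine memLp_finsetSum _ fun j _ => ?_
  simpa only [mul_comm] using hΓ.memLp_mul (hΓ.continuousOn_outwardNormal_coord j) (hξ j)

theorem memLp_tangentialPart (hΓ : IsSmoothPiece Ω Γ) {ξ : Space d → Fin d → ℂ}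
    (hξ : ∀ j, MemLp (fun x => ξ x j) 2 (surface Γ)) (j : Fin d) :
    MemLp (fun x => tangentialPart (outwardNormal Ω x) (ξ x) j) 2 (surface Γ) := by
  refine (hξ j).sub ?_
  simpa only [normalPart, Pi.smul_apply, smul_eq_mul, toC, mul_comm] using
    hΓ.memLp_mul (hΓ.continuousOn_outwardNormal_coord j) (hΓ.memLp_normalComp hξ)

theorem memLp_tangentialDiv (hΓ : IsSmoothPiece Ω Γ) {D : Space d → Matrix (Fin d) (Fin d) ℂ}
    (hD : ∀ i j, MemLp (fun x => D x i j) 2 (surface Γ)) :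
    MemLp (fun x => tangentialDiv (outwardNormal Ω x) (D x)) 2 (surface Γ) :=
  memLp_finsetSum _ fun j _ => hΓ.memLp_tangentialPart (fun i => hD i j) j

/-- The gradient `∂_i (v_j - (v · N) N_j)` of the tangential part of `v`, from the gradient `G` and
the values `b` of `v`. -/
noncomputable def _root_.tangentialGradient (N : Space d → Space d)
    (G : Space d → Matrix (Fin d) (Fin d) ℂ) (b : Space d → Fin d → ℂ) (x : Space d) :
    Matrix (Fin d) (Fin d) ℂ :=
  Matrix.of fun i j => G x i j - ∑ l, (((N x l * N x j : ℝ) : ℂ) * G x i l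
    + ((fderiv ℝ (fun y => N y l * N y j) x (EuclideanSpace.single i 1) : ℝ) : ℂ) * b x l)

section Tangential

variable {V : Set (Space d)} {N : Space d → Space d} {v b : Space d → Fin d → ℂ}
  {G : Space d → Matrix (Fin d) (Fin d) ℂ}

theorem _root_.contDiffOn_coord_mul (hN : ContDiffOn ℝ 1 N V) (l j : Fin d) :
    ContDiffOn ℝ 1 (fun y => N y l * N y j) V :=
  ((contDiffOn_euclidean.1 hN) l).mul ((contDiffOn_euclidean.1 hN) j)

/-- The product rule for the tangential part. -/
theorem exists_tangential (hΓ : IsSmoothPiece Ω Γ) (hV : IsOpen V) (hΓV : Γ ⊆ V)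
    (hN : ContDiffOn ℝ 1 N V) (hb : IsVectorTrace Ω Γ v b) (hG : IsGradientTrace Ω Γ v G)
    (i j : Fin d) : ∃ g, IsWeakPartial (Ω ∩ V) i (fun x => tangentialPart (N x) (v x) j) g ∧
      IsTrace (Ω ∩ V) Γ g (fun x => tangentialGradient N G b x i j) := by
  have hU : IsOpen (Ω ∩ V) := hΓ.isOpen.inter hV
  choose g hg hgt using fun l => hG i l
  have hg' : ∀ l, IsWeakPartial (Ω ∩ V) i (fun x => v x l) (g l) := fun l =>
    (hg l).mono hΓ.isOpen.measurableSet inter_subset_left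
  have hc := fun l => contDiffOn_coord_mul hN l j
  have hcU := fun l => (hc l).mono (inter_subset_right (s := Ω))
  have hw := (hg' j).sub (IsWeakPartial.sum (s := Finset.univ)
    (fun l _ => (hg' l).mul hU (hcU l)))
  have htp : (fun x => tangentialPart (N x) (v x) j)
      = fun x => v x j - ∑ l, ((N x l * N x j : ℝ) : ℂ) * v x l := by
    funext x
    simp only [tangentialPart, normalPart, normalComp, dotProduct, toC, Pi.sub_apply, Pi.smul_apply,
      smul_eq_mul, Finset.sum_mul]
    congr 1
    refine Finset.sum_congr rfl fun l _ => ?_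
    push_cast
    ring
  have hcd : ∀ l, ContinuousOn
      (fun x => fderiv ℝ (fun y => N y l * N y j) x (EuclideanSpace.single i 1)) V := fun l =>
    ((hc l).continuousOn_fderiv_of_isOpen hV le_rfl).clm_apply continuousOn_const
  have hcC : ∀ l, ContinuousOn (fun x => ((N x l * N x j : ℝ) : ℂ)) V := fun l =>
    Complex.continuous_ofReal.comp_continuousOn (hc l).continuousOn
  have hcdC : ∀ l, ContinuousOn
      (fun x => ((fderiv ℝ (fun y => N y l * N y j) x (EuclideanSpace.single i 1) : ℝ) : ℂ)) V :=
    fun l => Complex.continuous_ofReal.comp_continuousOn (hcd l)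
  refine ⟨_, by rw [htp]; exact hw, ?_, ?_⟩
  · simp only [tangentialGradient, Matrix.of_apply]
    refine (hgt j).1.sub (memLp_finsetSum _ fun l _ => ?_)
    exact (hΓ.memLp_mul ((hcC l).mono hΓV) (hgt l).1).add
      (hΓ.memLp_mul ((hcdC l).mono hΓV) (hb l).1)
  · have h1 : ∀ᵐ x ∂surface Γ, ∀ l, HasTraceAt Ω (g l) x (G x i l) :=
      ae_all_iff.2 fun l => (hgt l).2
    have h2 : ∀ᵐ x ∂surface Γ, ∀ l, HasTraceAt Ω (fun x => v x l) x (b x l) :=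
      ae_all_iff.2 fun l => (hb l).2
    filter_upwards [h1, h2, hΓ.ae_mem] with x hx1 hx2 hxΓ
    have hVx : V ∈ 𝓝 x := hV.mem_nhds (hΓV hxΓ)
    have t1 := fun l => (hasTraceAt_inter_iff hVx).2 (hx1 l)
    have t2 := fun l => (hasTraceAt_inter_iff hVx).2 (hx2 l)
    have hm : ∀ {c : Space d → ℂ}, ContinuousOn c V →
        AEStronglyMeasurable c (volume.restrict (Ω ∩ V)) := fun hc =>
      (hc.mono inter_subset_right).aestronglyMeasurable hU.measurableSet
    have t3 := fun l => (t1 l).mul_continuousAt ((hcC l).continuousAt hVx) (hm (hcC l))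
    have t4 := fun l => (t2 l).mul_continuousAt ((hcdC l).continuousAt hVx) (hm (hcdC l))
    have m1 := fun l => (hm (hcC l)).mul (hg' l).aestronglyMeasurable.2
    have m2 := fun l => (hm (hcdC l)).mul (hg' l).aestronglyMeasurable.1
    have t5 := fun l => (t3 l).add_of_aemeasurable (t4 l) (m1 l)
    have t6 := HasTraceAt.sum (s := Finset.univ) (fun l _ => t5 l)
      fun l _ => (m1 l).add (m2 l)
    have t7 := t6.mul_continuousAt (c := fun _ => -1) continuousAt_const aestronglyMeasurable_const
    have t8 := (t1 j).add_of_aemeasurable t7 (hg' j).aestronglyMeasurable.2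
    simpa [tangentialGradient, sub_eq_add_neg] using t8

/-- The trace of the gradient of the tangential part is given by the product rule. -/
theorem ae_eq_tangentialGradient (hΓ : IsSmoothPiece Ω Γ) (hV : IsOpen V) (hΓV : Γ ⊆ V)
    (hN : ContDiffOn ℝ 1 N V) (hb : IsVectorTrace Ω Γ v b) (hG : IsGradientTrace Ω Γ v G)
    {D : Space d → Matrix (Fin d) (Fin d) ℂ}
    (hD : IsGradientTrace (Ω ∩ V) Γ (fun x => tangentialPart (N x) (v x)) D) :
    ∀ᵐ x ∂surface Γ, D x = tangentialGradient N G b x := by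
  have : ∀ i j, ∀ᵐ x ∂surface Γ, D x i j = tangentialGradient N G b x i j := by
    intro i j
    have hU : IsOpen (Ω ∩ V) := hΓ.isOpen.inter hV
    obtain ⟨g, hg, hgt⟩ := hΓ.exists_tangential hV hΓV hN hb hG i j
    obtain ⟨g', hg', hgt'⟩ := hD i j
    have hgg := hg.unique hU hg'
    filter_upwards [hgt.2, hgt'.2, hΓ.ae_mem] with x hx hx' hxΓ
    refine hx'.unique hU ?_ hg'.aestronglyMeasurable.2 (hx.congr hgg)
    rw [mem_closure_iff_nhds]
    intro W hW
    obtain ⟨y, hy, hyΩ⟩ := mem_closure_iff_nhds.1 (hΓ.subset_closure hxΓ) (W ∩ V)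
      (inter_mem hW (hV.mem_nhds (hΓV hxΓ)))
    exact ⟨y, hy.1, hyΩ, hy.2⟩
  filter_upwards [ae_all_iff.2 fun i => ae_all_iff.2 fun j => this i j] with x hx
  ext i j
  exact hx i j

/-- The tangential divergence exists, with the `C^{1,1}` extension of the normal field obtained from
the charts. -/
theorem exists_isTangentialDivTrace (hΓ : IsSmoothPiece Ω Γ) (hb : IsVectorTrace Ω Γ v b)
    (hG : IsGradientTrace Ω Γ v G) :
    ∃ q, MemLp q 2 (surface Γ) ∧ IsTangentialDivTrace Ω Γ v q := by
  obtain ⟨N, hN, hNn⟩ := exists_normalField hΓ.isCompact hΓ.exists_chart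
  obtain ⟨R, hR⟩ := hΓ.isCompact.isBounded.subset_ball (0 : Space d)
  obtain ⟨K, hK⟩ := (hN.2.locallyLipschitzOn
    (s := Metric.closedBall 0 R)).exists_lipschitzOnWith_of_compact (isCompact_closedBall _ _)
  have hV : IsOpen (Metric.ball (0 : Space d) R) := Metric.isOpen_ball
  have hNV : ContDiffOn ℝ 1 N (Metric.ball 0 R) := hN.1.contDiffOn
  refine ⟨fun x => tangentialDiv (outwardNormal Ω x) (tangentialGradient N G b x), ?_,
    Metric.ball 0 R, N, K, tangentialGradient N G b, hV, hR, hNV,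
    hK.mono Metric.ball_subset_closedBall, hNn,
    fun i j => hΓ.exists_tangential hV hR hNV hb hG i j, fun x _ => rfl⟩
  have hD : ∀ i j, MemLp (fun x => tangentialGradient N G b x i j) 2 (surface Γ) := fun i j => by
    obtain ⟨g, -, hg⟩ := hΓ.exists_tangential hV hR hNV hb hG i j
    exact hg.1
  exact hΓ.memLp_tangentialDiv hD

end Tangential

end IsSmoothPiece

/-- The regularity of the function and of its weak derivatives in the space `H^s`, `3/2 < s ≤ 2`. -/
theorem RobinBoundary.MemHs.hasTraceRegularity {Ω : Set (Space d)} {s : ℝ}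
    (hs : s ∈ Ioc (3 / 2 : ℝ) 2) {u : Space d → ℂ} (hu : MemHs Ω s u) :
    HasTraceRegularity Ω u ∧ ∀ i, ∃ g, IsWeakPartial Ω i u g ∧ HasTraceRegularity Ω g := by
  refine ⟨⟨hu.1, Or.inr fun i => ?_⟩, fun i => ?_⟩
  · obtain ⟨g, h1, h2, -⟩ := hu.2 i
    exact ⟨g, h1, h2⟩
  · obtain ⟨g, h1, h2, h3, h4⟩ := hu.2 i
    refine ⟨g, h1, h2, ?_⟩
    rcases hs.2.lt_or_eq with h | h
    · exact Or.inl ⟨s, hs.1, h3 h⟩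
    · exact Or.inr (h4 h)

/-! ### Tangential derivatives on graphs -/

/-- The vector `(ν · p) q - (ν · q) p`, orthogonal to `ν`. Differentiation along these vectors gives
the operators `n_i ∂_j - n_j ∂_i`, which are tangential and skew-adjoint on hypersurfaces. -/
noncomputable def rot (ν p q : Space d) : Space d := ⟪ν, p⟫ • q - ⟪ν, q⟫ • p

theorem inner_rot (ν p q : Space d) : ⟪ν, rot ν p q⟫ = 0 := by
  simp only [rot, inner_sub_right, inner_smul_right]
  ring

namespace GraphData

variable (G : GraphData d)

theorem fderiv_par_proj (w : (ℝ ∙ G.e)ᗮ) (q : Space d) :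
    fderiv ℝ G.par w ((ℝ ∙ G.e)ᗮ.orthogonalProjectionOnto q) = q + ⟪G.slope w - G.e, q⟫ • G.e := by
  have h1 : (((ℝ ∙ G.e)ᗮ.orthogonalProjectionOnto q : (ℝ ∙ G.e)ᗮ) : Space d)
      = q + (-⟪q, G.e⟫) • G.e := by
    change (ℝ ∙ G.e)ᗮ.starProjection q = _
    rw [Submodule.starProjection_orthogonal_val,
      Submodule.starProjection_unit_singleton ℝ G.norm_e, real_inner_comm, neg_smul,
      sub_eq_add_neg]
  rw [G.fderiv_par_apply, h1, inner_add_right, inner_smul_right, G.inner_slope_e, inner_sub_left,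
    real_inner_comm q G.e, add_assoc, ← add_smul]
  congr 2
  ring

theorem rot_eq_fderiv_par (w : (ℝ ∙ G.e)ᗮ) (p q : Space d) :
    rot (G.slope w - G.e) p q = fderiv ℝ G.par w
      (⟪G.slope w - G.e, p⟫ • (ℝ ∙ G.e)ᗮ.orthogonalProjectionOnto q
        - ⟪G.slope w - G.e, q⟫ • (ℝ ∙ G.e)ᗮ.orthogonalProjectionOnto p) := by
  rw [map_sub, map_smul, map_smul, G.fderiv_par_proj, G.fderiv_par_proj, rot, smul_add, smul_add,
    smul_smul, smul_smul, mul_comm ⟪G.slope w - G.e, q⟫]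
  abel

/-- The Hessian of the height function, restricted to the hyperplane, is symmetric. -/
theorem inner_fderiv_slope_proj (w p q : Space d) :
    ⟪fderiv ℝ G.slope w ((ℝ ∙ G.e)ᗮ.orthogonalProjectionOnto q), p⟫
      = ⟪fderiv ℝ G.slope w ((ℝ ∙ G.e)ᗮ.orthogonalProjectionOnto p), q⟫ := by
  have hd : DifferentiableAt ℝ G.slope w := G.contDiff_slope.differentiable one_ne_zero w
  have hsymm : ∀ a b, ⟪fderiv ℝ G.slope w a, b⟫ = ⟪fderiv ℝ G.slope w b, a⟫ := by
    have h1 : IsSymmSndFDerivAt ℝ G.g w :=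
      G.contDiff.contDiffAt.isSymmSndFDerivAt (by simp)
    have h2 : ∀ a b, fderiv ℝ (fderiv ℝ G.g) w a b = ⟪fderiv ℝ G.slope w a, b⟫ := by
      intro a b
      have e : fderiv ℝ G.g = fun y => innerSL ℝ (G.slope y) :=
        funext fun y => (G.innerSL_slope y).symm
      have e2 : HasFDerivAt (fun y => innerSL ℝ (G.slope y))
          ((innerSL ℝ).comp (fderiv ℝ G.slope w)) w :=
        (innerSL ℝ (E := Space d)).hasFDerivAt.comp w hd.hasFDerivAt
      rw [e, e2.fderiv]
      rfl
    intro a b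
    rw [← h2, ← h2]
    exact h1 a b
  have he : ∀ a, ⟪fderiv ℝ G.slope w a, G.e⟫ = 0 := by
    intro a
    have h1 : HasFDerivAt (fun y => ⟪G.e, G.slope y⟫)
        ((innerSL ℝ G.e).comp (fderiv ℝ G.slope w)) w :=
      (innerSL ℝ G.e).hasFDerivAt.comp w hd.hasFDerivAt
    have h2 : (fun y => ⟪G.e, G.slope y⟫) = fun _ => 0 :=
      funext fun y => by rw [real_inner_comm, G.inner_slope_e]
    rw [h2] at h1
    have h3 := congrArg (fun L => L a) (h1.unique (hasFDerivAt_const _ _))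
    rw [real_inner_comm]
    exact h3
  have hproj : ∀ a b, ⟪fderiv ℝ G.slope w a, b⟫
      = ⟪fderiv ℝ G.slope w a, (ℝ ∙ G.e)ᗮ.orthogonalProjectionOnto b⟫ := by
    intro a b
    have h1 : (((ℝ ∙ G.e)ᗮ.orthogonalProjectionOnto b : (ℝ ∙ G.e)ᗮ) : Space d)
        = b + (-⟪b, G.e⟫) • G.e := by
      change (ℝ ∙ G.e)ᗮ.starProjection b = _
      rw [Submodule.starProjection_orthogonal_val,
        Submodule.starProjection_unit_singleton ℝ G.norm_e, real_inner_comm, neg_smul,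
        sub_eq_add_neg]
    rw [h1, inner_add_right, inner_smul_right, he, mul_zero, add_zero]
  rw [hproj, hsymm, ← hproj]

/-- Integration by parts on a graph: the tangential operators `n_p ∂_q - n_q ∂_p` have mean value
zero. In the parameters the area density times the normal is `∇g - e`, and the zero order terms
cancel because the Hessian of `g` is symmetric. -/
theorem integral_graph_rot {φ : Space d → ℂ} (hφ : ∀ y, G.height y = 0 → ContDiffAt ℝ 1 φ y)
    (hc : HasCompactSupport fun w => φ (G.par w)) (p q : Space d) :
    ∫ y in {y | G.height y = 0}, fderiv ℝ φ y (rot (G.normal y) p q)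
      ∂(Measure.euclideanHausdorffMeasure (d - 1)) = 0 := by
  set ψ : (ℝ ∙ G.e)ᗮ → ℂ := fun w => φ (G.par w) with hψ
  have hψd : ContDiff ℝ 1 ψ := contDiff_iff_contDiffAt.2 fun w =>
    (hφ _ (G.height_par w)).comp w ((G.contDiff_par.of_le (by norm_num)).contDiffAt)
  set π := (ℝ ∙ G.e)ᗮ.orthogonalProjectionOnto with hπ
  set a : Space d → (ℝ ∙ G.e)ᗮ → ℝ := fun r w => ⟪r, G.slope w - G.e⟫ with ha
  have haD : ∀ r (w : (ℝ ∙ G.e)ᗮ), HasFDerivAt (a r) ((innerSL ℝ r).comp ((fderiv ℝ G.slope w).comp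
      (ℝ ∙ G.e)ᗮ.subtypeL)) w := by
    intro r w
    have h1 : HasFDerivAt (fun w : (ℝ ∙ G.e)ᗮ => G.slope w - G.e)
        ((fderiv ℝ G.slope w).comp (ℝ ∙ G.e)ᗮ.subtypeL) w :=
      ((G.contDiff_slope.differentiable one_ne_zero (w : Space d)).hasFDerivAt.comp w
        (ℝ ∙ G.e)ᗮ.subtypeL.hasFDerivAt).sub_const _
    exact (innerSL ℝ r).hasFDerivAt.comp w h1
  have hac : ∀ r, Continuous (a r) := fun r => by
    have := G.continuous_slope
    fun_prop
  have hac' : ∀ r v, Continuous fun w : (ℝ ∙ G.e)ᗮ => ⟪r, fderiv ℝ G.slope w v⟫ := fun r v => by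
    have : Continuous fun w : (ℝ ∙ G.e)ᗮ => fderiv ℝ G.slope w v :=
      ((G.contDiff_slope.continuous_fderiv one_ne_zero).comp continuous_subtype_val).clm_apply
        continuous_const
    fun_prop
  have hψ' : ∀ v, Continuous fun w => fderiv ℝ ψ w v := fun v =>
    (hψd.continuous_fderiv one_ne_zero).clm_apply continuous_const
  have hψc' : ∀ v, HasCompactSupport fun w => fderiv ℝ ψ w v := fun v =>
    hc.fderiv_apply ℝ v
  -- integration by parts in the hyperplane
  have hibp : ∀ r v, ∫ w, a r w • fderiv ℝ ψ w v
      = -∫ w : (ℝ ∙ G.e)ᗮ, ⟪r, fderiv ℝ G.slope w v⟫ • ψ w := by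
    intro r v
    exact integral_bilinear_hasFDerivAt_right_eq_neg_left_of_integrable
      (B := ContinuousLinearMap.lsmul ℝ ℝ) (f := a r) (g := ψ) (v := v)
      (f' := fun w => (innerSL ℝ r).comp ((fderiv ℝ G.slope w).comp (ℝ ∙ G.e)ᗮ.subtypeL))
      (g' := fderiv ℝ ψ) (((hac' r v).smul hψd.continuous).integrable_of_hasCompactSupport
        hc.smul_left)
      (((hac r).smul (hψ' v)).integrable_of_hasCompactSupport (hψc' v).smul_left)
      (((hac r).smul hψd.continuous).integrable_of_hasCompactSupport hc.smul_left)
      (fun w _ => haD r w) (fun w _ => (hψd.differentiable one_ne_zero w).hasFDerivAt)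
  rw [G.integral_graph]
  have hpt : ∀ w, G.jac (G.par w) • fderiv ℝ φ (G.par w) (rot (G.normal (G.par w)) p q)
      = a p w • fderiv ℝ ψ w (π q) - a q w • fderiv ℝ ψ w (π p) := by
    intro w
    have h1 : G.jac (G.par w) • rot (G.normal (G.par w)) p q = rot (G.slope w - G.e) p q := by
      rw [← G.slope_par, ← G.jac_smul_normal]
      simp only [rot, inner_smul_left, smul_sub, smul_smul]
      rfl
    have h2 : fderiv ℝ ψ w = (fderiv ℝ φ (G.par w)).comp (fderiv ℝ G.par w) :=
      fderiv_comp w ((hφ _ (G.height_par w)).differentiableAt one_ne_zero)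
        (G.contDiff_par.differentiable two_ne_zero w)
    rw [← map_smul, h1, G.rot_eq_fderiv_par, h2, map_sub, map_sub, map_smul, map_smul, map_smul,
      map_smul]
    simp only [ha, ContinuousLinearMap.comp_apply, real_inner_comm]
    rfl
  simp only [hpt]
  rw [integral_sub, hibp, hibp]
  · have : ∀ w : (ℝ ∙ G.e)ᗮ, ⟪p, fderiv ℝ G.slope w (π q)⟫ = ⟪q, fderiv ℝ G.slope w (π p)⟫ := by
      intro w
      rw [real_inner_comm, real_inner_comm _ q]
      exact G.inner_fderiv_slope_proj w p q
    simp only [this, sub_self]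
  · exact ((hac p).smul (hψ' _)).integrable_of_hasCompactSupport (hψc' _).smul_left
  · exact ((hac q).smul (hψ' _)).integrable_of_hasCompactSupport (hψc' _).smul_left

/-- A function that is constant on the graph near one of its points has no tangential derivative
there. -/
theorem fderiv_eq_zero_of_eqOn {F : Type*} [NormedAddCommGroup F] [NormedSpace ℝ F]
    {φ : Space d → F} {x τ : Space d} {c : F} (hx : G.height x = 0)
    (hφ : DifferentiableAt ℝ φ x) (hc : ∀ᶠ y in 𝓝 x, G.height y = 0 → φ y = c)
    (hτ : ⟪G.normal x, τ⟫ = 0) : fderiv ℝ φ x τ = 0 := by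
  set w := (ℝ ∙ G.e)ᗮ.orthogonalProjectionOnto x
  have hw : G.par w = x := G.par_proj hx
  have h0 : ⟪G.slope w - G.e, τ⟫ = 0 := by
    rw [← G.slope_par, hw, ← G.jac_smul_normal, inner_smul_left, hτ, mul_zero]
  have h1 : fderiv ℝ G.par w ((ℝ ∙ G.e)ᗮ.orthogonalProjectionOnto τ) = τ := by
    rw [G.fderiv_par_proj, h0, zero_smul, add_zero]
  have hpd : DifferentiableAt ℝ G.par w := G.contDiff_par.differentiable two_ne_zero w
  rw [← hw] at hφ hc
  have h2 : fderiv ℝ (φ ∘ G.par) w = (fderiv ℝ φ (G.par w)).comp (fderiv ℝ G.par w) :=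
    fderiv_comp w hφ hpd
  have h3 : φ ∘ G.par =ᶠ[𝓝 w] fun _ => c := by
    filter_upwards [hpd.continuousAt.eventually hc] with z hz
    exact hz (G.height_par z)
  rw [h3.fderiv_eq, fderiv_fun_const] at h2
  have h4 := congrArg (fun L => L ((ℝ ∙ G.e)ᗮ.orthogonalProjectionOnto τ)) h2
  simp only [ContinuousLinearMap.comp_apply, h1] at h4
  rw [← hw]
  simpa using h4.symm

theorem hasCompactSupport_comp_par {F : Type*} [Zero F] {φ : Space d → F}
    (hφ : ∃ (x₀ : Space d) (R : ℝ), ∀ y, φ y ≠ 0 → y ∈ Metric.ball x₀ R) :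
    HasCompactSupport fun w => φ (G.par w) := by
  obtain ⟨x₀, R, h⟩ := hφ
  refine HasCompactSupport.of_support_subset_isCompact
    (isCompact_closedBall (0 : (ℝ ∙ G.e)ᗮ) (R + dist x₀ (G.par 0))) fun w hw => ?_
  have h1 : dist (G.par w) x₀ < R := h _ hw
  have h2 := G.dist_le_dist_par w 0
  have h3 := dist_triangle (G.par w) x₀ (G.par 0)
  rw [Metric.mem_closedBall]
  linarith

end GraphData

/-! ### Functions that are `C¹` up to the boundary -/

namespace IsChart

variable {G : GraphData d} {Ω Γ : Set (Space d)} {x₀ : Space d} {ρ : ℝ}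

theorem height_nonpos (h : IsChart G Ω Γ x₀ ρ) {y : Space d} (hy : y ∈ Metric.ball x₀ ρ)
    (hyΩ : y ∈ closure Ω) : G.height y ≤ 0 := by
  by_contra! hlt
  obtain ⟨z, ⟨hz1, hz2⟩, hzΩ⟩ := mem_closure_iff_nhds.1 hyΩ
      ({z | 0 < G.height z} ∩ Metric.ball x₀ ρ)
    (inter_mem ((isOpen_lt continuous_const G.continuous_height).mem_nhds hlt)
      (Metric.isOpen_ball.mem_nhds hy))
  exact absurd ((h.mem_domain z hz2).1 hzΩ) (not_lt.2 (le_of_lt hz1))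

theorem mem_of_mem_closure (h : IsChart G Ω Γ x₀ ρ) {y : Space d} (hy : y ∈ Metric.ball x₀ ρ)
    (hyΩ : y ∈ closure Ω) : y ∈ Ω ∨ y ∈ Γ := by
  rcases (h.height_nonpos hy hyΩ).lt_or_eq with h0 | h0
  · exact Or.inl ((h.mem_domain y hy).2 h0)
  · exact Or.inr ((h.mem_surf y hy).2 h0)

theorem half_subset (h : IsChart G Ω Γ x₀ ρ) : Metric.ball x₀ (ρ / 2) ⊆ Metric.ball x₀ ρ :=
  Metric.ball_subset_ball (half_le_self h.pos.le)

theorem quarter_subset (h : IsChart G Ω Γ x₀ ρ) : Metric.ball x₀ (ρ / 4) ⊆ Metric.ball x₀ (ρ / 2) :=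
  Metric.ball_subset_ball (by linarith [h.pos])

theorem uniqueDiffOn (h : IsChart G Ω Γ x₀ ρ) (hΩ : IsOpen Ω) :
    UniqueDiffOn ℝ (closure Ω ∩ Metric.ball x₀ (ρ / 2)) := by
  rintro y ⟨hy, hyb⟩
  refine UniqueDiffWithinAt.inter ?_ (Metric.isOpen_ball.mem_nhds hyb)
  rcases h.mem_of_mem_closure (h.half_subset hyb) hy with h0 | h0
  · exact (hΩ.uniqueDiffWithinAt h0).mono subset_closure
  · exact h.uniqueDiffWithinAt h0 hyb

/-- The derivative of a `C¹` function on the closure of `Ω` is continuous up to the boundary. -/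
theorem continuousOn_fderivWithin (h : IsChart G Ω Γ x₀ ρ) (hΩ : IsOpen Ω) {f : Space d → ℝ}
    (hf : ContDiffOn ℝ 1 f (closure Ω)) :
    ContinuousOn (fderivWithin ℝ f (closure Ω)) (closure Ω ∩ Metric.ball x₀ (ρ / 2)) := by
  refine ((hf.mono inter_subset_left).continuousOn_fderivWithin (h.uniqueDiffOn hΩ) le_rfl).congr ?_
  rintro y ⟨-, hyb⟩
  exact (fderivWithin_inter (Metric.isOpen_ball.mem_nhds hyb)).symm

theorem contDiffAt_of_height_neg (h : IsChart G Ω Γ x₀ ρ) (hΩ : IsOpen Ω) {f : Space d → ℝ}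
    (hf : ContDiffOn ℝ 1 f (closure Ω)) (hfs : tsupport f ⊆ Metric.ball x₀ (ρ / 4))
    {y : Space d} (hy : G.height y < 0) : ContDiffAt ℝ 1 f y := by
  by_cases hyf : y ∈ tsupport f
  · have hyΩ : y ∈ Ω := (h.mem_domain y (h.half_subset (h.quarter_subset (hfs hyf)))).2 hy
    exact hf.contDiffAt (mem_of_superset (hΩ.mem_nhds hyΩ) subset_closure)
  · have h0 : f =ᶠ[𝓝 y] fun _ => 0 := by
      filter_upwards [(isClosed_tsupport f).isOpen_compl.mem_nhds hyf] with z hz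
      exact image_eq_zero_of_notMem_tsupport hz
    exact contDiffAt_const.congr_of_eventuallyEq h0

theorem exists_fderivWithin_bound (h : IsChart G Ω Γ x₀ ρ) (hΩ : IsOpen Ω) {f : Space d → ℝ}
    (hf : ContDiffOn ℝ 1 f (closure Ω)) (hfs : tsupport f ⊆ Metric.ball x₀ (ρ / 4)) :
    ∃ C, 0 ≤ C ∧ ∀ y ∈ closure Ω, ‖f y‖ ≤ C ∧ ‖fderivWithin ℝ f (closure Ω) y‖ ≤ C := by
  have hK : IsCompact (tsupport f ∩ closure Ω) :=
    ((isCompact_closedBall x₀ (ρ / 4)).of_isClosed_subset (isClosed_tsupport f)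
      (hfs.trans Metric.ball_subset_closedBall)).inter_right isClosed_closure
  have hKT : tsupport f ∩ closure Ω ⊆ closure Ω ∩ Metric.ball x₀ (ρ / 2) := fun y hy =>
    ⟨hy.2, h.quarter_subset (hfs hy.1)⟩
  obtain ⟨A, hA⟩ := hK.exists_bound_of_continuousOn (hf.continuousOn.mono inter_subset_right)
  obtain ⟨B, hB⟩ := hK.exists_bound_of_continuousOn ((h.continuousOn_fderivWithin hΩ hf).mono hKT)
  refine ⟨max 0 (max A B), le_max_left _ _, fun y hy => ?_⟩
  by_cases hyf : y ∈ tsupport f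
  · exact ⟨(hA y ⟨hyf, hy⟩).trans ((le_max_left _ _).trans (le_max_right _ _)),
      (hB y ⟨hyf, hy⟩).trans ((le_max_right _ _).trans (le_max_right _ _))⟩
  · have h0 : f =ᶠ[𝓝[closure Ω] y] fun _ => 0 := by
      refine mem_nhdsWithin_of_mem_nhds ?_
      filter_upwards [(isClosed_tsupport f).isOpen_compl.mem_nhds hyf] with z hz
      exact image_eq_zero_of_notMem_tsupport hz
    rw [h0.fderivWithin_eq (image_eq_zero_of_notMem_tsupport hyf),
      image_eq_zero_of_notMem_tsupport hyf]
    simp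

/-- Integration by parts on a boundary chart for a product of a function of class `C¹` on the
closure of `Ω` and a function of class `C¹` on the whole space. The first factor is moved into `Ω`
before the formula for graphs is applied. -/
theorem integral_rot_smul (h : IsChart G Ω Γ x₀ ρ) (hΩ : IsOpen Ω) (hΓm : MeasurableSet Γ)
    {f : Space d → ℝ} (hf : ContDiffOn ℝ 1 f (closure Ω))
    (hfs : tsupport f ⊆ Metric.ball x₀ (ρ / 4)) {Φ : Space d → ℂ} (hΦ : ContDiff ℝ 1 Φ)
    (p q : Space d) :
    ∫ y, (fderivWithin ℝ f (closure Ω) y (rot (G.normal y) p q) • Φ y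
      + f y • fderiv ℝ Φ y (rot (G.normal y) p q)) ∂surface (Γ ∩ Metric.ball x₀ (ρ / 2)) = 0 := by
  have hfin := h.isFiniteMeasure
  have hρ := h.pos
  set S := Γ ∩ Metric.ball x₀ (ρ / 2) with hS
  have hSm : MeasurableSet S := hΓm.inter Metric.isOpen_ball.measurableSet
  have hSeq : S = {y | G.height y = 0} ∩ Metric.ball x₀ (ρ / 2) := by
    ext y
    exact and_congr_left fun hy => h.mem_surf y (h.half_subset hy)
  set τ : Space d → Space d := fun y => rot (G.normal y) p q with hτ
  have hnc : Continuous G.normal := by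
    have h1 := G.continuous_jac.inv₀ fun y => (G.jac_pos y).ne'
    exact h1.smul (G.continuous_slope.sub continuous_const)
  have hτc : Continuous τ := by simp only [hτ, rot]; fun_prop
  set F : ℝ → Space d → ℂ := fun t y => fderiv ℝ f (y + t • G.e) (τ y) • Φ y
      + f (y + t • G.e) • fderiv ℝ Φ y (τ y) with hF
  have hcd : ∀ t : ℝ, 0 < t → ∀ y, G.height y = 0 → ContDiffAt ℝ 1 f (y + t • G.e) := by
    intro t ht y hy
    refine h.contDiffAt_of_height_neg hΩ hf hfs ?_
    rw [G.height_shift, hy]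
    linarith
  have hFint : ∀ t : ℝ, 0 < t → t < ρ / 4 → ∫ y, F t y ∂surface S = 0 := by
    intro t ht htρ
    have hsupp : ∀ y, y ∉ Metric.ball x₀ (ρ / 2) → y + t • G.e ∉ tsupport f := by
      intro y hy hyf
      refine hy ?_
      have h1 : dist (y + t • G.e) x₀ < ρ / 4 := hfs hyf
      have h2 : dist y (y + t • G.e) = t := by
        rw [dist_self_add_right, norm_smul, G.norm_e, mul_one, Real.norm_of_nonneg ht.le]
      have h3 := dist_triangle y (y + t • G.e) x₀
      rw [Metric.mem_ball]
      linarith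
    have hcomp : ∀ y, G.height y = 0 → ContDiffAt ℝ 1 (fun z => f (z + t • G.e)) y := fun y hy =>
      (hcd t ht y hy).comp y (contDiffAt_id.add contDiffAt_const)
    have hφb : ∀ y, f (y + t • G.e) • Φ y ≠ 0 → y ∈ Metric.ball x₀ (ρ / 2) := by
      intro y hy
      by_contra hyb
      exact hy (by rw [image_eq_zero_of_notMem_tsupport (hsupp y hyb), zero_smul])
    have hcs := G.hasCompactSupport_comp_par (φ := fun y => f (y + t • G.e) • Φ y) ⟨x₀, ρ / 2, hφb⟩
    have h1 := G.integral_graph_rot (φ := fun y => f (y + t • G.e) • Φ y)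
      (fun y hy => (hcomp y hy).smul hΦ.contDiffAt) hcs p q
    have hHm : MeasurableSet {y | G.height y = 0} :=
      (isClosed_eq G.continuous_height continuous_const).measurableSet
    have hSsub : S ⊆ {y | G.height y = 0} := hSeq.trans_subset inter_subset_left
    have h2 : ∀ y ∈ {y | G.height y = 0} \ S,
        fderiv ℝ (fun y => f (y + t • G.e) • Φ y) y (rot (G.normal y) p q) = 0 := by
      rintro y ⟨hy, hyS⟩
      have hyb : y ∉ Metric.ball x₀ (ρ / 2) := fun hyb => hyS (hSeq ▸ ⟨hy, hyb⟩)
      have h0 : (fun y => f (y + t • G.e) • Φ y) =ᶠ[𝓝 y] fun _ => 0 := by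
        have hcont : ContinuousAt (fun z : Space d => z + t • G.e) y := by fun_prop
        filter_upwards [hcont.eventually
          ((isClosed_tsupport f).isOpen_compl.mem_nhds (hsupp y hyb))] with z hz
        rw [image_eq_zero_of_notMem_tsupport hz, zero_smul]
      rw [h0.fderiv_eq, fderiv_fun_const]
      rfl
    rw [setIntegral_eq_of_subset_of_forall_sdiff_eq_zero hHm hSsub h2] at h1
    refine Eq.trans (setIntegral_congr_fun hSm fun y hy => ?_) h1
    have hy0 : G.height y = 0 := hSsub hy
    have e1 : fderiv ℝ (fun z => f (z + t • G.e)) y = fderiv ℝ f (y + t • G.e) :=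
      fderiv_comp_add_right _
    simp only [hF, hτ]
    rw [fderiv_fun_smul ((hcomp y hy0).differentiableAt one_ne_zero)
      (hΦ.differentiable one_ne_zero y), e1]
    simp only [_root_.add_apply, _root_.smul_apply, ContinuousLinearMap.smulRight_apply]
    exact add_comm _ _
  -- passage to the limit `t → 0`
  obtain ⟨C, hC0, hC⟩ := h.exists_fderivWithin_bound hΩ hf hfs
  have hΦ' : Continuous fun y => fderiv ℝ Φ y (τ y) :=
    (hΦ.continuous_fderiv one_ne_zero).clm_apply hτc
  obtain ⟨B₁, hB₁⟩ := (isCompact_closedBall x₀ ρ).exists_bound_of_continuousOn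
      hΦ.continuous.continuousOn
  obtain ⟨B₂, hB₂⟩ := (isCompact_closedBall x₀ ρ).exists_bound_of_continuousOn hΦ'.continuousOn
  obtain ⟨B₃, hB₃⟩ := (isCompact_closedBall x₀ ρ).exists_bound_of_continuousOn hτc.continuousOn
  have hSb : ∀ y ∈ S, y ∈ Metric.closedBall x₀ ρ := fun y hy =>
    Metric.ball_subset_closedBall (h.half_subset hy.2)
  have hSH : ∀ y ∈ S, G.height y = 0 := fun y hy => (hSeq ▸ hy).1
  have hmemS : ∀ᵐ y ∂surface S, y ∈ S := ae_restrict_mem hSm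
  have hin : ∀ t : ℝ, 0 < t → ∀ y ∈ S, y + t • G.e ∈ Metric.ball x₀ ρ → y + t • G.e ∈ Ω := by
    intro t ht y hy hyb
    refine (h.mem_domain _ hyb).2 ?_
    rw [G.height_shift, hSH y hy]
    linarith
  have hbound : ∀ t : ℝ, 0 < t → ∀ y ∈ S,
      ‖f (y + t • G.e)‖ ≤ C ∧ ‖fderiv ℝ f (y + t • G.e)‖ ≤ C := by
    intro t ht y hy
    by_cases hyf : y + t • G.e ∈ tsupport f
    · have hyΩ := hin t ht y hy (h.half_subset (h.quarter_subset (hfs hyf)))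
      have := hC _ (subset_closure hyΩ)
      rwa [fderivWithin_of_mem_nhds (mem_of_superset (hΩ.mem_nhds hyΩ) subset_closure)] at this
    · rw [image_eq_zero_of_notMem_tsupport hyf,
        image_eq_zero_of_notMem_tsupport fun hmem => hyf (tsupport_fderiv_subset ℝ hmem)]
      simpa using hC0
  set t : ℕ → ℝ := fun n => ρ / 8 * (1 / ((n : ℝ) + 1)) with htdef
  have ht0 : ∀ n, 0 < t n := fun n => by simp only [htdef]; positivity
  have htρ : ∀ n, t n < ρ / 4 := fun n => by
    have h1 : (1 : ℝ) / ((n : ℝ) + 1) ≤ 1 := by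
      rw [div_le_one (by positivity)]
      linarith [(Nat.cast_nonneg n : (0 : ℝ) ≤ n)]
    simp only [htdef]
    nlinarith
  have htlim : Tendsto t atTop (𝓝 0) := by
    have := (tendsto_one_div_add_atTop_nhds_zero_nat (𝕜 := ℝ)).const_mul (ρ / 8)
    rwa [mul_zero] at this
  have hlim : Tendsto (fun n => ∫ y, F (t n) y ∂surface S) atTop
      (𝓝 (∫ y, (fderivWithin ℝ f (closure Ω) y (τ y) • Φ y
        + f y • fderiv ℝ Φ y (τ y)) ∂surface S)) := by
    refine tendsto_integral_of_dominated_convergence (fun _ => C * B₃ * B₁ + C * B₂) ?_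
      (integrable_const _) ?_ ?_
    · intro n
      refine ContinuousOn.aestronglyMeasurable (fun y hy => ContinuousAt.continuousWithinAt ?_) hSm
      have h1 := hcd (t n) (ht0 n) y (hSH y hy)
      have h2 : ContinuousAt (fderiv ℝ f) (y + t n • G.e) :=
        (h1.fderiv_right (m := 0) (by simp)).continuousAt
      have h3 : ContinuousAt (fun z : Space d => z + t n • G.e) y := by fun_prop
      have h4 : ContinuousAt (fun z => fderiv ℝ f (z + t n • G.e)) y := h2.comp_of_eq h3 rfl
      have h5 : ContinuousAt (fun z => f (z + t n • G.e)) y := h1.continuousAt.comp_of_eq h3 rfl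
      exact ((h4.clm_apply hτc.continuousAt).smul hΦ.continuous.continuousAt).add
        (h5.smul hΦ'.continuousAt)
    · intro n
      filter_upwards [hmemS] with y hy
      obtain ⟨b1, b2⟩ := hbound (t n) (ht0 n) y hy
      have b3 := hB₁ y (hSb y hy)
      have b4 := hB₂ y (hSb y hy)
      have b5 := hB₃ y (hSb y hy)
      refine (norm_add_le _ _).trans (add_le_add ?_ ?_)
      · rw [norm_smul]
        refine mul_le_mul ?_ b3 (norm_nonneg _) (mul_nonneg hC0 ((norm_nonneg _).trans b5))
        exact (ContinuousLinearMap.le_opNorm _ _).trans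
          (mul_le_mul b2 b5 (norm_nonneg _) hC0)
      · rw [norm_smul]
        exact mul_le_mul b1 b4 (norm_nonneg _) hC0
    · filter_upwards [hmemS] with y hy
      have hyc : y ∈ closure Ω := by
        simpa using (h.uniqueDiffWithinAt hy.1 hy.2).mem_closure
      have hmove : Tendsto (fun n => y + t n • G.e) atTop (𝓝 y) := by
        simpa using (htlim.smul_const G.e).const_add y
      have hev : ∀ᶠ n in atTop, y + t n • G.e ∈ Ω ∧ y + t n • G.e ∈ Metric.ball x₀ (ρ / 2) := by
        filter_upwards [hmove.eventually (Metric.isOpen_ball.mem_nhds hy.2)] with n hn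
        exact ⟨hin _ (ht0 n) y hy (h.half_subset hn), hn⟩
      have hmove' : Tendsto (fun n => y + t n • G.e) atTop
          (𝓝[closure Ω ∩ Metric.ball x₀ (ρ / 2)] y) :=
        tendsto_nhdsWithin_iff.2 ⟨hmove, hev.mono fun n hn => ⟨subset_closure hn.1, hn.2⟩⟩
      have l1 : Tendsto (fun n => fderiv ℝ f (y + t n • G.e)) atTop
          (𝓝 (fderivWithin ℝ f (closure Ω) y)) := by
        refine (((h.continuousOn_fderivWithin hΩ hf) y ⟨hyc, hy.2⟩).tendsto.comp hmove').congr' ?_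
        filter_upwards [hev] with n hn
        exact fderivWithin_of_mem_nhds (mem_of_superset (hΩ.mem_nhds hn.1) subset_closure)
      have l2 : Tendsto (fun n => f (y + t n • G.e)) atTop (𝓝 (f y)) :=
        ((hf.continuousOn y hyc).mono inter_subset_left).tendsto.comp hmove'
      have l3 : Tendsto (fun n => fderiv ℝ f (y + t n • G.e) (τ y)) atTop
          (𝓝 (fderivWithin ℝ f (closure Ω) y (τ y))) :=
        ((ContinuousLinearMap.apply ℝ ℝ (τ y)).continuous.tendsto _).comp l1
      exact (l3.smul_const _).add (l2.smul_const _)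
  exact tendsto_nhds_unique hlim (tendsto_const_nhds.congr fun n => (hFint _ (ht0 n) (htρ n)).symm)

end IsChart

/-! ### Integration by parts for traces -/

section Limits

variable {α : Type*} [MeasurableSpace α] {μ : Measure α}

theorem MeasureTheory.MemLp.bounded_mul {κ : α → ℝ} {B : ℝ} (hκm : AEStronglyMeasurable κ μ)
    (hκ : ∀ᵐ x ∂μ, |κ x| ≤ B) {a : α → ℂ} (ha : MemLp a 2 μ) :
    MemLp (fun x => (κ x : ℂ) * a x) 2 μ := by
  refine ha.of_le_mul (c := B)
    ((Complex.continuous_ofReal.comp_aestronglyMeasurable hκm).mul ha.1) ?_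
  filter_upwards [hκ] with x hx
  rw [norm_mul, Complex.norm_real]
  exact mul_le_mul_of_nonneg_right hx (norm_nonneg _)

theorem integrable_mul_star {κ : α → ℝ} {B : ℝ} (hκm : AEStronglyMeasurable κ μ)
    (hκ : ∀ᵐ x ∂μ, |κ x| ≤ B) {a c : α → ℂ} (ha : MemLp a 2 μ) (hc : MemLp c 2 μ) :
    Integrable (fun x => (κ x : ℂ) * (a x * star (c x))) μ := by
  have h1 := (ha.bounded_mul hκm hκ).integrable_mul hc.star
  refine h1.congr (Eventually.of_forall fun x => ?_)
  simp [mul_assoc]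

/-- The integral of a product is continuous with respect to convergence in `L²` of the factors. -/
theorem tendsto_integral_mul_star {κ : α → ℝ} {B : ℝ} (hκm : AEStronglyMeasurable κ μ)
    (hκ : ∀ᵐ x ∂μ, |κ x| ≤ B) {a c : α → ℂ} (ha : MemLp a 2 μ) (hc : MemLp c 2 μ)
    {A C : ℕ → α → ℂ} (hA : ∀ k, MemLp (A k) 2 μ) (hC : ∀ k, MemLp (C k) 2 μ)
    (hAa : Tendsto (fun k => eLpNorm (A k - a) 2 μ) atTop (𝓝 0))
    (hCc : Tendsto (fun k => eLpNorm (C k - c) 2 μ) atTop (𝓝 0)) :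
    Tendsto (fun k => ∫ x, (κ x : ℂ) * (A k x * star (C k x)) ∂μ) atTop
      (𝓝 (∫ x, (κ x : ℂ) * (a x * star (c x)) ∂μ)) := by
  have hinner : ∀ {f g : α → ℂ} (hf : MemLp f 2 μ) (hg : MemLp g 2 μ),
      inner ℂ (hg.toLp g) ((hf.bounded_mul hκm hκ).toLp _)
        = ∫ x, (κ x : ℂ) * (f x * star (g x)) ∂μ := by
    intro f g hf hg
    rw [L2.inner_def]
    refine integral_congr_ae ?_
    filter_upwards [hg.coeFn_toLp, (hf.bounded_mul hκm hκ).coeFn_toLp] with x hx1 hx2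
    rw [hx1, hx2, RCLike.inner_apply, mul_assoc]
    rfl
  have h1 : Tendsto (fun k => eLpNorm ((fun x => (κ x : ℂ) * A k x) - fun x => (κ x : ℂ) * a x) 2 μ)
      atTop (𝓝 0) := by
    have h2 := ENNReal.Tendsto.const_mul (a := ENNReal.ofReal B) hAa (Or.inr ENNReal.ofReal_ne_top)
    rw [mul_zero] at h2
    refine tendsto_of_tendsto_of_tendsto_of_le_of_le tendsto_const_nhds h2 (fun _ => bot_le)
      fun k => ?_
    refine eLpNorm_le_mul_eLpNorm_of_ae_le_mul ?_ 2
    filter_upwards [hκ] with x hx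
    rw [Pi.sub_apply, Pi.sub_apply, ← mul_sub, norm_mul, Complex.norm_real]
    exact mul_le_mul_of_nonneg_right hx (norm_nonneg _)
  have h2 := (Lp.tendsto_Lp_iff_tendsto_eLpNorm'' _ (fun k => (hA k).bounded_mul hκm hκ) _
    (ha.bounded_mul hκm hκ)).2 h1
  have h3 := (Lp.tendsto_Lp_iff_tendsto_eLpNorm'' _ hC _ hc).2 hCc
  have h4 := h3.inner (𝕜 := ℂ) h2
  rw [hinner ha hc] at h4
  exact h4.congr fun k => hinner (hA k) (hC k)

end Limits

/-- The functions `a` and `Ga` on `Γ` are the traces of a function on `Ω` and of its weak gradient,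
with enough regularity for the traces to exist. -/
def HasTraceGradient (Ω Γ : Set (Space d)) (a : Space d → ℂ) (Ga : Space d → Fin d → ℂ) : Prop :=
  ∃ (u : Space d → ℂ) (g : Fin d → Space d → ℂ), HasTraceRegularity Ω u ∧ IsTrace Ω Γ u a ∧
    ∀ i, IsWeakPartial Ω i u (g i) ∧ HasTraceRegularity Ω (g i) ∧ IsTrace Ω Γ (g i) fun x => Ga x i

namespace IsSmoothPiece

variable {Ω Γ : Set (Space d)}

/-- Near a point of `Γ`, a function and its gradient are approximated in `L²(Γ)` by a smooth
function and its gradient. -/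
theorem exists_approx (hΓ : IsSmoothPiece Ω Γ) {G : GraphData d} {x₀ : Space d} {ρ : ℝ}
    (h : IsChart G Ω Γ x₀ ρ) {a : Space d → ℂ} {Ga : Space d → Fin d → ℂ}
    (ha : HasTraceGradient Ω Γ a Ga) :
    ∃ U : ℕ → Space d → ℂ, (∀ k, ContDiff ℝ ∞ (U k)) ∧
      Tendsto (fun k => eLpNorm (U k - a) 2 (surface (Γ ∩ Metric.ball x₀ (ρ / 2)))) atTop (𝓝 0) ∧
      ∀ i, Tendsto (fun k => eLpNorm ((fun x => fderiv ℝ (U k) x (EuclideanSpace.single i 1))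
        - fun x => Ga x i) 2 (surface (Γ ∩ Metric.ball x₀ (ρ / 2)))) atTop (𝓝 0) := by
  obtain ⟨u, g, hu, hua, hg⟩ := ha
  obtain ⟨M, r₀, hcone⟩ := h.exists_coneCondition
  have hM := hcone.two_le
  have hr₀ := hcone.pos
  set r : ℕ → ℝ := fun k => r₀ / 2 * (1 / (M + 1)) ^ k with hr
  have hr0 : ∀ k, 0 < r k := fun k => by simp only [hr]; positivity
  have hrlt : ∀ k, r k < r₀ := fun k => by
    have h1 : (1 / (M + 1)) ^ k ≤ 1 := pow_le_one₀ (by positivity)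
      ((div_le_one (by positivity)).2 (by linarith))
    simp only [hr]
    nlinarith
  have hui := hu.1.integrableOn hΓ.isBounded
  refine ⟨fun k => coneMean Ω G.e M (r k) u, fun k => ?_, hΓ.tendsto_coneMean h hcone hu hua,
    fun i => ?_⟩
  · exact (hasFDerivAt_smear (contDiff_coneKernel G.e M _)
      (hasCompactSupport_coneKernel G.e M (hr0 k)) hΓ.isOpen.measurableSet hui).1
  · refine (hΓ.tendsto_coneMean h hcone (hg i).2.1 (hg i).2.2).congr fun k => eLpNorm_congr_ae ?_
    have hm : ∀ᵐ x ∂surface (Γ ∩ Metric.ball x₀ (ρ / 2)), x ∈ Γ ∩ Metric.ball x₀ (ρ / 2) :=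
      ae_restrict_mem (hΓ.measurableSet.inter Metric.isOpen_ball.measurableSet)
    filter_upwards [hm] with x hx
    rw [Pi.sub_apply, Pi.sub_apply]
    congr 1
    refine (fderiv_smear_of_weakPartial (contDiff_coneKernel G.e M _)
      (hasCompactSupport_coneKernel G.e M (hr0 k)) hΓ.isOpen hui (hg i).1 fun y hy => ?_).symm
    refine hcone.ball_subset x hx (r k) (hr0 k) (hrlt k) ?_
    have h1 := norm_sub_le_of_mem_tsupport G.e M (hr0 k) hy
    rw [Metric.mem_ball, dist_eq_norm, ← sub_sub]
    linarith [hr0 k]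

end IsSmoothPiece

/-- The value at a boundary point with normal `ν` of `(ν_i ∂_j - ν_j ∂_i)(f a \bar c)`, from the
values and the gradients of the three factors. -/
noncomputable def rotForm (ν : Space d) (i j : Fin d) (f : ℝ) (Df : Space d →L[ℝ] ℝ) (a : ℂ)
    (Ga : Fin d → ℂ) (c : ℂ) (Gc : Fin d → ℂ) : ℂ :=
  (Df (rot ν (EuclideanSpace.single i 1) (EuclideanSpace.single j 1)) : ℂ) * (a * star c)
    + ((f * ν i : ℝ) : ℂ) * (Ga j * star c) + ((f * ν i : ℝ) : ℂ) * (a * star (Gc j))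
    - ((f * ν j : ℝ) : ℂ) * (Ga i * star c) - ((f * ν j : ℝ) : ℂ) * (a * star (Gc i))

theorem fderiv_mul_star_rot {U W : Space d → ℂ} {y : Space d} (hU : DifferentiableAt ℝ U y)
    (hW : DifferentiableAt ℝ W y) (ν : Space d) (i j : Fin d) (f : ℝ) (Df : Space d →L[ℝ] ℝ) :
    Df (rot ν (EuclideanSpace.single i 1) (EuclideanSpace.single j 1)) • (U y * star (W y))
      + f • fderiv ℝ (fun y => U y * star (W y)) y
        (rot ν (EuclideanSpace.single i 1) (EuclideanSpace.single j 1))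
      = rotForm ν i j f Df (U y) (fun l => fderiv ℝ U y (EuclideanSpace.single l 1)) (W y)
        (fun l => fderiv ℝ W y (EuclideanSpace.single l 1)) := by
  have h1 : HasFDerivAt (fun y => U y * star (W y)) _ y := hU.hasFDerivAt.mul hW.hasFDerivAt.star
  rw [h1.fderiv]
  simp only [rotForm, rot, map_sub, map_smul, _root_.add_apply, _root_.smul_apply,
    ContinuousLinearMap.comp_apply, EuclideanSpace.inner_single_right, smul_eq_mul,
    Complex.real_smul]
  simp
  ring

namespace IsSmoothPiece

variable {Ω Γ : Set (Space d)}

/-- Integration by parts in a chart: the identity for smooth functions passes to the limit, as the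
coefficients of the five products are bounded. -/
theorem integral_rotForm_chart (hΓ : IsSmoothPiece Ω Γ) {G : GraphData d} {x₀ : Space d} {ρ : ℝ}
    (h : IsChart G Ω Γ x₀ ρ) {f : Space d → ℝ} (hf : ContDiffOn ℝ 1 f (closure Ω))
    (hfs : tsupport f ⊆ Metric.ball x₀ (ρ / 4)) {a c : Space d → ℂ} {Ga Gc : Space d → Fin d → ℂ}
    (ha : HasTraceGradient Ω Γ a Ga) (hc : HasTraceGradient Ω Γ c Gc) (i j : Fin d) :
    Integrable (fun x => rotForm (G.normal x) i j (f x) (fderivWithin ℝ f (closure Ω) x) (a x)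
        (Ga x) (c x) (Gc x)) (surface (Γ ∩ Metric.ball x₀ (ρ / 2))) ∧
    ∫ x, rotForm (G.normal x) i j (f x) (fderivWithin ℝ f (closure Ω) x) (a x)
        (Ga x) (c x) (Gc x) ∂surface (Γ ∩ Metric.ball x₀ (ρ / 2)) = 0 := by
  obtain ⟨U, hU, hUa, hUG⟩ := hΓ.exists_approx h ha
  obtain ⟨W, hW, hWc, hWG⟩ := hΓ.exists_approx h hc
  obtain ⟨u, gu, -, hua, hgu⟩ := ha
  obtain ⟨w, gw, -, hwc, hgw⟩ := hc
  have hfin := h.isFiniteMeasure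
  set S := Γ ∩ Metric.ball x₀ (ρ / 2) with hS
  have hSm : MeasurableSet S := hΓ.measurableSet.inter Metric.isOpen_ball.measurableSet
  have hmemS : ∀ᵐ x ∂surface S, x ∈ S := ae_restrict_mem hSm
  have hle : surface S ≤ surface Γ := surface_mono inter_subset_left
  have hSc : S ⊆ closure Ω ∩ Metric.ball x₀ (ρ / 2) := fun x hx =>
    ⟨hΓ.subset_closure hx.1, hx.2⟩
  have ma : MemLp a 2 (surface S) := hua.1.mono_measure hle
  have mc : MemLp c 2 (surface S) := hwc.1.mono_measure hle
  have mGa : ∀ l, MemLp (fun x => Ga x l) 2 (surface S) := fun l => (hgu l).2.2.1.mono_measure hle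
  have mGc : ∀ l, MemLp (fun x => Gc x l) 2 (surface S) := fun l => (hgw l).2.2.1.mono_measure hle
  have hcontmem : ∀ {φ : Space d → ℂ}, Continuous φ → MemLp φ 2 (surface S) := by
    intro φ hφ
    obtain ⟨B, hB⟩ := (isCompact_closedBall x₀ ρ).exists_bound_of_continuousOn hφ.continuousOn
    refine MemLp.of_bound hφ.aestronglyMeasurable B (hmemS.mono fun x hx => hB x ?_)
    exact Metric.ball_subset_closedBall (h.half_subset hx.2)
  have mU := fun k => hcontmem (hU k).continuous
  have mW := fun k => hcontmem (hW k).continuous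
  have mU' : ∀ l k, MemLp (fun x => fderiv ℝ (U k) x (EuclideanSpace.single l 1)) 2 (surface S) :=
    fun l k => hcontmem (((hU k).continuous_fderiv (by simp)).clm_apply continuous_const)
  have mW' : ∀ l k, MemLp (fun x => fderiv ℝ (W k) x (EuclideanSpace.single l 1)) 2 (surface S) :=
    fun l k => hcontmem (((hW k).continuous_fderiv (by simp)).clm_apply continuous_const)
  -- the coefficients are bounded and measurable
  have hnc : Continuous G.normal := by
    have h1 := G.continuous_jac.inv₀ fun y => (G.jac_pos y).ne'
    exact h1.smul (G.continuous_slope.sub continuous_const)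
  obtain ⟨C, hC0, hC⟩ := h.exists_fderivWithin_bound hΓ.isOpen hf hfs
  set τ : Space d → Space d := fun x =>
    rot (G.normal x) (EuclideanSpace.single i 1) (EuclideanSpace.single j 1) with hτ
  have hτc : Continuous τ := by simp only [hτ, rot]; fun_prop
  obtain ⟨B, hB⟩ := (isCompact_closedBall x₀ ρ).exists_bound_of_continuousOn hτc.continuousOn
  have hκ₁m : AEStronglyMeasurable (fun x => fderivWithin ℝ f (closure Ω) x (τ x)) (surface S) :=
    (((h.continuousOn_fderivWithin hΓ.isOpen hf).mono hSc).clm_apply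
      hτc.continuousOn).aestronglyMeasurable hSm
  have hκ₁ : ∀ᵐ x ∂surface S, |fderivWithin ℝ f (closure Ω) x (τ x)| ≤ C * B := by
    filter_upwards [hmemS] with x hx
    exact (ContinuousLinearMap.le_opNorm _ _).trans (mul_le_mul (hC x (hSc hx).1).2
      (hB x (Metric.ball_subset_closedBall (h.half_subset hx.2))) (norm_nonneg _) hC0)
  have hκm : ∀ l, AEStronglyMeasurable (fun x => f x * G.normal x l) (surface S) := fun l =>
    ((hf.continuousOn.mono fun x hx => (hSc hx).1).mul
      ((EuclideanSpace.proj l).continuous.comp hnc).continuousOn).aestronglyMeasurable hSm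
  have hκ : ∀ l, ∀ᵐ x ∂surface S, |f x * G.normal x l| ≤ C := by
    intro l
    filter_upwards [hmemS] with x hx
    rw [abs_mul]
    have h1 : |G.normal x l| ≤ 1 := by
      rw [← G.norm_normal x]
      exact PiLp.norm_apply_le (G.normal x) l
    have h2 : |f x| ≤ C := (hC x (hSc hx).1).1
    calc _ ≤ C * 1 := mul_le_mul h2 h1 (abs_nonneg _) hC0
      _ = C := mul_one C
  -- the integral is the sum of five integrals of products
  have hsum : ∀ {a c : Space d → ℂ} {Ga Gc : Space d → Fin d → ℂ}, MemLp a 2 (surface S) →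
      MemLp c 2 (surface S) → (∀ l, MemLp (fun x => Ga x l) 2 (surface S)) →
      (∀ l, MemLp (fun x => Gc x l) 2 (surface S)) →
      Integrable (fun x => rotForm (G.normal x) i j (f x) (fderivWithin ℝ f (closure Ω) x) (a x)
        (Ga x) (c x) (Gc x)) (surface S) ∧
      ∫ x, rotForm (G.normal x) i j (f x) (fderivWithin ℝ f (closure Ω) x) (a x)
        (Ga x) (c x) (Gc x) ∂surface S
        = ∫ x, (fderivWithin ℝ f (closure Ω) x (τ x) : ℂ) * (a x * star (c x)) ∂surface S
          + ∫ x, ((f x * G.normal x i : ℝ) : ℂ) * (Ga x j * star (c x)) ∂surface S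
          + ∫ x, ((f x * G.normal x i : ℝ) : ℂ) * (a x * star (Gc x j)) ∂surface S
          - ∫ x, ((f x * G.normal x j : ℝ) : ℂ) * (Ga x i * star (c x)) ∂surface S
          - ∫ x, ((f x * G.normal x j : ℝ) : ℂ) * (a x * star (Gc x i)) ∂surface S := by
    intro a c Ga Gc ma mc mGa mGc
    have i1 := integrable_mul_star hκ₁m hκ₁ ma mc
    have i2 := integrable_mul_star (hκm i) (hκ i) (mGa j) mc
    have i3 := integrable_mul_star (hκm i) (hκ i) ma (mGc j)
    have i4 := integrable_mul_star (hκm j) (hκ j) (mGa i) mc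
    have i5 := integrable_mul_star (hκm j) (hκ j) ma (mGc i)
    refine ⟨(((i1.add i2).add i3).sub i4).sub i5, ?_⟩
    exact (integral_sub (((i1.add i2).add i3).sub i4) i5).trans (congrArg (· - _)
      ((integral_sub ((i1.add i2).add i3) i4).trans (congrArg (· - _)
        ((integral_add (i1.add i2) i3).trans (congrArg (· + _) (integral_add i1 i2))))))
  refine ⟨(hsum ma mc mGa mGc).1, ?_⟩
  have hzero : ∀ k, ∫ x, rotForm (G.normal x) i j (f x) (fderivWithin ℝ f (closure Ω) x) (U k x)
      (fun l => fderiv ℝ (U k) x (EuclideanSpace.single l 1)) (W k x)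
      (fun l => fderiv ℝ (W k) x (EuclideanSpace.single l 1)) ∂surface S = 0 := by
    intro k
    have hUk : ContDiff ℝ 1 (U k) := (hU k).of_le (by exact_mod_cast le_top)
    have hWk : ContDiff ℝ 1 (W k) := (hW k).of_le (by exact_mod_cast le_top)
    have hΦ : ContDiff ℝ 1 fun y => U k y * star (W k y) :=
      hUk.mul ((starL' ℝ : ℂ ≃L[ℝ] ℂ).contDiff.comp hWk)
    rw [← h.integral_rot_smul hΓ.isOpen hΓ.measurableSet hf hfs hΦ (EuclideanSpace.single i 1)
      (EuclideanSpace.single j 1)]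
    refine integral_congr_ae (Eventually.of_forall fun x => ?_)
    exact (fderiv_mul_star_rot (hUk.differentiable one_ne_zero x)
      (hWk.differentiable one_ne_zero x) _ i j _ _).symm
  have l1 := tendsto_integral_mul_star hκ₁m hκ₁ ma mc mU mW hUa hWc
  have l2 := tendsto_integral_mul_star (hκm i) (hκ i) (mGa j) mc (mU' j) mW (hUG j) hWc
  have l3 := tendsto_integral_mul_star (hκm i) (hκ i) ma (mGc j) mU (mW' j) hUa (hWG j)
  have l4 := tendsto_integral_mul_star (hκm j) (hκ j) (mGa i) mc (mU' i) mW (hUG i) hWc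
  have l5 := tendsto_integral_mul_star (hκm j) (hκ j) ma (mGc i) mU (mW' i) hUa (hWG i)
  rw [(hsum ma mc mGa mGc).2]
  refine tendsto_nhds_unique ((((l1.add l2).add l3).sub l4).sub l5)
    (tendsto_const_nhds.congr fun k => ?_)
  rw [← hzero k]
  exact (hsum (mU k) (mW k) (fun l => mU' l k) (fun l => mW' l k)).2

end IsSmoothPiece

theorem IsChart.height_eq_zero {G : GraphData d} {Ω Γ : Set (Space d)} {x₀ : Space d} {ρ : ℝ}
    (h : IsChart G Ω Γ x₀ ρ) (hx : x₀ ∈ Γ) : G.height x₀ = 0 :=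
  (h.mem_surf x₀ (Metric.mem_ball_self h.pos)).1 hx

namespace IsSmoothPiece

variable {Ω Γ : Set (Space d)}

theorem norm_outwardNormal (hΓ : IsSmoothPiece Ω Γ) {x : Space d} (hx : x ∈ Γ) :
    ‖outwardNormal Ω x‖ = 1 := by
  obtain ⟨G, ρ, h⟩ := hΓ.exists_chart x hx
  rw [h.outwardNormal_eq hx (Metric.mem_ball_self h.pos), G.norm_normal]

theorem uniqueDiffWithinAt (hΓ : IsSmoothPiece Ω Γ) {x : Space d} (hx : x ∈ Γ) :
    UniqueDiffWithinAt ℝ (closure Ω) x := by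
  obtain ⟨G, ρ, h⟩ := hΓ.exists_chart x hx
  exact h.uniqueDiffWithinAt hx (Metric.mem_ball_self (half_pos h.pos))

/-- The tangential derivatives of a function that is constant on `Γ` vanish. -/
theorem fderiv_rot_eq_zero (hΓ : IsSmoothPiece Ω Γ) {F : Type*} [NormedAddCommGroup F]
    [NormedSpace ℝ F] {φ : Space d → F} {c : F} (hc : ∀ y ∈ Γ, φ y = c) {x : Space d} (hx : x ∈ Γ)
    (hφ : DifferentiableAt ℝ φ x) (p q : Space d) :
    fderiv ℝ φ x (rot (outwardNormal Ω x) p q) = 0 := by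
  obtain ⟨G, ρ, h⟩ := hΓ.exists_chart x hx
  rw [h.outwardNormal_eq hx (Metric.mem_ball_self h.pos)]
  refine G.fderiv_eq_zero_of_eqOn (c := c) (h.height_eq_zero hx) hφ ?_ (inner_rot _ p q)
  filter_upwards [Metric.ball_mem_nhds x h.pos] with y hy h0
  exact hc y ((h.mem_surf y hy).2 h0)

/-- **Integration by parts on `Γ`**: the operators `n_i ∂_j - n_j ∂_i` have mean value zero. The
local formulas are added up with a partition of unity, whose tangential derivatives cancel. -/
theorem integral_rotForm (hΓ : IsSmoothPiece Ω Γ) {m : Space d → ℝ}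
    (hm : ContDiffOn ℝ 1 m (closure Ω)) {a c : Space d → ℂ} {Ga Gc : Space d → Fin d → ℂ}
    (ha : HasTraceGradient Ω Γ a Ga) (hc : HasTraceGradient Ω Γ c Gc) (i j : Fin d) :
    Integrable (fun x => rotForm (outwardNormal Ω x) i j (m x) (fderivWithin ℝ m (closure Ω) x)
      (a x) (Ga x) (c x) (Gc x)) (surface Γ) ∧
    ∫ x, rotForm (outwardNormal Ω x) i j (m x) (fderivWithin ℝ m (closure Ω) x)
      (a x) (Ga x) (c x) (Gc x) ∂surface Γ = 0 := by
  choose! G ρ hch using hΓ.exists_chart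
  obtain ⟨t, χ, htΓ, hχ, hχ1⟩ := exists_smooth_partition hΓ.isCompact
    (fun x => Metric.ball x (ρ x / 4)) fun x hx =>
      ⟨Metric.isOpen_ball, Metric.mem_ball_self (by linarith [(hch x hx).pos])⟩
  set f : Space d → Space d → ℝ := fun x y => χ x y * m y with hf
  have hfts : ∀ x ∈ t, tsupport (f x) ⊆ Metric.ball x (ρ x / 4) := fun x hx =>
    tsupport_mul_subset_left.trans (hχ x hx).2
  have hfd : ∀ x ∈ t, ContDiffOn ℝ 1 (f x) (closure Ω) := fun x hx =>
    (((hχ x hx).1.of_le (by exact_mod_cast le_top)).contDiffOn).mul hm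
  set R : Space d → Space d → ℂ := fun x y => rotForm (outwardNormal Ω y) i j (f x y)
    (fderivWithin ℝ (f x) (closure Ω) y) (a y) (Ga y) (c y) (Gc y) with hR
  -- the local formulas
  have hloc : ∀ x ∈ t, Integrable (R x) (surface Γ) ∧ ∫ y, R x y ∂surface Γ = 0 := by
    intro x hx
    have hc' := hch x (htΓ x hx)
    obtain ⟨h1, h2⟩ := hΓ.integral_rotForm_chart hc' (hfd x hx) (hfts x hx) ha hc i j
    have hSm : MeasurableSet (Γ ∩ Metric.ball x (ρ x / 2)) :=
      hΓ.measurableSet.inter Metric.isOpen_ball.measurableSet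
    have heq : ∀ᵐ y ∂surface (Γ ∩ Metric.ball x (ρ x / 2)), rotForm ((G x (htΓ x hx)).normal y) i j
        (f x y) (fderivWithin ℝ (f x) (closure Ω) y) (a y) (Ga y) (c y) (Gc y) = R x y := by
      have hmem : ∀ᵐ y ∂surface (Γ ∩ Metric.ball x (ρ x / 2)), y ∈ Γ ∩ Metric.ball x (ρ x / 2) :=
        ae_restrict_mem hSm
      filter_upwards [hmem] with y hy
      simp only [hR]
      rw [hc'.outwardNormal_eq hy.1 (hc'.half_subset hy.2)]
    have hout : ∀ y ∈ Γ \ (Γ ∩ Metric.ball x (ρ x / 2)), R x y = 0 := by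
      rintro y ⟨hy, hyS⟩
      have hyf : y ∉ tsupport (f x) := fun hmem =>
        hyS ⟨hy, hc'.quarter_subset (hfts x hx hmem)⟩
      have h0 : f x =ᶠ[𝓝[closure Ω] y] fun _ => 0 := by
        refine mem_nhdsWithin_of_mem_nhds ?_
        filter_upwards [(isClosed_tsupport (f x)).isOpen_compl.mem_nhds hyf] with z hz
        exact image_eq_zero_of_notMem_tsupport hz
      simp only [hR]
      rw [h0.fderivWithin_eq (image_eq_zero_of_notMem_tsupport hyf),
        image_eq_zero_of_notMem_tsupport hyf]
      simp [rotForm]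
    have h3 : IntegrableOn (R x) (Γ ∩ Metric.ball x (ρ x / 2))
        (Measure.euclideanHausdorffMeasure (d - 1)) := h1.congr heq
    refine ⟨h3.of_forall_sdiff_eq_zero hΓ.measurableSet hout, ?_⟩
    refine (setIntegral_eq_of_subset_of_forall_sdiff_eq_zero hΓ.measurableSet inter_subset_left
      hout).trans ?_
    exact (integral_congr_ae heq).symm.trans h2
  have hsum : ∀ y ∈ Γ, ∑ x ∈ t, R x y = rotForm (outwardNormal Ω y) i j (m y)
      (fderivWithin ℝ m (closure Ω) y) (a y) (Ga y) (c y) (Gc y) := by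
    intro y hy
    have hud := hΓ.uniqueDiffWithinAt hy
    set τ := rot (outwardNormal Ω y) (EuclideanSpace.single i 1) (EuclideanSpace.single j 1) with hτ
    have hχd : ∀ x ∈ t, DifferentiableAt ℝ (χ x) y := fun x hx =>
      (hχ x hx).1.differentiable (by simp) y
    have hD : ∀ x ∈ t, fderivWithin ℝ (f x) (closure Ω) y τ
        = χ x y * fderivWithin ℝ m (closure Ω) y τ + m y * fderiv ℝ (χ x) y τ := by
      intro x hx
      have h1 : DifferentiableWithinAt ℝ m (closure Ω) y :=
        (hm.differentiableOn one_ne_zero) y (hΓ.subset_closure hy)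
      simp only [hf]
      rw [fderivWithin_fun_mul hud (hχd x hx).differentiableWithinAt h1,
        (hχd x hx).fderivWithin hud]
      rfl
    have hzero : ∑ x ∈ t, fderiv ℝ (χ x) y τ = 0 := by
      have h1 := hΓ.fderiv_rot_eq_zero (φ := fun z => ∑ x ∈ t, χ x z) hχ1 hy
        (DifferentiableAt.fun_sum hχd) (EuclideanSpace.single i 1) (EuclideanSpace.single j 1)
      rw [fderiv_fun_sum hχd] at h1
      simpa using h1
    have s1 : ∑ x ∈ t, fderivWithin ℝ (f x) (closure Ω) y τ = fderivWithin ℝ m (closure Ω) y τ := by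
      rw [Finset.sum_congr rfl hD, Finset.sum_add_distrib, ← Finset.sum_mul, ← Finset.mul_sum,
        hzero, hχ1 y hy]
      ring
    have s2 : ∑ x ∈ t, f x y = m y := by
      simp only [hf]
      rw [← Finset.sum_mul, hχ1 y hy, one_mul]
    simp only [hR, rotForm, Finset.sum_sub_distrib, Finset.sum_add_distrib, ← Finset.sum_mul,
      ← Complex.ofReal_sum, ← hτ, s1, s2]
  have hae : ∀ᵐ y ∂surface Γ, ∑ x ∈ t, R x y = rotForm (outwardNormal Ω y) i j (m y)
      (fderivWithin ℝ m (closure Ω) y) (a y) (Ga y) (c y) (Gc y) :=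
    hΓ.ae_mem.mono hsum
  refine ⟨(integrable_finsetSum t fun x hx => (hloc x hx).1).congr hae, ?_⟩
  rw [← integral_congr_ae hae, integral_finsetSum t fun x hx => (hloc x hx).1]
  exact Finset.sum_eq_zero fun x hx => (hloc x hx).2

end IsSmoothPiece

/-! ### The algebra of the tangential divergence -/

theorem rotForm_eq (ν : Space d) (i j : Fin d) (f : ℝ) (Df : Space d →L[ℝ] ℝ) (a : ℂ)
    (Ga : Fin d → ℂ) (c : ℂ) (Gc : Fin d → ℂ) : rotForm ν i j f Df a Ga c Gc
      = (ν i : ℂ) * ((Df (EuclideanSpace.single j 1) : ℂ) * (a * star c)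
          + (f : ℂ) * (Ga j * star c) + (f : ℂ) * (a * star (Gc j)))
        - (ν j : ℂ) * ((Df (EuclideanSpace.single i 1) : ℂ) * (a * star c)
          + (f : ℂ) * (Ga i * star c) + (f : ℂ) * (a * star (Gc i))) := by
  simp only [rotForm, rot, map_sub, map_smul, EuclideanSpace.inner_single_right, smul_eq_mul]
  simp
  ring

/-- Subtracting from `a` the combination `∑ l, p l * a' l`, with the product rule for gradients. -/
theorem rotForm_sub_sum (ν : Space d) (i j : Fin d) (f : ℝ) (Df : Space d →L[ℝ] ℝ) (a : ℂ)
    (Ga : Fin d → ℂ) (c : ℂ) (Gc : Fin d → ℂ) (p : Fin d → ℝ) (Dp : Fin d → Space d →L[ℝ] ℝ)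
    (a' : Fin d → ℂ) (Ga' : Fin d → Fin d → ℂ) :
    rotForm ν i j f Df a Ga c Gc
        - ∑ l, rotForm ν i j (f * p l) (f • Dp l + p l • Df) (a' l) (Ga' l) c Gc
      = rotForm ν i j f Df (a - ∑ l, (p l : ℂ) * a' l) (fun q => Ga q - ∑ l, ((p l : ℂ) * Ga' l q
          + (Dp l (EuclideanSpace.single q 1) : ℂ) * a' l)) c Gc := by
  have h : ∀ l, rotForm ν i j (f * p l) (f • Dp l + p l • Df) (a' l) (Ga' l) c Gc
      = rotForm ν i j f Df ((p l : ℂ) * a' l) (fun q => (p l : ℂ) * Ga' l q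
          + (Dp l (EuclideanSpace.single q 1) : ℂ) * a' l) c Gc := by
    intro l
    simp only [rotForm_eq, _root_.add_apply, _root_.smul_apply, smul_eq_mul]
    push_cast
    ring
  have h2 : ∀ (s : Finset (Fin d)) (z : Fin d → ℂ) (Z : Fin d → Fin d → ℂ),
      ∑ l ∈ s, rotForm ν i j f Df (z l) (Z l) c Gc
        = rotForm ν i j f Df (∑ l ∈ s, z l) (fun q => ∑ l ∈ s, Z l q) c Gc := by
    intro s z Z
    simp only [rotForm, Finset.sum_sub_distrib, Finset.sum_add_distrib, ← Finset.sum_mul,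
      ← Finset.mul_sum]
  rw [Finset.sum_congr rfl fun l _ => h l, h2]
  simp only [rotForm]
  ring

/-- The algebra of the tangential divergence: in `∑ i j, (n_i ∂_j - n_j ∂_i) (n_i φ T_j)`, with `T`
tangential, the derivatives of `n` drop out. -/
theorem sum_normal_curl (n T ψ : Fin d → ℂ) (dN D : Fin d → Fin d → ℂ) (φ : ℂ)
    (hn : ∑ i, n i * n i = 1) (hT : ∑ j, n j * T j = 0)
    (hs : ∀ p q, n p * (∑ i, n i * dN q i) = n q * (∑ i, n i * dN p i)) :
    ∑ i, ∑ j, (n i * (dN j i * φ * T j + n i * (ψ j * T j + φ * D j j))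
        - n j * (dN i i * φ * T j + n i * (ψ i * T j + φ * D i j)))
      = ∑ j, ψ j * T j + φ * ∑ j, (D j j - (∑ i, D i j * n i) * n j) := by
  have hsT : ∑ j, (∑ i, n i * dN j i) * T j = 0 := by
    have h1 : ∀ j, ∑ i, n i * dN j i = n j * ∑ p, n p * (∑ i, n i * dN p i) := by
      intro j
      rw [Finset.mul_sum]
      calc ∑ i, n i * dN j i = (∑ p, n p * n p) * ∑ i, n i * dN j i := by rw [hn, one_mul]
        _ = ∑ p, n p * (n p * ∑ i, n i * dN j i) := by
          rw [Finset.sum_mul]; exact Finset.sum_congr rfl fun p _ => by ring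
        _ = ∑ p, n j * (n p * ∑ i, n i * dN p i) :=
          Finset.sum_congr rfl fun p _ => by rw [hs p j]; ring
    calc ∑ j, (∑ i, n i * dN j i) * T j
        = ∑ j, (∑ p, n p * (∑ i, n i * dN p i)) * (n j * T j) :=
          Finset.sum_congr rfl fun j _ => by rw [h1 j]; ring
      _ = 0 := by rw [← Finset.mul_sum, hT, mul_zero]
  have e1 : ∑ i, ∑ j, n i * (dN j i * φ * T j) = 0 := by
    rw [Finset.sum_comm]
    calc _ = ∑ j, φ * ((∑ i, n i * dN j i) * T j) := by
          refine Finset.sum_congr rfl fun j _ => ?_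
          rw [Finset.sum_mul, Finset.mul_sum]
          exact Finset.sum_congr rfl fun i _ => by ring
      _ = 0 := by rw [← Finset.mul_sum, hsT, mul_zero]
  have e2 : ∑ i, ∑ j, n i * (n i * (ψ j * T j + φ * D j j))
      = ∑ j, ψ j * T j + φ * ∑ j, D j j := by
    calc _ = ∑ i, n i * n i * ∑ j, (ψ j * T j + φ * D j j) := by
          refine Finset.sum_congr rfl fun i _ => ?_
          rw [Finset.mul_sum]
          exact Finset.sum_congr rfl fun j _ => by ring
      _ = _ := by rw [← Finset.sum_mul, hn, one_mul, Finset.sum_add_distrib, Finset.mul_sum]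
  have e3 : ∑ i, ∑ j, n j * (dN i i * φ * T j + n i * (ψ i * T j))
      = 0 := by
    refine Finset.sum_eq_zero fun i _ => ?_
    calc _ = ∑ j, (dN i i * φ + n i * ψ i) * (n j * T j) :=
          Finset.sum_congr rfl fun j _ => by ring
      _ = 0 := by rw [← Finset.mul_sum, hT, mul_zero]
  have e4 : ∑ i, ∑ j, n j * (n i * (φ * D i j)) = φ * ∑ j, (∑ i, D i j * n i) * n j := by
    rw [Finset.sum_comm, Finset.mul_sum]
    refine Finset.sum_congr rfl fun j _ => ?_
    rw [Finset.sum_mul, Finset.mul_sum]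
    exact Finset.sum_congr rfl fun i _ => by ring
  calc _ = ∑ i, ∑ j, n i * (dN j i * φ * T j)
        + ∑ i, ∑ j, n i * (n i * (ψ j * T j + φ * D j j))
        - ∑ i, ∑ j, n j * (dN i i * φ * T j + n i * (ψ i * T j))
        - ∑ i, ∑ j, n j * (n i * (φ * D i j)) := by
        simp only [← Finset.sum_add_distrib, ← Finset.sum_sub_distrib]
        exact Finset.sum_congr rfl fun i _ => Finset.sum_congr rfl fun j _ => by ring
    _ = _ := by rw [e1, e2, e3, e4, Finset.sum_sub_distrib]; ring

/-- The values of `rotForm` in the direction of a product `n_i h_k`, added up. -/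
theorem sum_rotForm_normal (ν : Space d) (H : Fin d → ℝ) (DN DH : Fin d → Space d →L[ℝ] ℝ)
    (T w : Fin d → ℂ) (D W : Fin d → Fin d → ℂ) (hν : ‖ν‖ = 1) (hT : ∑ j, (ν j : ℂ) * T j = 0)
    (hs : ∀ p q, ∑ i, ν i * DN i (rot ν p q) = 0) :
    ∑ i, ∑ j, ∑ k, rotForm ν i j (ν i * H k) (ν i • DH k + H k • DN i) (T j) (fun q => D q j) (w k)
        (fun q => W q k)
      = ∑ j, (∑ k, ((DH k (EuclideanSpace.single j 1) : ℂ) * star (w k)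
          + (H k : ℂ) * star (W j k))) * T j
        + (∑ k, (H k : ℂ) * star (w k)) * ∑ j, (D j j - (∑ i, D i j * ν i) * ν j) := by
  rw [← sum_normal_curl (fun i => (ν i : ℂ)) T
    (fun q => ∑ k, ((DH k (EuclideanSpace.single q 1) : ℂ) * star (w k) + (H k : ℂ) * star (W q k)))
    (fun q i => (DN i (EuclideanSpace.single q 1) : ℂ)) D (∑ k, (H k : ℂ) * star (w k)) _ hT]
  · refine Finset.sum_congr rfl fun i _ => Finset.sum_congr rfl fun j _ => ?_
    simp only [rotForm_eq, _root_.add_apply, _root_.smul_apply, smul_eq_mul, Finset.sum_mul,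
      Finset.mul_sum, ← Finset.sum_add_distrib, ← Finset.sum_sub_distrib]
    refine Finset.sum_congr rfl fun k _ => ?_
    push_cast
    ring
  · intro p q
    have h := hs (EuclideanSpace.single p 1) (EuclideanSpace.single q 1)
    have h2 : ν p * (∑ i, ν i * DN i (EuclideanSpace.single q 1))
        - ν q * (∑ i, ν i * DN i (EuclideanSpace.single p 1)) = 0 := by
      rw [← h, Finset.mul_sum, Finset.mul_sum, ← Finset.sum_sub_distrib]
      refine Finset.sum_congr rfl fun i _ => ?_
      simp only [rot, map_sub, map_smul, EuclideanSpace.inner_single_right, smul_eq_mul]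
      simp
      ring
    have h3 := congrArg Complex.ofReal (sub_eq_zero.1 h2)
    push_cast at h3
    exact h3
  · have h := EuclideanSpace.real_norm_sq_eq ν
    rw [hν] at h
    have h3 := congrArg Complex.ofReal h
    push_cast at h3
    rw [← h3.trans (Finset.sum_congr rfl fun i _ => sq _)]
    norm_num

/-! ### The tangential divergence theorem -/

/-- A `C¹` field near a compact set can be cut off to a `C¹` field on the whole space. -/
theorem exists_contDiff_eqOn_nhds {V Γ : Set (Space d)} {N : Space d → Space d} (hV : IsOpen V)
    (hΓ : IsCompact Γ) (hΓV : Γ ⊆ V) (hN : ContDiffOn ℝ 1 N V) :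
    ∃ N' : Space d → Space d, ContDiff ℝ 1 N' ∧ ∀ x ∈ Γ, N' =ᶠ[𝓝 x] N := by
  obtain ⟨χ, h0, h1, -⟩ := exists_contMDiffMap_zero_one_nhds_of_isClosed (n := 1)
    (modelWithCornersSelf ℝ (Space d)) hV.isClosed_compl hΓ.isClosed
    (disjoint_compl_left_iff_subset.2 hΓV)
  have hχ : ContDiff ℝ 1 χ := χ.contMDiff.contDiff
  refine ⟨fun y => χ y • N y, contDiff_iff_contDiffAt.2 fun x => ?_, fun x hx => ?_⟩
  · by_cases hx : x ∈ V
    · exact hχ.contDiffAt.smul (hN.contDiffAt (hV.mem_nhds hx))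
    · refine (contDiffAt_const (c := (0 : Space d))).congr_of_eventuallyEq ?_
      filter_upwards [eventually_nhdsSet_iff_forall.1 h0 x hx] with y hy
      rw [hy, zero_smul]
  · filter_upwards [eventually_nhdsSet_iff_forall.1 h1 x hx] with y hy
    rw [hy, one_smul]

theorem tangentialGradient_congr {N N' : Space d → Space d} {G : Space d → Matrix (Fin d) (Fin d) ℂ}
    {b : Space d → Fin d → ℂ} {x : Space d} (h : N' =ᶠ[𝓝 x] N) :
    tangentialGradient N' G b x = tangentialGradient N G b x := by
  have h1 : ∀ l j, fderiv ℝ (fun y => N' y l * N' y j) x = fderiv ℝ (fun y => N y l * N y j) x :=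
    fun l j => Filter.EventuallyEq.fderiv_eq (h.mono fun y hy => by simp only [hy])
  simp only [tangentialGradient, h1, h.self_of_nhds]

namespace IsSmoothPiece

variable {Ω Γ : Set (Space d)}

theorem gradC_apply (hΓ : IsSmoothPiece Ω Γ) {h : Space d → Space d}
    (hh : ContDiffOn ℝ 1 h (closure Ω)) {x : Space d} (hx : x ∈ Γ) (q k : Fin d) :
    gradC Ω h x q k
      = (fderivWithin ℝ (fun y => h y k) (closure Ω) x (EuclideanSpace.single q 1) : ℂ) := by
  have h1 : HasFDerivWithinAt h (fderivWithin ℝ h (closure Ω) x) (closure Ω) x :=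
    ((hh.differentiableOn one_ne_zero) x (hΓ.subset_closure hx)).hasFDerivWithinAt
  have h2 : HasFDerivWithinAt (fun y => h y k)
      ((EuclideanSpace.proj k : Space d →L[ℝ] ℝ) ∘L fderivWithin ℝ h (closure Ω) x)
      (closure Ω) x :=
    (EuclideanSpace.proj k : Space d →L[ℝ] ℝ).hasFDerivAt.comp_hasFDerivWithinAt x h1
  rw [h2.fderivWithin (hΓ.uniqueDiffWithinAt hx)]
  rfl

/-- The sum of the tangential derivatives `(n_i ∂_j - n_j ∂_i) (n_i φ T_j)`, where `T` is the
tangential part of `b` and `φ = ∑ k, h_k \bar b_k`, at a point of `Γ`. -/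
theorem sum_rotForm_eq (hΓ : IsSmoothPiece Ω Γ) {N h : Space d → Space d} (hN : ContDiff ℝ 1 N)
    (hNn : ∀ x ∈ Γ, N x = outwardNormal Ω x) (hh : ContDiffOn ℝ 1 h (closure Ω))
    (b : Space d → Fin d → ℂ) (G : Space d → Matrix (Fin d) (Fin d) ℂ) {x : Space d} (hx : x ∈ Γ) :
    ∑ i, ∑ j, ∑ k, (rotForm (outwardNormal Ω x) i j (N x i * h x k)
        (fderivWithin ℝ (fun y => N y i * h y k) (closure Ω) x) (b x j) (fun q => G x q j) (b x k)
        (fun q => G x q k)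
      - ∑ l, rotForm (outwardNormal Ω x) i j (N x i * h x k * (N x l * N x j))
        (fderivWithin ℝ (fun y => N y i * h y k * (N y l * N y j)) (closure Ω) x) (b x l)
        (fun q => G x q l) (b x k) (fun q => G x q k))
      = ∑ j, star ((gradC Ω h x *ᵥ b x + G x *ᵥ toC (h x)) j)
          * tangentialPart (outwardNormal Ω x) (b x) j
        + (toC (h x) ⬝ᵥ star (b x))
          * tangentialDiv (outwardNormal Ω x) (tangentialGradient N G b x) := by
  have hud := hΓ.uniqueDiffWithinAt hx
  have hn1 := hΓ.norm_outwardNormal hx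
  have hNx := hNn x hx
  set ν := outwardNormal Ω x with hν
  have hNd : ∀ i, DifferentiableAt ℝ (fun y => N y i) x := fun i =>
    ((contDiff_euclidean.1 hN) i).differentiable one_ne_zero x
  have hhd : ∀ k, DifferentiableWithinAt ℝ (fun y => h y k) (closure Ω) x := fun k =>
    ((contDiffOn_euclidean.1 hh) k).differentiableOn one_ne_zero x (hΓ.subset_closure hx)
  have hgrad := fun q k => hΓ.gradC_apply hh hx q k
  have hD1 : ∀ i k, fderivWithin ℝ (fun y => N y i * h y k) (closure Ω) x
      = N x i • fderivWithin ℝ (fun y => h y k) (closure Ω) x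
        + h x k • fderiv ℝ (fun y => N y i) x := by
    intro i k
    rw [fderivWithin_fun_mul hud (hNd i).differentiableWithinAt (hhd k), (hNd i).fderivWithin hud]
  have hD2 : ∀ i k l j, fderivWithin ℝ (fun y => N y i * h y k * (N y l * N y j)) (closure Ω) x
      = (N x i * h x k) • fderiv ℝ (fun y => N y l * N y j) x
        + (N x l * N x j) • fderivWithin ℝ (fun y => N y i * h y k) (closure Ω) x := by
    intro i k l j
    rw [fderivWithin_fun_mul hud ((hNd i).differentiableWithinAt.fun_mul (hhd k))
      ((hNd l).fun_mul (hNd j)).differentiableWithinAt, ((hNd l).fun_mul (hNd j)).fderivWithin hud]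
  have hT : ∀ j, b x j - ∑ l, ((N x l * N x j : ℝ) : ℂ) * b x l = tangentialPart ν (b x) j := by
    intro j
    simp only [tangentialPart, normalPart, normalComp, dotProduct, toC, Pi.sub_apply, Pi.smul_apply,
      smul_eq_mul, Finset.sum_mul, hNx]
    congr 1
    refine Finset.sum_congr rfl fun l _ => ?_
    push_cast
    ring
  have hDT : ∀ q j, G x q j - ∑ l, (((N x l * N x j : ℝ) : ℂ) * G x q l
      + ((fderiv ℝ (fun y => N y l * N y j) x (EuclideanSpace.single q 1) : ℝ) : ℂ) * b x l)
      = tangentialGradient N G b x q j := fun q j => rfl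
  have hnn : ∑ j, (ν j : ℂ) * ν j = 1 := by
    have h := EuclideanSpace.real_norm_sq_eq ν
    rw [hn1] at h
    have h3 := congrArg Complex.ofReal h
    push_cast at h3
    rw [← h3.trans (Finset.sum_congr rfl fun i _ => sq _)]
    norm_num
  have hnT : ∑ j, (ν j : ℂ) * tangentialPart ν (b x) j = 0 := by
    simp only [tangentialPart, normalPart, toC, Pi.sub_apply, Pi.smul_apply, smul_eq_mul, mul_sub,
      Finset.sum_sub_distrib]
    rw [sub_eq_zero]
    calc _ = normalComp ν (b x) := by
          simp only [normalComp, dotProduct, toC, mul_comm]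
      _ = normalComp ν (b x) * ∑ j, (ν j : ℂ) * ν j := by rw [hnn, mul_one]
      _ = _ := by
          rw [Finset.mul_sum]
          exact Finset.sum_congr rfl fun j _ => by ring
  -- the extension of the normal has length one on `Γ`
  have hs : ∀ p q, ∑ i, ν i * fderiv ℝ (fun y => N y i) x (rot ν p q) = 0 := by
    intro p q
    have hφ : ∀ i ∈ Finset.univ, DifferentiableAt ℝ (fun y => N y i * N y i) x :=
      fun i _ => (hNd i).mul (hNd i)
    have h1 := hΓ.fderiv_rot_eq_zero (φ := fun y => ∑ i, N y i * N y i) (c := 1) (fun y hy => by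
      rw [← one_pow 2, ← hΓ.norm_outwardNormal hy, EuclideanSpace.real_norm_sq_eq, hNn y hy]
      exact Finset.sum_congr rfl fun i _ => (sq _).symm) hx (DifferentiableAt.fun_sum hφ) p q
    rw [fderiv_fun_sum hφ, _root_.sum_apply] at h1
    simp only [fderiv_fun_mul (hNd _) (hNd _), _root_.add_apply, _root_.smul_apply, smul_eq_mul,
      ← two_mul, ← Finset.mul_sum, hNx] at h1
    simpa using h1
  simp only [hD2, rotForm_sub_sum, hT, hDT, hD1]
  simp only [hNx]
  rw [sum_rotForm_normal ν (fun k => h x k) (fun i => fderiv ℝ (fun y => N y i) x)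
    (fun k => fderivWithin ℝ (fun y => h y k) (closure Ω) x)
    (tangentialPart ν (b x)) (b x) (tangentialGradient N G b x) (G x) hn1 hnT hs]
  congr 1
  · refine Finset.sum_congr rfl fun j _ => ?_
    congr 1
    simp only [Pi.add_apply, Matrix.mulVec, dotProduct, hgrad, toC, star_add, star_sum, star_mul',
      Finset.sum_add_distrib]
    simp [mul_comm]

/-- The divergence theorem on `Γ` for the tangential field `φ T`, where `T` is the tangential part
of `b` and `φ = h · \bar b`, with the derivatives of `φ` replaced by
  the gradient of `h · \bar b`. -/
theorem integral_tangentialDiv_eq_zero (hΓ : IsSmoothPiece Ω Γ) {N h : Space d → Space d}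
    (hN : ContDiff ℝ 1 N) (hNn : ∀ x ∈ Γ, N x = outwardNormal Ω x)
    (hh : ContDiffOn ℝ 1 h (closure Ω)) {b : Space d → Fin d → ℂ}
    {G : Space d → Matrix (Fin d) (Fin d) ℂ}
    (hb : ∀ j, HasTraceGradient Ω Γ (fun x => b x j) fun x q => G x q j) :
    Integrable (fun x => ∑ j, star ((gradC Ω h x *ᵥ b x + G x *ᵥ toC (h x)) j)
          * tangentialPart (outwardNormal Ω x) (b x) j
        + (toC (h x) ⬝ᵥ star (b x))
          * tangentialDiv (outwardNormal Ω x) (tangentialGradient N G b x)) (surface Γ) ∧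
    ∫ x, (∑ j, star ((gradC Ω h x *ᵥ b x + G x *ᵥ toC (h x)) j)
          * tangentialPart (outwardNormal Ω x) (b x) j
        + (toC (h x) ⬝ᵥ star (b x))
          * tangentialDiv (outwardNormal Ω x) (tangentialGradient N G b x)) ∂surface Γ = 0 := by
  have hNc : ∀ i, ContDiffOn ℝ 1 (fun y => N y i) (closure Ω) := fun i =>
    ((contDiff_euclidean.1 hN) i).contDiffOn
  have hhc : ∀ k, ContDiffOn ℝ 1 (fun y => h y k) (closure Ω) := contDiffOn_euclidean.1 hh
  have h1 := fun i j k => hΓ.integral_rotForm ((hNc i).mul (hhc k)) (hb j) (hb k) i j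
  have h2 := fun i j k l => hΓ.integral_rotForm
    (((hNc i).mul (hhc k)).mul ((hNc l).mul (hNc j))) (hb l) (hb k) i j
  have i2 := fun i j k => integrable_finsetSum Finset.univ fun l _ => (h2 i j k l).1
  have i3 := fun i j k => (h1 i j k).1.sub (i2 i j k)
  have i4 := fun i j => integrable_finsetSum Finset.univ fun k _ => i3 i j k
  have i5 := fun i => integrable_finsetSum Finset.univ fun j _ => i4 i j
  have i6 := integrable_finsetSum Finset.univ fun i _ => i5 i
  have hae := hΓ.ae_mem.mono fun x hx => hΓ.sum_rotForm_eq hN hNn hh b G hx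
  refine ⟨i6.congr hae, (integral_congr_ae hae).symm.trans ?_⟩
  refine (integral_finsetSum _ fun i _ => i5 i).trans ?_
  refine Finset.sum_eq_zero fun i _ => ?_
  refine (integral_finsetSum _ fun j _ => i4 i j).trans ?_
  refine Finset.sum_eq_zero fun j _ => ?_
  refine (integral_finsetSum _ fun k _ => i3 i j k).trans ?_
  refine Finset.sum_eq_zero fun k _ => ?_
  refine (integral_sub (h1 i j k).1 (i2 i j k)).trans ?_
  rw [integral_finsetSum _ fun l _ => (h2 i j k l).1, Finset.sum_eq_zero fun l _ => (h2 i j k l).2,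
    sub_zero]
  exact (h1 i j k).2

end IsSmoothPiece

/-! ### The boundary identity -/

/-- The pointwise identity, for `h = β n`. The conjugated values and gradient of the second
argument are `w` and `K`, and `H` is the gradient of `h`. -/
theorem impedance_identity (n T w : Fin d → ℂ) (K H : Matrix (Fin d) (Fin d) ℂ)
    (β q c aT aN : ℂ) :
    (aT • T + aN • (c • n)) ⬝ᵥ ((β • n) ᵥ* K)
      = 2 * ((aT • T + aN • (c • n)) ⬝ᵥ ((β • n) ᵥ* ((1 / 2 : ℂ) • (K + Kᵀ))))
        + (aT • T + aN • (c • n)) ⬝ᵥ (H *ᵥ w)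
        + aT * (β * q * (n ⬝ᵥ w)) - aN * ((c • (n ᵥ* H)) ⬝ᵥ w)
        - aN * (β * c * (((1 / 2 : ℂ) • (K + Kᵀ)) *ᵥ n ⬝ᵥ n))
        - aT * ((H *ᵥ w + K *ᵥ (β • n)) ⬝ᵥ T + ((β • n) ⬝ᵥ w) * q) := by
  have h1 : K *ᵥ n ⬝ᵥ n = n ⬝ᵥ n ᵥ* K := by
    rw [dotProduct_comm, Matrix.dotProduct_mulVec, dotProduct_comm]
  have h2 : n ᵥ* H ⬝ᵥ w = n ⬝ᵥ H *ᵥ w := (Matrix.dotProduct_mulVec n H w).symm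
  simp only [Matrix.smul_vecMul, Matrix.vecMul_smul, Matrix.smul_mulVec, Matrix.mulVec_smul,
    Matrix.vecMul_add, Matrix.add_mulVec, Matrix.vecMul_transpose, Matrix.mulVec_transpose,
    add_dotProduct, dotProduct_add, smul_dotProduct, dotProduct_smul, smul_eq_mul, h1, h2,
    dotProduct_comm (H *ᵥ w) T, dotProduct_comm (K *ᵥ n) T, dotProduct_comm n (K *ᵥ n),
    dotProduct_comm (n ᵥ* K) n]
  ring

theorem star_vecMul_real {y : Fin d → ℂ} (hy : star y = y) (G : Matrix (Fin d) (Fin d) ℂ) :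
    star (y ᵥ* G) = y ᵥ* G.map star := by
  funext j
  have h := fun i => congrFun hy i
  simp only [Pi.star_apply] at h
  simp only [Pi.star_apply, Matrix.vecMul, dotProduct, star_sum, star_mul', h, Matrix.map_apply]

theorem star_mulVec_map (y : Fin d → ℂ) (G : Matrix (Fin d) (Fin d) ℂ) :
    star (G *ᵥ y) = G.map star *ᵥ star y := by
  funext j
  simp only [Pi.star_apply, Matrix.mulVec, dotProduct, star_sum, star_mul', Matrix.map_apply]

theorem star_toC (ν : Space d) : star (toC ν) = toC ν := by
  funext j
  simp [toC]

theorem strain_map_star (G : Matrix (Fin d) (Fin d) ℂ) :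
    (strain G).map star = (1 / 2 : ℂ) • (G.map star + (G.map star)ᵀ) := by
  ext i j
  have h2 : (starRingEnd ℂ) 2 = 2 := map_ofNat _ 2
  simp [strain, h2, mul_add]

theorem gradC_map_star (Ω : Set (Space d)) (h : Space d → Space d) (x : Space d) :
    (gradC Ω h x).map star = gradC Ω h x := by
  ext i j
  simp [gradC]

theorem integrable_dotProduct_star {α : Type*} [MeasurableSpace α] {μ : Measure α}
    {f g : α → Fin d → ℂ} (hf : ∀ j, MemLp (fun x => f x j) 2 μ)
    (hg : ∀ j, MemLp (fun x => g x j) 2 μ) : Integrable (fun x => f x ⬝ᵥ star (g x)) μ :=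
  integrable_finsetSum _ fun j _ => (hf j).integrable_mul (hg j).star

theorem integral_linear_combination {α : Type*} [MeasurableSpace α] {μ : Measure α}
    {F F₁ F₂ F₃ F₄ F₅ Z : α → ℂ} {a c : ℂ} (h1 : Integrable F₁ μ) (h2 : Integrable F₂ μ)
    (h3 : Integrable F₃ μ) (h4 : Integrable F₄ μ) (h5 : Integrable F₅ μ) (hZ : Integrable Z μ)
    (hZ0 : ∫ x, Z x ∂μ = 0) (hF : ∀ᵐ x ∂μ, F x = 2 * F₁ x + F₂ x + a * F₃ x - c * F₄ x - c * F₅ x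
      - a * Z x) :
    ∫ x, F x ∂μ = 2 * ∫ x, F₁ x ∂μ + ∫ x, F₂ x ∂μ + a * ∫ x, F₃ x ∂μ - c * ∫ x, F₄ x ∂μ
      - c * ∫ x, F₅ x ∂μ := by
  have k1 := h1.const_mul 2
  have k3 := h3.const_mul a
  have k4 := h4.const_mul c
  have k5 := h5.const_mul c
  have kZ := hZ.const_mul a
  have k12 : Integrable (fun x => 2 * F₁ x + F₂ x) μ := k1.add h2
  have k13 : Integrable (fun x => 2 * F₁ x + F₂ x + a * F₃ x) μ := k12.add k3
  have k14 : Integrable (fun x => 2 * F₁ x + F₂ x + a * F₃ x - c * F₄ x) μ := k13.sub k4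
  have k15 : Integrable (fun x => 2 * F₁ x + F₂ x + a * F₃ x - c * F₄ x - c * F₅ x) μ := k14.sub k5
  rw [integral_congr_ae hF, integral_sub k15 kZ, integral_sub k14 k5, integral_sub k13 k4,
    integral_add k12 k3, integral_add k1 h2]
  simp only [integral_const_mul, hZ0, mul_zero, sub_zero]

namespace IsSmoothPiece

variable {Ω Γ : Set (Space d)}

theorem continuousOn_gradC (hΓ : IsSmoothPiece Ω Γ) {h : Space d → Space d}
    (hh : ContDiffOn ℝ 1 h (closure Ω)) (i j : Fin d) :
    ContinuousOn (fun x => gradC Ω h x i j) Γ := by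
  refine ContinuousOn.congr ?_ fun x hx => hΓ.gradC_apply hh hx i j
  refine Complex.continuous_ofReal.comp_continuousOn fun x hx => ?_
  obtain ⟨G, ρ, hG⟩ := hΓ.exists_chart x hx
  have hb : Metric.ball x (ρ / 2) ∈ 𝓝 x := Metric.ball_mem_nhds x (half_pos hG.pos)
  have h1 := (hG.continuousOn_fderivWithin hΓ.isOpen ((contDiffOn_euclidean.1 hh) j)) x
    ⟨hΓ.subset_closure hx, mem_of_mem_nhds hb⟩
  have h2 : ContinuousWithinAt (fderivWithin ℝ (fun y => h y j) (closure Ω)) Γ x :=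
    ((continuousWithinAt_inter hb).1 h1).mono hΓ.subset_closure
  exact h2.clm_apply continuousWithinAt_const

/-- A function with sufficiently regular weak gradient has a trace gradient, whatever the
representatives of its weak derivatives that have been used. -/
theorem hasTraceGradient (hΓ : IsSmoothPiece Ω Γ) {u a : Space d → ℂ} {Ga : Space d → Fin d → ℂ}
    (hu : HasTraceRegularity Ω u) (hreg : ∀ i, ∃ g, IsWeakPartial Ω i u g ∧ HasTraceRegularity Ω g)
    (ha : IsTrace Ω Γ u a)
    (hG : ∀ i, ∃ g, IsWeakPartial Ω i u g ∧ IsTrace Ω Γ g fun x => Ga x i) :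
    HasTraceGradient Ω Γ a Ga := by
  choose g hg hgr using hreg
  refine ⟨u, g, hu, ha, fun i => ⟨hg i, hgr i, ?_⟩⟩
  obtain ⟨g', hg', ht⟩ := hG i
  exact ⟨ht.1, ht.2.mono fun x hx => hx.congr (hg'.unique hΓ.isOpen (hg i))⟩

/-- The identity on a smooth piece of the boundary, for given traces. -/
theorem bdInner_eq (hΓ : IsSmoothPiece Ω Γ) {h : Space d → Space d}
    (hh : ContDiffOn ℝ 1 h (closure Ω))
    (hcross : ∀ x ∈ Γ, ∀ i j, h x i * outwardNormal Ω x j - h x j * outwardNormal Ω x i = 0)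
    {A : Space d → Matrix (Fin d) (Fin d) ℝ} {aT aN : ℝ}
    (hA : ∀ x ∈ Γ, ∀ ξ : Fin d → ℂ, (A x).map Complex.ofReal *ᵥ ξ =
      (aT : ℂ) • tangentialPart (outwardNormal Ω x) ξ
        + (aN : ℂ) • normalPart (outwardNormal Ω x) ξ)
    {v : Space d → Fin d → ℂ}
    {b : Space d → Fin d → ℂ} {G : Space d → Matrix (Fin d) (Fin d) ℂ} {q : Space d → ℂ}
    (hb : IsVectorTrace Ω Γ v b) (hG : IsGradientTrace Ω Γ v G)
    (hbG : ∀ j, HasTraceGradient Ω Γ (fun x => b x j) fun x i => G x i j)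
    (hq : IsTangentialDivTrace Ω Γ v q) :
    bdInner Γ (fun x => (A x).map Complex.ofReal *ᵥ b x) (fun x => toC (h x) ᵥ* G x) =
      2 * bdInner Γ (fun x => (A x).map Complex.ofReal *ᵥ b x)
            (fun x => toC (h x) ᵥ* strain (G x))
      + bdInner Γ (fun x => (A x).map Complex.ofReal *ᵥ b x)
            (fun x => gradC Ω h x *ᵥ b x)
      + aT * bdInnerScalar Γ (fun x => normalComp (outwardNormal Ω x) (toC (h x)) * q x)
            (fun x => normalComp (outwardNormal Ω x) (b x))
      - aN * bdInner Γ
            (fun x => normalComp (outwardNormal Ω x) (b x) •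
              (toC (outwardNormal Ω x) ᵥ* gradC Ω h x))
            b
      - aN * bdInnerScalar Γ
            (fun x => normalComp (outwardNormal Ω x) (toC (h x)) *
              normalComp (outwardNormal Ω x) (b x))
            (fun x => normalComp (outwardNormal Ω x)
              (strain (G x) *ᵥ toC (outwardNormal Ω x))) := by
  have mb : ∀ j, MemLp (fun x => b x j) 2 (surface Γ) := fun j => (hb j).1
  have mG : ∀ i j, MemLp (fun x => G x i j) 2 (surface Γ) := fun i j => by
    obtain ⟨g, -, hg⟩ := hG i j
    exact hg.1
  -- `N` may be replaced by a field on the whole space that agrees with it near `Γ`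
  obtain ⟨V, N, -, D, hV, hΓV, hN, -, hNn, hD, hqD⟩ := hq
  obtain ⟨N', hN', hNN⟩ := exists_contDiff_eqOn_nhds hV hΓ.isCompact hΓV hN
  have hN'n : ∀ x ∈ Γ, N' x = outwardNormal Ω x := fun x hx =>
    (hNN x hx).self_of_nhds.trans (hNn x hx)
  have mq : MemLp q 2 (surface Γ) := by
    refine (memLp_congr_ae (hΓ.ae_mem.mono fun x hx => hqD x hx)).2
      (hΓ.memLp_tangentialDiv fun i j => ?_)
    obtain ⟨g, -, hg⟩ := hD i j
    exact hg.1
  have hqN : ∀ᵐ x ∂surface Γ, tangentialDiv (outwardNormal Ω x)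
      (tangentialGradient N' G b x) = q x := by
    filter_upwards [hΓ.ae_eq_tangentialGradient hV hΓV hN hb hG hD, hΓ.ae_mem] with x hx hxΓ
    rw [tangentialGradient_congr (hNN x hxΓ), ← hx, hqD x hxΓ]
  obtain ⟨iZ, hZ⟩ := hΓ.integral_tangentialDiv_eq_zero hN' hN'n hh hbG
  -- integrability
  have cn := hΓ.continuousOn_outwardNormal_coord
  have ch : ∀ j, ContinuousOn (fun x => ((h x j : ℝ) : ℂ)) Γ := fun j =>
    Complex.continuous_ofReal.comp_continuousOn
      (((contDiffOn_euclidean.1 hh) j).continuousOn.mono hΓ.subset_closure)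
  have cH := hΓ.continuousOn_gradC hh
  have cβ : ContinuousOn (fun x => normalComp (outwardNormal Ω x) (toC (h x))) Γ :=
    continuousOn_finsetSum Finset.univ fun j _ => (ch j).fun_mul (cn j)
  have cnH : ∀ j, ContinuousOn (fun x => (toC (outwardNormal Ω x) ᵥ* gradC Ω h x) j) Γ := fun j =>
    continuousOn_finsetSum Finset.univ fun i _ => (cn i).fun_mul (cH i j)
  have mbn := hΓ.memLp_normalComp mb
  have mS : ∀ i j, MemLp (fun x => strain (G x) i j) 2 (surface Γ) := fun i j =>
    ((mG i j).add (mG j i)).const_mul (1 / 2 : ℂ)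
  have mA : ∀ j, MemLp (fun x => ((A x).map Complex.ofReal *ᵥ b x) j) 2 (surface Γ) := by
    intro j
    have h1 : ∀ᵐ x ∂surface Γ, ((A x).map Complex.ofReal *ᵥ b x) j
        = aT * tangentialPart (outwardNormal Ω x) (b x) j
          + aN * ((outwardNormal Ω x j : ℂ) * normalComp (outwardNormal Ω x) (b x)) := by
      filter_upwards [hΓ.ae_mem] with x hx
      rw [hA x hx]
      simp [normalPart, toC, mul_comm]
    exact (memLp_congr_ae h1).2 (((hΓ.memLp_tangentialPart mb j).const_mul _).add
      ((hΓ.memLp_mul (cn j) mbn).const_mul _))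
  have i1 := integrable_dotProduct_star mA fun j => memLp_finsetSum (μ := surface Γ) (p := 2)
    Finset.univ fun i _ => hΓ.memLp_mul (ch i) (mS i j)
  have i2 := integrable_dotProduct_star mA fun j => memLp_finsetSum (μ := surface Γ) (p := 2)
    Finset.univ fun k _ => hΓ.memLp_mul (cH j k) (mb k)
  have i3 := (hΓ.memLp_mul cβ mq).integrable_mul mbn.star
  have i4 := integrable_dotProduct_star (fun j => by
    simpa only [mul_comm] using hΓ.memLp_mul (cnH j) mbn) mb
  have i5 := (hΓ.memLp_mul cβ mbn).integrable_mul
    (hΓ.memLp_normalComp fun i => memLp_finsetSum (μ := surface Γ) (p := 2) Finset.univ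
      fun j _ => by
      simpa only [mul_comm] using hΓ.memLp_mul (cn j) (mS i j)).star
  refine integral_linear_combination i1 i2 i3 i4 i5 iZ hZ ?_
  filter_upwards [hΓ.ae_mem, hqN] with x hx hqx
  have hn1 := hΓ.norm_outwardNormal hx
  set ν := outwardNormal Ω x with hν
  -- `h × n = 0` and `|n| = 1`
  have hβ : toC (h x) = normalComp ν (toC (h x)) • toC ν := by
    funext j
    have h0 := EuclideanSpace.real_norm_sq_eq ν
    rw [hn1] at h0
    have h1 : h x j = (∑ i, h x i * ν i) * ν j := by
      rw [Finset.sum_mul]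
      calc h x j = h x j * ∑ i, ν i ^ 2 := by rw [← h0]; ring
        _ = _ := by
          rw [Finset.mul_sum]
          exact Finset.sum_congr rfl fun i _ => by linear_combination -(ν i) * hcross x hx i j
    simp only [toC, normalComp, dotProduct, Pi.smul_apply, smul_eq_mul]
    exact_mod_cast h1
  rw [hA x hx, hqx]
  set β := normalComp ν (toC (h x))
  have key := impedance_identity (toC ν) (tangentialPart ν (b x)) (star (b x)) ((G x).map star)
    (gradC Ω h x) β (q x) (normalComp ν (b x)) aT aN
  have e1 : star (normalComp ν (b x)) = toC ν ⬝ᵥ star (b x) := by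
    rw [normalComp, ← Matrix.star_dotProduct_star, star_toC]
  have e2 : star (normalComp ν (strain (G x) *ᵥ toC ν))
      = (strain (G x)).map star *ᵥ toC ν ⬝ᵥ toC ν := by
    rw [normalComp, ← Matrix.star_dotProduct_star, star_toC, star_mulVec_map, star_toC,
      dotProduct_comm]
  have e3 : ∑ j, star ((gradC Ω h x *ᵥ b x + G x *ᵥ toC (h x)) j) * tangentialPart ν (b x) j
      = (gradC Ω h x *ᵥ star (b x) + (G x).map star *ᵥ toC (h x)) ⬝ᵥ tangentialPart ν (b x) := by
    rw [← gradC_map_star Ω h x, ← star_toC (h x), ← star_mulVec_map, ← star_mulVec_map, star_toC,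
      ← star_add, gradC_map_star]
    rfl
  rw [e1, e2, e3, star_vecMul_real (star_toC _), star_vecMul_real (star_toC _), star_mulVec_map,
    gradC_map_star, strain_map_star, hβ]
  exact key

end IsSmoothPiece

end Boundary

theorem mainTheorem11 (d : ℕ) (hd : d = 2 ∨ d = 3)
    (Ω ΓDir ΓDiss : Set (Space d))
    (hΩ : IsBoundedLipschitzDomain Ω)
    (hDir : IsClosed ΓDir) (hDiss : IsClosed ΓDiss)
    (hcover : ΓDir ∪ ΓDiss = frontier Ω) (hdisj : Disjoint ΓDir ΓDiss)
    (hreg : IsC21Boundary Ω ΓDiss)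
    -- a real vector field `h ∈ C¹(closure Ω)` with `h × n = 0` on `ΓDiss`
    (h : Space d → Space d) (hh : ContDiffOn ℝ 1 h (closure Ω))
    (hcross : ∀ x ∈ ΓDiss, ∀ i j,
      h x i * outwardNormal Ω x j - h x j * outwardNormal Ω x i = 0)
    -- the impedance matrix `A ξ = a_T ξ_T + a_N ξ_N`
    (A : Space d → Matrix (Fin d) (Fin d) ℝ) (aT aN : ℝ)
    (hA : ∀ x ∈ ΓDiss, ∀ ξ : Fin d → ℂ, (A x).map Complex.ofReal *ᵥ ξ =
      (aT : ℂ) • tangentialPart (outwardNormal Ω x) ξ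
        + (aN : ℂ) • normalPart (outwardNormal Ω x) ξ)
    (s : ℝ) (hs : s ∈ Ioc (3 / 2 : ℝ) 2)
    (v : Space d → Fin d → ℂ) (hv : MemHsDir Ω ΓDir s v) :
    -- the traces of `v` and `∇v`, and the tangential divergence of `v_T`, exist in `L²(ΓDiss)`
    (∃ b, IsVectorTrace Ω ΓDiss v b) ∧
    (∃ G, IsGradientTrace Ω ΓDiss v G) ∧
    (∃ q, MemLp q 2 (surface ΓDiss) ∧ IsTangentialDivTrace Ω ΓDiss v q) ∧
    -- and they satisfy the identity
    ∀ (b : Space d → Fin d → ℂ) (G : Space d → Matrix (Fin d) (Fin d) ℂ) (q : Space d → ℂ),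
      IsVectorTrace Ω ΓDiss v b → IsGradientTrace Ω ΓDiss v G →
      IsTangentialDivTrace Ω ΓDiss v q →
      bdInner ΓDiss (fun x => (A x).map Complex.ofReal *ᵥ b x) (fun x => toC (h x) ᵥ* G x) =
        2 * bdInner ΓDiss (fun x => (A x).map Complex.ofReal *ᵥ b x)
              (fun x => toC (h x) ᵥ* strain (G x))
        + bdInner ΓDiss (fun x => (A x).map Complex.ofReal *ᵥ b x)
              (fun x => gradC Ω h x *ᵥ b x)
        + aT * bdInnerScalar ΓDiss (fun x => normalComp (outwardNormal Ω x) (toC (h x)) * q x)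
              (fun x => normalComp (outwardNormal Ω x) (b x))
        - aN * bdInner ΓDiss
              (fun x => normalComp (outwardNormal Ω x) (b x) •
                (toC (outwardNormal Ω x) ᵥ* gradC Ω h x))
              b
        - aN * bdInnerScalar ΓDiss
              (fun x => normalComp (outwardNormal Ω x) (toC (h x)) *
                normalComp (outwardNormal Ω x) (b x))
              (fun x => normalComp (outwardNormal Ω x)
                (strain (G x) *ᵥ toC (outwardNormal Ω x))) := by 
  have hbd := hΩ.isBounded
  have hΓ : IsSmoothPiece Ω ΓDiss :=
    { one_le := by omega
      isOpen := hΩ.isOpen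
      isBounded := hbd
      isCompact := Metric.isCompact_of_isClosed_isBounded hDiss
        (hbd.closure.subset ((subset_union_right.trans_eq hcover).trans frontier_subset_closure))
      exists_chart := fun x hx => exists_isChart hΩ.isOpen hDir hcover hdisj hreg hx }
  have hr := fun j => (hv.1 j).hasTraceRegularity hs
  choose b hb using fun j => hΓ.exists_isTrace (hr j).1
  choose g hg hgr using fun j => (hr j).2
  choose G hG using fun i j => hΓ.exists_isTrace (hgr j i)
  have hb' : IsVectorTrace Ω ΓDiss v fun x j => b j x := hb
  have hG' : IsGradientTrace Ω ΓDiss v fun x => Matrix.of fun i j => G i j x :=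
    fun i j => ⟨g j i, hg j i, hG i j⟩
  refine ⟨⟨_, hb'⟩, ⟨_, hG'⟩, hΓ.exists_isTangentialDivTrace hb' hG', fun b G q hb hG hq => ?_⟩
  exact hΓ.bdInner_eq hh hcross hA hb hG
    (fun j => hΓ.hasTraceGradient (hr j).1 (hr j).2 (hb j) fun i => hG i j) hq
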